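/- **Setting.** All rings are unital. A *pseudocompact ring* is a Hausdorff complete topological ring $R$ having a fundamental system of open neighbourhoods of $0$ consisting of left ideals $L$ with $R/L$ of finite length. Let $R$ be a (left and right) noetherian pseudocompact ring, $\sigma$ a topological automorphism of $R$, and $\delta:R\to R$ a continuous left $\sigma$-derivation, i.e. $\delta$ is additive and $\delta(ab)=\delta(a)b+\sigma(a)\delta(b)$. Assume that $\delta$ is $\sigma$-nilpotent: for every $n\ge 1$ there is $m\ge 1$ such that every composition of maps from $\{\delta,\sigma,\sigma^{-1}\}$ in which $\delta$ occurs at least $m$ times maps $R$ into $\mathrm{Jac}(R)^n$. Let $S=R[[t;\sigma,\delta]]$ be the skew power series ring: the left $R$-module of formal power series $\sum_{i\ge0}a_it^i$ with the product topology and the continuous multiplication determined by $ta=\sigma(a)t+\delta(a)$ for $a\in R$. Assume that $S$ is (left and right) noetherian. **Twisted duals.** Give a finitely generated left $S$-module $N$ its pseudocompact topology, that is, the quotient topology from any surjection $S^k\to N$. The group $\mathrm{Hom}^{c}_R(N,R)$ of continuous left $R$-linear maps $N\to R$ is a right $S$-module, functorially in $N$, with $$f^a(n)=f(n)\,\sigma^{-1}(a)\quad(a\in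 R),\qquad f^t(n)=\sigma^{-1}\bigl(f(tn)-\delta(f(n))\bigr),$$ extended to $S$ by continuity: for $x=\sum_i t^ia_i$ one has the convergent sum $f^x(n)=\sum_{i}\bigl((f^{t^i})^{a_i}\bigr)(n)$. Denote it by $\mathrm{Hom}^{c}_R(N,R)^\sigma$. For a left $S$-module $M$ with a resolution $P_\bullet\to M$ by finitely generated projective $S$-modules, define the right $S$-modules $$\mathrm{Ext}^j_R(M,R)^\sigma:=H^j\bigl(\mathrm{Hom}^{c}_R(P_\bullet,R)^\sigma\bigr),\qquad j\ge0 .$$ **Proposition 3.1** (a generalised Rees lemma). Let $M$ be a left $S$-module which is finitely generated as an $R$-module. Then: 1. $\mathrm{Hom}_S(M,S)=0$. 2. The underlying group of $\mathrm{Ext}^j_R(M,R)^\sigma$ is the usual $\mathrm{Ext}^j_R(M,R)$, with $R$ acting through $\sigma^{-1}$. More precisely, for every $j\ge0$ and every $P_\bullet$ as above there is an isomorphism of groups $c:\mathrm{Ext}^j_R(M,R)^\sigma\to\mathrm{Ext}^j_R(M,R)$ with $c(x\cdot a)=c(x)\,\sigma^{-1}(a)$ for $a\in R$, such that, for every resolution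 $Q_\bullet\to M$ by projective $R$-modules and every $R$-linear morphism of complexes $\varphi:Q_\bullet\to P_\bullet$ over $\mathrm{id}_M$, $c$ sends the class of a cocycle $z$ to the class of $z\circ\varphi_j$. 3. For every $j\ge1$ there is an isomorphism of right $S$-modules $$\mathrm{Ext}^j_S(M,S)\;\cong\;\mathrm{Ext}^{j-1}_R(M,R)^\sigma .$$ These isomorphisms can be chosen natural in $M$: they are compatible with the maps induced by an $S$-linear map $M\to M'$ between modules as above and by any morphism over it between the chosen resolutions. -/

import Mathlib

universe u

section Definitions

open Filter Topology

set_option linter.unusedSectionVars false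
set_option linter.style.haveILetI false

/-- A (left) pseudocompact ring: a Hausdorff, complete topological ring with a fundamental system
of open neighbourhoods of zero consisting of left ideals `L` with `R ⧸ L` of finite length.
(`Ideal R` means left ideal for a noncommutative ring `R`.) -/
class PseudocompactRing (R : Type u) [Ring R] [UniformSpace R] : Prop extends
    IsUniformAddGroup R, IsTopologicalRing R, CompleteSpace R, T2Space R where
  exists_open_ideal : ∀ U ∈ 𝓝 (0 : R), ∃ L : Ideal R,
    IsOpen (L : Set R) ∧ IsFiniteLength R (R ⧸ L) ∧ (L : Set R) ⊆ U

namespace PseudocompactRing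

section Basic

variable {R : Type u} [Ring R]

theorem exists_jacobson_pow_le_annihilator {M : Type u} [AddCommGroup M] [Module R M]
    (h : IsFiniteLength R M) : ∃ n : ℕ, Ring.jacobson R ^ n ≤ Module.annihilator R M := by
  induction h with
  | of_subsingleton =>
    exact ⟨0, fun a _ => Module.mem_annihilator.2 fun m => Subsingleton.elim _ _⟩
  | @of_simple_quotient M _ _ N hs _ ih =>
    obtain ⟨n, hn⟩ := ih
    refine ⟨n + 1, ?_⟩
    rw [Submodule.pow_succ, Ideal.mul_le]
    intro a ha b hb
    rw [Module.mem_annihilator]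
    intro m
    have hb' : b • m ∈ N := by
      have := IsSemisimpleModule.jacobson_le_annihilator R (M ⧸ N) hb
      have := Module.mem_annihilator.1 this (N.mkQ m)
      rwa [← map_smul, Submodule.mkQ_apply, Submodule.Quotient.mk_eq_zero] at this
    have := Module.mem_annihilator.1 (hn ha) ⟨b • m, hb'⟩
    simpa [mul_smul] using congrArg Subtype.val this

theorem exists_jacobson_pow_le {L : Ideal R} (h : IsFiniteLength R (R ⧸ L)) :
    ∃ n : ℕ, Ring.jacobson R ^ n ≤ L := by
  obtain ⟨n, hn⟩ := exists_jacobson_pow_le_annihilator h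
  refine ⟨n, fun a ha => ?_⟩
  have := Module.mem_annihilator.1 (hn ha) (L.mkQ 1)
  rw [← map_smul, Submodule.mkQ_apply, Submodule.Quotient.mk_eq_zero] at this
  simpa using this

/-- A set is a coset of a left ideal. -/
def IsCoset (s : Set R) (L : Ideal R) : Prop := ∃ a ∈ s, ∀ x, x ∈ s ↔ x - a ∈ L

theorem IsCoset.sub_mem {s : Set R} {L : Ideal R} (h : IsCoset s L) {x y : R} (hx : x ∈ s)
    (hy : y ∈ s) : x - y ∈ L := by
  obtain ⟨a, _, h⟩ := h
  simpa using L.sub_mem ((h x).1 hx) ((h y).1 hy)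

theorem IsCoset.add_mem {s : Set R} {L : Ideal R} (h : IsCoset s L) {x y : R} (hx : x ∈ s)
    (hy : y ∈ L) : x + y ∈ s := by
  obtain ⟨a, _, h⟩ := h
  rw [h, add_sub_right_comm]
  exact L.add_mem ((h x).1 hx) hy

theorem isArtinian_quotient_mul {I A : Ideal R} [I.IsTwoSided] [IsArtinian R (R ⧸ I)]
    [IsArtinian R (R ⧸ A)] (hA : A.FG) : IsArtinian R (R ⧸ (I * A)) := by
  classical
  obtain ⟨s, hs⟩ := hA
  have hmem : ∀ x : s, (x : R) ∈ A := fun x => by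
    rw [← hs]
    exact Submodule.subset_span x.2
  have hA' : ∀ B : Ideal R, (∀ x : s, (x : R) ∈ B) → A ≤ B := fun B hB => by
    rw [← hs, Ideal.span_le]
    exact fun x hx => hB ⟨x, hx⟩
  let f1 : ∀ x : s, (R ⧸ I) →ₗ[R] (R ⧸ (I * A)) := fun x =>
    Submodule.liftQ I ((I * A).mkQ.comp (LinearMap.toSpanSingleton R R (x : R))) (by
      intro r hr
      rw [LinearMap.mem_ker]
      simp only [LinearMap.comp_apply, LinearMap.toSpanSingleton_apply, smul_eq_mul,
        Submodule.mkQ_apply, Submodule.Quotient.mk_eq_zero]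
      exact Ideal.mul_mem_mul hr (hmem x))
  have hle : I * A ≤ A := Ideal.mul_le_right
  refine isArtinian_of_range_eq_ker (LinearMap.lsum R (fun _ : s => R ⧸ I) ℕ f1)
    (Submodule.factor hle) ?_
  apply le_antisymm
  · rintro _ ⟨c, rfl⟩
    rw [LinearMap.mem_ker, LinearMap.lsum_apply, LinearMap.sum_apply, map_sum]
    refine Finset.sum_eq_zero fun x _ => ?_
    obtain ⟨r, hr⟩ := Submodule.mkQ_surjective I (c x)
    rw [LinearMap.comp_apply, LinearMap.proj_apply, ← hr, Submodule.mkQ_apply]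
    simp only [f1, Submodule.liftQ_apply, LinearMap.comp_apply, LinearMap.toSpanSingleton_apply,
      Submodule.mkQ_apply]
    exact (Submodule.Quotient.mk_eq_zero A).2 (A.smul_mem r (hmem x))
  · intro y hy
    obtain ⟨z, rfl⟩ := Submodule.mkQ_surjective _ y
    rw [LinearMap.mem_ker, Submodule.factor_mk, Submodule.mkQ_apply,
      Submodule.Quotient.mk_eq_zero] at hy
    have : A ≤ Submodule.comap (I * A).mkQ
        (LinearMap.range (LinearMap.lsum R (fun _ : s => R ⧸ I) ℕ f1)) := by
      refine hA' _ fun x => ⟨Pi.single x (I.mkQ 1), ?_⟩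
      rw [LinearMap.lsum_piSingle]
      exact (Submodule.liftQ_apply I _ 1).trans (by simp)
    exact this hy

variable [UniformSpace R] [PseudocompactRing R]

theorem isArtinian_of_isOpen {L : Ideal R} (h : IsOpen (L : Set R)) : IsArtinian R (R ⧸ L) := by
  obtain ⟨L', _, h2, h3⟩ := exists_open_ideal _ (h.mem_nhds L.zero_mem)
  have : IsArtinian R (R ⧸ L') := (isFiniteLength_iff_isNoetherian_isArtinian.1 h2).2
  exact isArtinian_of_surjective (R ⧸ L') (Submodule.factor (show L' ≤ L from h3))
    (Submodule.factor_surjective _)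

/-- Linear compactness of a pseudocompact ring. -/
theorem linearlyCompact (A : Set (Set R)) (hne : A.Nonempty)
    (hc : ∀ s ∈ A, ∃ L, IsCoset s L) (hcl : ∀ s ∈ A, IsClosed s)
    (hd : ∀ s ∈ A, ∀ t ∈ A, ∃ u ∈ A, u ⊆ s ∩ t) : ∃ x, ∀ s ∈ A, x ∈ s := by
  let P : Set (Set (Set R)) :=
    {B | (∀ s ∈ B, ∃ L, IsCoset s L) ∧ ∀ s ∈ B, ∀ t ∈ B, ∃ u ∈ B, u ⊆ s ∩ t}
  obtain ⟨B, hAB, hB⟩ := zorn_subset_nonempty P (by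
    intro c hcP hchain _
    refine ⟨⋃₀ c, ⟨?_, ?_⟩, fun s hs => Set.subset_sUnion_of_mem hs⟩
    · rintro s ⟨B, hB, hs⟩
      exact (hcP hB).1 s hs
    · rintro s ⟨B, hB, hs⟩ t ⟨B', hB', ht⟩
      rcases hchain.total hB hB' with h | h
      · obtain ⟨u, hu, h'⟩ := (hcP hB').2 s (h hs) t ht
        exact ⟨u, ⟨B', hB', hu⟩, h'⟩
      · obtain ⟨u, hu, h'⟩ := (hcP hB).2 s hs t (h ht)
        exact ⟨u, ⟨B, hB, hu⟩, h'⟩) A ⟨hc, hd⟩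
  have hBP : B ∈ P := hB.prop
  -- every coset of an open ideal which meets all members contains a member
  have key : ∀ L : Ideal R, IsOpen (L : Set R) → ∃ b, ∃ s ∈ B, ∀ x ∈ s, x - b ∈ L := by
    intro L hL
    have : IsArtinian R (R ⧸ L) := isArtinian_of_isOpen hL
    let Y : Set (Submodule R (R ⧸ L)) := {K | ∃ s ∈ B, ∃ K', IsCoset s K' ∧ K = Submodule.map L.mkQ K'}
    have hY : Y.Nonempty := by
      obtain ⟨s, hs⟩ := hne
      obtain ⟨K', hK⟩ := hc s hs
      exact ⟨_, s, hAB hs, K', hK, rfl⟩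
    obtain ⟨K, ⟨s0, hs0, K0, hK0, rfl⟩, hmin⟩ := IsWellFounded.wf.has_min (r := (· < ·)) Y hY
    have hs0c := hK0
    obtain ⟨b, hb, -⟩ := hs0c
    let c : Set R := {x | x - b ∈ L}
    have meet : ∀ t ∈ B, (c ∩ t).Nonempty := by
      intro t ht
      obtain ⟨v, hv, hvst⟩ := hBP.2 s0 hs0 t ht
      obtain ⟨K1, hK1⟩ := hBP.1 v hv
      have hle : K1 ≤ K0 := by
        obtain ⟨z, hz, -⟩ := id hK1
        intro k hk
        simpa using hK0.sub_mem (hvst (hK1.add_mem hz hk)).1 (hvst hz).1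
      have hmap : Submodule.map L.mkQ K1 = Submodule.map L.mkQ K0 :=
        eq_of_le_of_not_lt (Submodule.map_mono hle) (hmin _ ⟨v, hv, K1, hK1, rfl⟩)
      obtain ⟨z, hz, -⟩ := id hK1
      have hbz : L.mkQ (b - z) ∈ Submodule.map L.mkQ K1 := by
        rw [hmap]
        exact Submodule.mem_map_of_mem (hK0.sub_mem hb (hvst hz).1)
      obtain ⟨k, hk, hkz⟩ := hbz
      refine ⟨z + k, ?_, (hvst (hK1.add_mem hz hk)).2⟩
      have : k - (b - z) ∈ L := by
        rw [← Submodule.Quotient.mk_eq_zero, ← Submodule.mkQ_apply, map_sub, hkz, sub_self]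
      show z + k - b ∈ L
      convert this using 1
      abel
    have hcc : IsCoset c L := ⟨b, by simp [c], fun x => Iff.rfl⟩
    have hB' : B ∪ (fun s => c ∩ s) '' B ∈ P := by
      refine ⟨?_, ?_⟩
      · rintro s (hs | ⟨s, hs, rfl⟩)
        · exact hBP.1 s hs
        · obtain ⟨K1, hK1⟩ := hBP.1 s hs
          obtain ⟨z, hz⟩ := meet s hs
          refine ⟨L ⊓ K1, z, hz, fun x => ⟨fun hx => ⟨hcc.sub_mem hx.1 hz.1,
            hK1.sub_mem hx.2 hz.2⟩, fun hx => ⟨?_, ?_⟩⟩⟩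
          · simpa using hcc.add_mem hz.1 hx.1
          · simpa using hK1.add_mem hz.2 hx.2
      · rintro s (hs | ⟨s, hs, rfl⟩) t (ht | ⟨t, ht, rfl⟩) <;>
          obtain ⟨v, hv, hvst⟩ := hBP.2 s hs t ht
        · exact ⟨v, Or.inl hv, hvst⟩
        · exact ⟨c ∩ v, Or.inr ⟨v, hv, rfl⟩, fun x hx => ⟨(hvst hx.2).1, hx.1, (hvst hx.2).2⟩⟩
        · exact ⟨c ∩ v, Or.inr ⟨v, hv, rfl⟩, fun x hx => ⟨⟨hx.1, (hvst hx.2).1⟩, (hvst hx.2).2⟩⟩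
        · exact ⟨c ∩ v, Or.inr ⟨v, hv, rfl⟩,
            fun x hx => ⟨⟨hx.1, (hvst hx.2).1⟩, hx.1, (hvst hx.2).2⟩⟩
    have hsub := hB.le_of_ge hB' Set.subset_union_left
    exact ⟨b, c ∩ s0, hsub (Or.inr ⟨s0, hs0, rfl⟩), fun x hx => hx.1⟩
  let F : Filter R := ⨅ s ∈ B, 𝓟 s
  have hBne : B.Nonempty := hne.mono hAB
  have hdir : DirectedOn ((fun s : Set R => 𝓟 s) ⁻¹'o (· ≥ ·)) B := by
    intro s hs t ht
    obtain ⟨v, hv, h⟩ := hBP.2 s hs t ht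
    exact ⟨v, hv, principal_mono.2 (h.trans Set.inter_subset_left),
      principal_mono.2 (h.trans Set.inter_subset_right)⟩
  have hF : ∀ U, U ∈ F ↔ ∃ s ∈ B, s ⊆ U := by
    intro U
    rw [mem_biInf_of_directed hdir hBne]
    simp
  have hFne : F.NeBot := by
    rw [← forall_mem_nonempty_iff_neBot]
    intro U hU
    obtain ⟨s, hs, hsU⟩ := (hF U).1 hU
    obtain ⟨L, a, ha, -⟩ := hBP.1 s hs
    exact ⟨a, hsU ha⟩
  have hcau : Cauchy F := by
    refine ⟨hFne, ?_⟩
    rw [uniformity_eq_comap_nhds_zero, ← map_le_iff_le_comap]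
    intro U hU
    obtain ⟨L, hL, -, hLU⟩ := exists_open_ideal U hU
    obtain ⟨b, s, hs, hsL⟩ := key L hL
    rw [mem_map]
    refine mem_of_superset (prod_mem_prod ((hF s).2 ⟨s, hs, subset_rfl⟩)
      ((hF s).2 ⟨s, hs, subset_rfl⟩)) ?_
    rintro ⟨x, y⟩ ⟨hx, hy⟩
    apply hLU
    simpa using L.sub_mem (hsL y hy) (hsL x hx)
  obtain ⟨x, hx⟩ := CompleteSpace.complete hcau
  refine ⟨x, fun s hs => ?_⟩
  rw [← (hcl s hs).closure_eq, mem_closure_iff_clusterPt]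
  have : F ≤ 𝓝 x ⊓ 𝓟 s := le_inf hx (le_principal_iff.2 ((hF s).2 ⟨s, hAB hs, subset_rfl⟩))
  exact hFne.mono this

theorem isOpen_of_le {L L' : Ideal R} (hL : IsOpen (L : Set R)) (h : L ≤ L') :
    IsOpen (L' : Set R) :=
  AddSubgroup.isOpen_mono (H₁ := L.toAddSubgroup) (H₂ := L'.toAddSubgroup) h hL

theorem isClosed_of_isOpen {L : Ideal R} (hL : IsOpen (L : Set R)) : IsClosed (L : Set R) :=
  AddSubgroup.isClosed_of_isOpen L.toAddSubgroup hL

theorem mem_of_forall_mem_sup {N : Ideal R} (hN : IsClosed (N : Set R)) {y : R}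
    (h : ∀ L : Ideal R, IsOpen (L : Set R) → y ∈ N ⊔ L) : y ∈ N := by
  rw [← SetLike.mem_coe, ← hN.closure_eq, mem_closure_iff_nhds_zero]
  intro U hU
  obtain ⟨L, hL, -, hLU⟩ := exists_open_ideal U hU
  obtain ⟨n, hn, l, hl, rfl⟩ := Submodule.mem_sup.1 (h L hL)
  exact ⟨n, hn, hLU (by simpa using L.neg_mem hl)⟩

theorem mem_sup_of_mem_closure {N : Ideal R} {y : R} (hy : y ∈ closure (N : Set R))
    {L : Ideal R} (hL : IsOpen (L : Set R)) : y ∈ N ⊔ L := by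
  rw [mem_closure_iff_nhds_zero] at hy
  obtain ⟨n, hn, h⟩ := hy L (hL.mem_nhds L.zero_mem)
  have : y = n - (n - y) := by abel
  rw [this]
  exact Submodule.sub_mem _ (Submodule.mem_sup_left hn) (Submodule.mem_sup_right h)

theorem isClosed_span_singleton_sup {N : Ideal R} (hN : IsClosed (N : Set R)) (x : R) :
    IsClosed ((Submodule.span R {x} ⊔ N : Ideal R) : Set R) := by
  rw [← closure_subset_iff_isClosed]
  intro y hy
  let A : Set (Set R) := {s | ∃ L : Ideal R, IsOpen (L : Set R) ∧ s = {r | r * x - y ∈ N ⊔ L}}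
  obtain ⟨r, hr⟩ := linearlyCompact A ⟨_, ⊤, by simp, rfl⟩ (by
      rintro s ⟨L, hL, rfl⟩
      have := mem_sup_of_mem_closure hy hL
      rw [sup_assoc] at this
      obtain ⟨z, hz, n, hn, hzn⟩ := Submodule.mem_sup.1 this
      obtain ⟨a, rfl⟩ := Submodule.mem_span_singleton.1 hz
      have ha : a * x - y ∈ N ⊔ L := by
        rw [← hzn]
        simpa using Submodule.neg_mem _ hn
      refine ⟨Submodule.comap (LinearMap.toSpanSingleton R R x) (N ⊔ L), a, ha, fun r => ?_⟩
      simp only [Set.mem_ofPred_eq, Submodule.mem_comap, LinearMap.toSpanSingleton_apply,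
        smul_eq_mul, sub_mul]
      constructor
      · intro h
        simpa using Submodule.sub_mem _ h ha
      · intro h
        simpa using Submodule.add_mem _ h ha) (by
      rintro s ⟨L, hL, rfl⟩
      have : IsClosed ((N ⊔ L : Ideal R) : Set R) := isClosed_of_isOpen (isOpen_of_le hL le_sup_right)
      exact this.preimage (f := fun r => r * x - y) (by fun_prop)) (by
      rintro s ⟨L, hL, rfl⟩ t ⟨L', hL', rfl⟩
      refine ⟨_, ⟨L ⊓ L', hL.inter hL', rfl⟩, fun r hr => ⟨?_, ?_⟩⟩
      · exact sup_le_sup_left inf_le_left N hr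
      · exact sup_le_sup_left inf_le_right N hr)
  have hmem : r * x - y ∈ N := mem_of_forall_mem_sup hN fun L hL => hr _ ⟨L, hL, rfl⟩
  have : y = r * x - (r * x - y) := by abel
  rw [this]
  exact Submodule.sub_mem _ (Submodule.mem_sup_left (Submodule.mem_span_singleton.2 ⟨r, rfl⟩))
    (Submodule.mem_sup_right hmem)

theorem isClosed_of_fg {N : Ideal R} (hN : N.FG) : IsClosed (N : Set R) := by
  obtain ⟨s, rfl⟩ := hN
  classical
  induction s using Finset.induction_on with
  | empty => simp
  | insert a s _ ih =>
    rw [Finset.coe_insert, Ideal.span_insert]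
    exact isClosed_span_singleton_sup ih a

theorem isOpen_of_isClosed_of_isArtinian {I : Ideal R} (hI : IsClosed (I : Set R))
    [IsArtinian R (R ⧸ I)] : IsOpen (I : Set R) := by
  let Y : Set (Submodule R (R ⧸ I)) :=
    {K | ∃ L : Ideal R, IsOpen (L : Set R) ∧ K = Submodule.map I.mkQ L}
  obtain ⟨K, ⟨L0, hL0, rfl⟩, hmin⟩ := IsWellFounded.wf.has_min (r := (· < ·)) Y
    ⟨_, ⊤, by simp, rfl⟩
  refine isOpen_of_le hL0 fun x hx => mem_of_forall_mem_sup hI fun L hL => ?_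
  have hmap : Submodule.map I.mkQ (L0 ⊓ L) = Submodule.map I.mkQ L0 :=
    eq_of_le_of_not_lt (Submodule.map_mono inf_le_left) (hmin _ ⟨L0 ⊓ L, hL0.inter hL, rfl⟩)
  have : I.mkQ x ∈ Submodule.map I.mkQ (L0 ⊓ L) := hmap ▸ Submodule.mem_map_of_mem hx
  obtain ⟨k, hk, hkx⟩ := this
  have h2 : x - k ∈ I := by
    rw [← Submodule.Quotient.mk_eq_zero, ← Submodule.mkQ_apply, map_sub, hkx, sub_self]
  have : x = (x - k) + k := by abel
  rw [this]
  exact Submodule.add_mem _ (Submodule.mem_sup_left h2) (Submodule.mem_sup_right hk.2)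

theorem isOpen_of_isMaximal [IsNoetherianRing R] {m : Ideal R} (hm : m.IsMaximal) :
    IsOpen (m : Set R) := by
  have hcl := isClosed_of_fg (IsNoetherian.noetherian m)
  by_contra hno
  apply hm.ne_top
  rw [Ideal.eq_top_iff_one]
  refine mem_of_forall_mem_sup hcl fun L hL => ?_
  have : m ⊔ L = ⊤ := by
    by_contra h
    have := hm.eq_of_le h le_sup_left
    exact hno (isOpen_of_le hL (this ▸ le_sup_right))
  rw [this]
  trivial

theorem isOpen_jacobson [IsNoetherianRing R] : IsOpen (Ring.jacobson R : Set R) := by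
  by_contra hno
  have hex : ∀ I : Ideal R, ∃ m : Ideal R, m.IsMaximal ∧ (IsOpen (I : Set R) → ¬ I ≤ m) := by
    intro I
    by_contra h
    push Not at h
    by_cases hI : IsOpen (I : Set R)
    · apply hno
      refine isOpen_of_le hI ?_
      rw [Ring.jacobson_eq_sInf_isMaximal]
      exact le_sInf fun m hm => (h m hm).2
    · by_cases hR : Subsingleton R
      · apply hI
        have : (I : Set R) = Set.univ := by
          ext x; simp [Subsingleton.elim x 0]
        rw [this]; exact isOpen_univ
      · rw [not_subsingleton_iff_nontrivial] at hR
        obtain ⟨m, hm⟩ := Ideal.exists_maximal R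
        exact hI (h m hm).1
  choose m hm hle using hex
  let I : ℕ → Ideal R := fun k => Nat.rec ⊤ (fun _ I => I ⊓ m I) k
  have hI1 : ∀ k, I (k + 1) = I k ⊓ m (I k) := fun k => rfl
  have hIo : ∀ k : ℕ, IsOpen (SetLike.coe (I k)) := by
    intro k
    induction k with
    | zero => simp [I]
    | succ k ih =>
    exact IsOpen.inter ih (isOpen_of_isMaximal (hm (I k)))
  have hIanti : Antitone I := antitone_nat_of_succ_le fun k => inf_le_left
  let A : ℕ →o Ideal R := ⟨fun n => ⨅ i, ⨅ _ : n ≤ i, m (I i), fun a b hab =>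
    le_iInf₂ fun i hi => iInf₂_le i (hab.trans hi)⟩
  obtain ⟨n, hn⟩ := monotone_stabilizes_iff_noetherian.2 ‹IsNoetherianRing R› A
  have heq := hn (n + 1) (Nat.le_succ n)
  have hA : ∀ (n : ℕ) (x : R), x ∈ A n ↔ ∀ i : ℕ, n ≤ i → x ∈ m (I i) := by
    intro n x
    have h : A n = ⨅ i, ⨅ _ : n ≤ i, m (I i) := rfl
    rw [h]
    simp only [Submodule.mem_iInf]
  -- construct an element of `A (n + 1)` outside `A n`
  obtain ⟨a0, -, ha0⟩ := SetLike.not_le_iff_exists.1 (hle (I n) (hIo n))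
  have hstep : ∀ (k : ℕ) (a : R), ∃ v ∈ m (I k), a - v ∈ I k := by
    intro k a
    have htop : m (I k) ⊔ I k = ⊤ := by
      by_contra h
      have := (hm (I k)).eq_of_le h le_sup_left
      exact hle (I k) (hIo k) (this ▸ le_sup_right)
    have : a ∈ m (I k) ⊔ I k := htop ▸ Submodule.mem_top
    obtain ⟨v, hv, w, hw, rfl⟩ := Submodule.mem_sup.1 this
    exact ⟨v, hv, by simpa using hw⟩
  choose! v hv hva using hstep
  let a : ℕ → R := fun k => Nat.rec a0 (fun j b => v (n + 1 + j) b) k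
  have ha1 : ∀ k, a (k + 1) = v (n + 1 + k) (a k) := fun k => rfl
  let s : ℕ → Set R := fun k => {x | x - a k ∈ I (n + 1 + k)}
  have hsanti : Antitone s := by
    refine antitone_nat_of_succ_le fun k x hx => ?_
    have h1 : x - a (k + 1) ∈ I (n + 1 + k) := hIanti (show n + 1 + k ≤ n + 1 + (k + 1) by omega) hx
    have h2 := hva (n + 1 + k) (a k)
    rw [← ha1] at h2
    show x - a k ∈ I (n + 1 + k)
    have := Submodule.sub_mem _ h1 h2
    simpa using this
  obtain ⟨x, hx⟩ := linearlyCompact (Set.range s) ⟨_, 0, rfl⟩ (by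
      rintro _ ⟨k, rfl⟩
      exact ⟨I (n + 1 + k), a k, by simp [s], fun x => Iff.rfl⟩) (by
      rintro _ ⟨k, rfl⟩
      exact (isClosed_of_isOpen (hIo (n + 1 + k))).preimage (f := fun x => x - a k)
        (by fun_prop)) (by
      rintro _ ⟨k, rfl⟩ _ ⟨l, rfl⟩
      exact ⟨_, ⟨max k l, rfl⟩, Set.subset_inter (hsanti (le_max_left k l))
        (hsanti (le_max_right k l))⟩)
  have hx' : ∀ k, x - a k ∈ I (n + 1 + k) := fun k => hx _ ⟨k, rfl⟩
  have hxA : x ∈ A (n + 1) := by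
    rw [hA]
    intro i hi
    obtain ⟨k, rfl⟩ := Nat.exists_eq_add_of_le hi
    have h1 := hx' (k + 1)
    rw [show n + 1 + (k + 1) = (n + 1 + k) + 1 by ring, hI1] at h1
    have h2 := hv (n + 1 + k) (a k)
    rw [← ha1] at h2
    simpa using Submodule.add_mem _ h1.2 h2
  rw [← heq] at hxA
  have hxn : x ∈ m (I n) := (hA n x).1 hxA n le_rfl
  have h0 := hx' 0
  rw [add_zero, hI1] at h0
  apply ha0
  have := Submodule.sub_mem _ hxn h0.2
  simpa [a] using this

theorem isOpen_jacobson_pow [IsNoetherianRing R] (n : ℕ) :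
    IsOpen ((Ring.jacobson R ^ n : Ideal R) : Set R) := by
  induction n with
  | zero => simp [Submodule.pow_zero, Ideal.one_eq_top]
  | succ n ih =>
    have h1 : IsArtinian R (R ⧸ Ring.jacobson R) := isArtinian_of_isOpen isOpen_jacobson
    have h2 : IsArtinian R (R ⧸ (Ring.jacobson R ^ n)) := isArtinian_of_isOpen ih
    have h3 : IsArtinian R (R ⧸ (Ring.jacobson R * Ring.jacobson R ^ n)) :=
      isArtinian_quotient_mul (IsNoetherian.noetherian _)
    rw [Ideal.IsTwoSided.pow_succ]
    exact isOpen_of_isClosed_of_isArtinian (isClosed_of_fg (IsNoetherian.noetherian _))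

theorem exists_jacobson_pow_subset {U : Set R} (hU : U ∈ 𝓝 (0 : R)) :
    ∃ n : ℕ, ((Ring.jacobson R ^ n : Ideal R) : Set R) ⊆ U := by
  obtain ⟨L, -, hL, hLU⟩ := exists_open_ideal U hU
  obtain ⟨n, hn⟩ := exists_jacobson_pow_le hL
  exact ⟨n, subset_trans hn hLU⟩

end Basic

end PseudocompactRing

/-- The monomials `M(δ, σ, σ⁻¹)` in a family of maps: `IsMonomial σ δ k w` says that `w : R → R` is
obtained by evaluating at `(δ, σ, σ⁻¹)` some noncommutative monomial in three variables
`Y, Z, Z'` with exactly `k` factors `Y`. -/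
inductive IsMonomial {R : Type u} [Ring R] (σ : R ≃+* R) (δ : R →+ R) : ℕ → (R → R) → Prop
  | one : IsMonomial σ δ 0 id
  | delta {k : ℕ} {w : R → R} : IsMonomial σ δ k w → IsMonomial σ δ (k + 1) (fun a => δ (w a))
  | sigma {k : ℕ} {w : R → R} : IsMonomial σ δ k w → IsMonomial σ δ k (fun a => σ (w a))
  | sigmaInv {k : ℕ} {w : R → R} :
      IsMonomial σ δ k w → IsMonomial σ δ k (fun a => σ.symm (w a))

/-- The data `(σ, δ)` from which a skew power series ring over `R` is built: a topological
automorphism `σ` of `R` and a continuous left `σ`-derivation `δ` which is `σ`-nilpotent. -/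
structure SkewDatum (R : Type u) [Ring R] [TopologicalSpace R] where
  σ : R ≃+* R
  continuous_σ : Continuous σ
  continuous_σ_symm : Continuous σ.symm
  δ : R →+ R
  continuous_δ : Continuous δ
  /-- `δ` is a left `σ`-derivation -/
  δ_mul : ∀ a b : R, δ (a * b) = δ a * b + σ a * δ b
  /-- `δ` is `σ`-nilpotent -/
  nilpotent : ∀ n : ℕ, 1 ≤ n → ∃ m : ℕ, 1 ≤ m ∧ ∀ k, m ≤ k → ∀ w : R → R, IsMonomial σ δ k w →
    ∀ a : R, w a ∈ Ring.jacobson R ^ n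

/-- The underlying additive group of `R[[t;σ,δ]]`: the left formal power series
`∑ i, a i * t ^ i`, given by their sequences of coefficients. -/
def SkewPowerSeries {R : Type u} [Ring R] [TopologicalSpace R] (_D : SkewDatum R) : Type u := ℕ → R

namespace SkewPowerSeries

open PseudocompactRing

section Additive

variable {R : Type u} [Ring R]

instance [TopologicalSpace R] (D : SkewDatum R) : AddCommGroup (SkewPowerSeries D) :=
  inferInstanceAs (AddCommGroup (ℕ → R))

instance [TopologicalSpace R] (D : SkewDatum R) : Module R (SkewPowerSeries D) :=
  inferInstanceAs (Module R (ℕ → R))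

/-- The product topology (and uniformity). -/
instance [UniformSpace R] (D : SkewDatum R) : UniformSpace (SkewPowerSeries D) :=
  inferInstanceAs (UniformSpace (ℕ → R))

variable [UniformSpace R] {D : SkewDatum R}

instance [T2Space R] : T2Space (SkewPowerSeries D) := inferInstanceAs (T2Space (ℕ → R))

instance [CompleteSpace R] : CompleteSpace (SkewPowerSeries D) :=
  inferInstanceAs (CompleteSpace (ℕ → R))

instance [IsUniformAddGroup R] : IsUniformAddGroup (SkewPowerSeries D) :=
  inferInstanceAs (IsUniformAddGroup (ℕ → R))

/-- The coefficient of `t ^ m` in a left power series. -/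
def coeff (m : ℕ) (x : SkewPowerSeries D) : R := x m

@[ext] theorem ext {x y : SkewPowerSeries D} (h : ∀ m, coeff m x = coeff m y) : x = y := funext h

@[simp] theorem coeff_add (m : ℕ) (x y : SkewPowerSeries D) :
    coeff m (x + y) = coeff m x + coeff m y := rfl

@[simp] theorem coeff_zero (m : ℕ) : coeff m (0 : SkewPowerSeries D) = 0 := rfl

@[simp] theorem coeff_smul (m : ℕ) (a : R) (x : SkewPowerSeries D) :
    coeff m (a • x) = a * coeff m x := rfl

theorem continuous_coeff (m : ℕ) : Continuous (coeff m : SkewPowerSeries D → R) :=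
  continuous_apply m

theorem hasSum_iff {ι : Type*} {f : ι → SkewPowerSeries D} {x : SkewPowerSeries D} :
    HasSum f x ↔ ∀ m, HasSum (fun i => coeff m (f i)) (coeff m x) :=
  Pi.hasSum

/-- The monomial `a * t ^ i`. -/
def monomial (i : ℕ) (a : R) : SkewPowerSeries D := Pi.single (M := fun _ : ℕ => R) i a

theorem coeff_monomial (m i : ℕ) (a : R) :
    coeff m (monomial i a : SkewPowerSeries D) = if m = i then a else 0 := by
  simp [coeff, monomial, Pi.single_apply]

/-- Left multiplication by `t`, that is
`t * ∑ i, a i * t ^ i = ∑ i, (σ (a i) * t ^ (i + 1) + δ (a i) * t ^ i)`. -/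
def tMul (x : SkewPowerSeries D) : SkewPowerSeries D
  | 0 => D.δ (x 0)
  | m + 1 => D.σ (x m) + D.δ (x (m + 1))

theorem coeff_tMul_zero (x : SkewPowerSeries D) : coeff 0 (tMul x) = D.δ (coeff 0 x) := rfl

theorem coeff_tMul_succ (m : ℕ) (x : SkewPowerSeries D) :
    coeff (m + 1) (tMul x) = D.σ (coeff m x) + D.δ (coeff (m + 1) x) := rfl

theorem tMul_add (x y : SkewPowerSeries D) : tMul (x + y) = tMul x + tMul y := by
  ext (_ | m)
  · simp [coeff_tMul_zero]
  · simp only [coeff_tMul_succ, coeff_add, map_add]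
    abel

/-- `tMul` as an additive map. -/
def tMulHom : SkewPowerSeries D →+ SkewPowerSeries D := AddMonoidHom.mk' tMul tMul_add

theorem tMul_smul (a : R) (x : SkewPowerSeries D) :
    tMul (a • x) = D.σ a • tMul x + D.δ a • x := by
  ext (_ | m)
  · simp only [coeff_tMul_zero, coeff_smul, coeff_add, D.δ_mul]
    abel
  · simp only [coeff_tMul_succ, coeff_smul, coeff_add, D.δ_mul, map_mul, mul_add]
    abel

theorem iterate_tMul_add (i : ℕ) (x y : SkewPowerSeries D) :
    tMul^[i] (x + y) = tMul^[i] x + tMul^[i] y := by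
  have := iterate_map_add (tMulHom (D := D)) i x y
  exact this

theorem iterate_tMul_zero (i : ℕ) : tMul^[i] (0 : SkewPowerSeries D) = 0 :=
  iterate_map_zero (tMulHom (D := D)) i

theorem continuous_tMul [IsTopologicalRing R] :
    Continuous (tMul : SkewPowerSeries D → SkewPowerSeries D) := by
  refine continuous_pi fun m => ?_
  rcases m with _ | m
  · exact D.continuous_δ.comp (continuous_apply (A := fun _ : ℕ => R) 0)
  · exact (D.continuous_σ.comp (continuous_apply (A := fun _ : ℕ => R) m)).add
      (D.continuous_δ.comp (continuous_apply (A := fun _ : ℕ => R) (m + 1)))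

theorem continuous_iterate_tMul [IsTopologicalRing R] (i : ℕ) :
    Continuous (tMul^[i] : SkewPowerSeries D → SkewPowerSeries D) :=
  continuous_tMul.iterate i

/-- The product of two left power series, that is
`(∑ i, a i * t ^ i) * y = ∑ i, a i * (t ^ i * y)`. -/
noncomputable def mulAux (x y : SkewPowerSeries D) : SkewPowerSeries D :=
  ∑' i, coeff i x • tMul^[i] y

end Additive

end SkewPowerSeries

namespace SkewDatum

open PseudocompactRing

variable {R : Type u} [Ring R] [UniformSpace R] (D : SkewDatum R)

/-- The additive group generated by the images of the monomials with at least `k` factors `δ`. -/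
def monomialGroup (k : ℕ) : AddSubgroup R :=
  AddSubgroup.closure {b | ∃ j, k ≤ j ∧ ∃ w, IsMonomial D.σ D.δ j w ∧ ∃ a, b = w a}

theorem monomialGroup_zero (a : R) : a ∈ D.monomialGroup 0 :=
  AddSubgroup.subset_closure ⟨0, le_rfl, id, .one, a, rfl⟩

theorem monomialGroup_anti {k l : ℕ} (h : k ≤ l) : D.monomialGroup l ≤ D.monomialGroup k :=
  AddSubgroup.closure_mono fun _ ⟨j, hj, h'⟩ => ⟨j, h.trans hj, h'⟩

theorem sigma_mem_monomialGroup {k : ℕ} {a : R} (ha : a ∈ D.monomialGroup k) :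
    D.σ a ∈ D.monomialGroup k := by
  have : D.monomialGroup k ≤ (D.monomialGroup k).comap (D.σ : R →+ R) := by
    refine (AddSubgroup.closure_le _).2 ?_
    rintro b ⟨j, hj, w, hw, a, rfl⟩
    exact AddSubgroup.subset_closure ⟨j, hj, _, hw.sigma, a, rfl⟩
  exact this ha

theorem delta_mem_monomialGroup {k : ℕ} {a : R} (ha : a ∈ D.monomialGroup k) :
    D.δ a ∈ D.monomialGroup (k + 1) := by
  have : D.monomialGroup k ≤ (D.monomialGroup (k + 1)).comap D.δ := by
    refine (AddSubgroup.closure_le _).2 ?_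
    rintro b ⟨j, hj, w, hw, a, rfl⟩
    exact AddSubgroup.subset_closure ⟨j + 1, by omega, _, hw.delta, a, rfl⟩
  exact this ha

theorem exists_monomialGroup_le (n : ℕ) :
    ∃ m, ∀ a ∈ D.monomialGroup m, a ∈ Ring.jacobson R ^ n := by
  obtain ⟨m, -, hm⟩ := D.nilpotent (n + 1) (by omega)
  refine ⟨m, fun a ha => ?_⟩
  have : D.monomialGroup m ≤ (Ring.jacobson R ^ n).toAddSubgroup := by
    refine (AddSubgroup.closure_le _).2 ?_
    rintro b ⟨j, hj, w, hw, a, rfl⟩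
    exact Ideal.pow_le_pow_right (Nat.le_succ n) (hm j hj w hw a)
  exact this ha

end SkewDatum

namespace SkewPowerSeries

open PseudocompactRing

section Mul

variable {R : Type u} [Ring R] [UniformSpace R] {D : SkewDatum R}

theorem coeff_iterate_tMul_mem (i m : ℕ) (y : SkewPowerSeries D) :
    coeff m (tMul^[i] y) ∈ D.monomialGroup (i - m) := by
  induction i generalizing m with
  | zero =>
    rw [Nat.zero_sub]
    exact D.monomialGroup_zero _
  | succ i ih =>
    rw [Function.iterate_succ_apply']
    rcases m with _ | m
    · exact D.delta_mem_monomialGroup (ih 0)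
    · rw [coeff_tMul_succ]
      refine AddSubgroup.add_mem _ ?_ ?_
      · rw [Nat.add_sub_add_right]
        exact D.sigma_mem_monomialGroup (ih m)
      · exact D.monomialGroup_anti (by omega) (D.delta_mem_monomialGroup (ih (m + 1)))

theorem exists_coeff_iterate_tMul_mem (n m : ℕ) :
    ∃ K, ∀ i, K ≤ i → ∀ y : SkewPowerSeries D, coeff m (tMul^[i] y) ∈ Ring.jacobson R ^ n := by
  obtain ⟨k, hk⟩ := D.exists_monomialGroup_le n
  refine ⟨k + m, fun i hi y => hk _ (D.monomialGroup_anti (by omega) (coeff_iterate_tMul_mem i m y))⟩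

theorem delta_one (D : SkewDatum R) : D.δ 1 = 0 := by
  simpa using D.δ_mul 1 1

/-- The coefficientwise application of an additive map followed by a shift. -/
def shift (x : SkewPowerSeries D) : SkewPowerSeries D
  | 0 => 0
  | m + 1 => D.σ (x m)

/-- The coefficientwise application of `δ`. -/
def mapDelta (x : SkewPowerSeries D) : SkewPowerSeries D := fun m => D.δ (x m)

theorem tMul_eq (x : SkewPowerSeries D) : tMul x = shift x + mapDelta x := by
  ext (_ | m)
  · exact (zero_add _).symm
  · rfl

theorem iterate_tMul_one (i : ℕ) :
    tMul^[i] (monomial 0 1 : SkewPowerSeries D) = monomial i 1 := by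
  induction i with
  | zero => rfl
  | succ i ih =>
    rw [Function.iterate_succ_apply', ih]
    ext (_ | m)
    · rw [coeff_tMul_zero, coeff_monomial, coeff_monomial]
      split_ifs <;> simp_all [delta_one]
    · rw [coeff_tMul_succ, coeff_monomial, coeff_monomial, coeff_monomial]
      split_ifs <;> simp_all [delta_one]

/-- The value `M_{k,l}(δ, σ)(a)`, where `M_{k,l}(Y, Z)` is the sum of all noncommutative monomials
with `k` factors `Y` and `l` factors `Z`. -/
def monomialSum (D : SkewDatum R) : ℕ → ℕ → R → R
  | 0, 0, a => a
  | k + 1, 0, a => D.δ (monomialSum D k 0 a)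
  | 0, l + 1, a => D.σ (monomialSum D 0 l a)
  | k + 1, l + 1, a => D.δ (monomialSum D k (l + 1) a) + D.σ (monomialSum D (k + 1) l a)

theorem monomialSum_mem (k l : ℕ) (a : R) : monomialSum D k l a ∈ D.monomialGroup k := by
  induction k generalizing l with
  | zero => exact D.monomialGroup_zero _
  | succ k ih =>
    induction l with
    | zero =>
      rw [monomialSum]
      exact D.delta_mem_monomialGroup (ih 0)
    | succ l ih' =>
      rw [monomialSum]
      exact AddSubgroup.add_mem _ (D.delta_mem_monomialGroup (ih (l + 1)))
        (D.sigma_mem_monomialGroup ih')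

theorem coeff_iterate_tMul (i m : ℕ) (y : SkewPowerSeries D) : coeff m (tMul^[i] y) =
    ∑ n ∈ Finset.range (m + 1), if n ≤ i then monomialSum D (i - n) n (coeff (m - n) y) else 0 := by
  induction i generalizing m with
  | zero =>
    rw [Finset.sum_range_succ']
    simp [monomialSum]
  | succ i ih =>
    rw [Function.iterate_succ_apply']
    rcases m with _ | m
    · rw [coeff_tMul_zero, ih]
      simp [monomialSum]
    · rw [coeff_tMul_succ, ih, ih, Finset.sum_range_succ' _ (m + 1), Finset.sum_range_succ' _ (m + 1),
        map_add, map_sum, map_sum, ← add_assoc, ← Finset.sum_add_distrib]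
      congr 1
      · refine Finset.sum_congr rfl fun n hn => ?_
        rw [Nat.add_sub_add_right m 1 n, Nat.add_sub_add_right i 1 n]
        by_cases h1 : n + 1 ≤ i
        · obtain ⟨k, rfl⟩ := Nat.exists_eq_add_of_le h1
          rw [if_pos h1, if_pos (by omega), if_pos (by omega),
            show n + 1 + k - (n + 1) = k by omega, show n + 1 + k - n = k + 1 by omega]
          rw [monomialSum, add_comm]
        · by_cases h2 : n ≤ i
          · obtain rfl : n = i := by omega
            simp [monomialSum]
          · rw [if_neg h1, if_neg h2, if_neg (by omega)]
            simp
      · simp [monomialSum]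

variable [PseudocompactRing R]

theorem tendsto_iff {ι : Type*} {l : Filter ι} {f : ι → SkewPowerSeries D}
    (h : ∀ n m, ∀ᶠ z in l, coeff m (f z) ∈ Ring.jacobson R ^ n) : Tendsto f l (𝓝 0) := by
  refine tendsto_pi_nhds.2 fun m U hU => ?_
  obtain ⟨n, hn⟩ := exists_jacobson_pow_subset hU
  exact mem_map.2 ((h n m).mono fun z hz => hn hz)

/-- A neighbourhood of zero contains a basic one. -/
theorem exists_setOf_coeff_subset {W : Set (SkewPowerSeries D)} (hW : W ∈ 𝓝 0) :
    ∃ n K, {x : SkewPowerSeries D | ∀ i < K, coeff i x ∈ Ring.jacobson R ^ n} ⊆ W := by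
  have hW' : ∃ I : Set ℕ, I.Finite ∧ ∃ U : ℕ → Set R, (∀ i, U i ∈ 𝓝 0) ∧ I.pi U ⊆ W := by
    have h := nhds_pi (a := (0 : ℕ → R))
    exact mem_pi.1 (h.ge hW)
  obtain ⟨I, hI, U, hU, hIU⟩ := hW'
  choose ν hν using fun i => exists_jacobson_pow_subset (hU i)
  obtain ⟨K, hK⟩ := hI.bddAbove
  refine ⟨(Finset.range (K + 1)).sup ν, K + 1, fun x hx => hIU fun i hi => hν i ?_⟩
  have hiK : i < K + 1 := Nat.lt_succ_of_le (hK hi)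
  exact Ideal.pow_le_pow_right (Finset.le_sup (Finset.mem_range.2 hiK)) (hx i hiK)

variable [IsNoetherianRing R]

theorem _root_.PseudocompactRing.jacobson_pow_mem_nhds (n : ℕ) :
    ((Ring.jacobson R ^ n : Ideal R) : Set R) ∈ 𝓝 (0 : R) :=
  (isOpen_jacobson_pow n).mem_nhds (Ideal.zero_mem _)

theorem _root_.PseudocompactRing.isClosed_jacobson_pow (n : ℕ) :
    IsClosed ((Ring.jacobson R ^ n : Ideal R) : Set R) :=
  isClosed_of_isOpen (isOpen_jacobson_pow n)

theorem _root_.PseudocompactRing.summable_of_forall {f : ℕ → R}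
    (h : ∀ n, ∃ K, ∀ i, K ≤ i → f i ∈ Ring.jacobson R ^ n) : Summable f := by
  have : NonarchimedeanAddGroup R := by
    refine ⟨fun U hU => ?_⟩
    obtain ⟨n, hn⟩ := exists_jacobson_pow_subset hU
    exact ⟨⟨(Ring.jacobson R ^ n).toAddSubgroup, isOpen_jacobson_pow n⟩, hn⟩
  apply NonarchimedeanAddGroup.summable_of_tendsto_cofinite_zero
  rw [Nat.cofinite_eq_atTop]
  intro U hU
  obtain ⟨n, hn⟩ := exists_jacobson_pow_subset hU
  obtain ⟨K, hK⟩ := h n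
  exact mem_map.2 (mem_atTop_sets.2 ⟨K, fun i hi => hn (hK i hi)⟩)

theorem _root_.PseudocompactRing.hasSum_mem {f : ℕ → R} {a : R} (hf : HasSum f a) {n : ℕ}
    (h : ∀ i, f i ∈ Ring.jacobson R ^ n) : a ∈ Ring.jacobson R ^ n :=
  (isClosed_jacobson_pow n).mem_of_tendsto hf
    (Eventually.of_forall fun _ => Submodule.sum_mem _ fun i _ => h i)

theorem _root_.PseudocompactRing.hasSum_sub_mem {f : ℕ → R} {a : R} (hf : HasSum f a) {n : ℕ}
    {s : Finset ℕ} (h : ∀ i ∉ s, f i ∈ Ring.jacobson R ^ n) :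
    a - ∑ i ∈ s, f i ∈ Ring.jacobson R ^ n := by
  classical
  have h2 : HasSum (fun i => f i - if i ∈ s then f i else 0) (a - ∑ i ∈ s, f i) := by
    refine hf.sub ?_
    have h3 : ∑ i ∈ s, f i = ∑ i ∈ s, if i ∈ s then f i else 0 :=
      Finset.sum_congr rfl fun i hi => by rw [if_pos hi]
    rw [h3]
    exact hasSum_sum_of_ne_finset_zero fun b hb => by rw [if_neg hb]
  refine hasSum_mem h2 fun i => ?_
  by_cases hi : i ∈ s
  · simp [hi]
  · simpa [hi] using h i hi

theorem hasSum_mulAux (x y : SkewPowerSeries D) :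
    HasSum (fun i => coeff i x • tMul^[i] y) (mulAux x y) := by
  refine Summable.hasSum ?_
  have : ∀ m, Summable fun i => coeff m (coeff i x • tMul^[i] y) := by
    intro m
    refine summable_of_forall fun n => ?_
    obtain ⟨K, hK⟩ := exists_coeff_iterate_tMul_mem (D := D) n m
    exact ⟨K, fun i hi => Ideal.mul_mem_left _ _ (hK i hi y)⟩
  exact ⟨fun m => ∑' i, coeff m (coeff i x • tMul^[i] y), hasSum_iff.2 fun m => (this m).hasSum⟩

theorem add_mulAux (x x' y : SkewPowerSeries D) :
    mulAux (x + x') y = mulAux x y + mulAux x' y := by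
  refine (hasSum_mulAux _ _).unique ?_
  simpa [add_smul] using (hasSum_mulAux x y).add (hasSum_mulAux x' y)

theorem mulAux_add (x y y' : SkewPowerSeries D) :
    mulAux x (y + y') = mulAux x y + mulAux x y' := by
  refine (hasSum_mulAux _ _).unique ?_
  simpa [iterate_tMul_add] using (hasSum_mulAux x y).add (hasSum_mulAux x y')

theorem zero_mulAux (y : SkewPowerSeries D) : mulAux 0 y = 0 := by
  simpa using add_mulAux 0 0 y

theorem mulAux_zero (y : SkewPowerSeries D) : mulAux y 0 = 0 := by
  simpa using mulAux_add y 0 0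

theorem smul_mulAux (a : R) (x y : SkewPowerSeries D) : mulAux (a • x) y = a • mulAux x y := by
  refine (hasSum_mulAux _ _).unique (hasSum_iff.2 fun m => ?_)
  simpa [mul_assoc] using (hasSum_iff.1 (hasSum_mulAux x y) m).mul_left a

theorem hasSum_shift_mulAux (x y : SkewPowerSeries D) :
    HasSum (fun i => D.σ (coeff i x) • tMul^[i + 1] y) (mulAux (shift x) y) := by
  have := hasSum_mulAux (shift x) y
  rw [← hasSum_nat_add_iff' 1] at this
  have h0 : coeff 0 (shift x) = 0 := rfl
  have h1 : ∀ i, coeff (i + 1) (shift x) = D.σ (coeff i x) := fun i => rfl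
  simpa only [Finset.sum_range_one, h0, h1, zero_smul, sub_zero] using this

theorem tMul_mulAux (x y : SkewPowerSeries D) : tMul (mulAux x y) = mulAux (tMul x) y := by
  have h1 : HasSum (fun i => tMul (coeff i x • tMul^[i] y)) (tMul (mulAux x y)) :=
    (hasSum_mulAux x y).map (tMulHom (D := D)) continuous_tMul
  refine h1.unique ?_
  rw [tMul_eq x, add_mulAux]
  convert (hasSum_shift_mulAux x y).add (hasSum_mulAux (mapDelta x) y) using 2 with i
  rw [tMul_smul, Function.iterate_succ_apply']
  rfl

theorem iterate_tMul_mulAux (i : ℕ) (x y : SkewPowerSeries D) :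
    tMul^[i] (mulAux x y) = mulAux (tMul^[i] x) y := by
  induction i with
  | zero => rfl
  | succ i ih => rw [Function.iterate_succ_apply', ih, tMul_mulAux, Function.iterate_succ_apply']

theorem exists_mulAux_mem (n m : ℕ) : ∃ K, ∀ x y : SkewPowerSeries D,
    (∀ i < K, coeff m (coeff i x • tMul^[i] y) ∈ Ring.jacobson R ^ n) →
      coeff m (mulAux x y) ∈ Ring.jacobson R ^ n := by
  obtain ⟨K, hK⟩ := exists_coeff_iterate_tMul_mem (D := D) n m
  refine ⟨K, fun x y h => hasSum_mem (hasSum_iff.1 (hasSum_mulAux x y) m) fun i => ?_⟩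
  by_cases hi : i < K
  · exact h i hi
  · exact Ideal.mul_mem_left _ _ (hK i (not_lt.1 hi) y)

theorem setOf_coeff_mem_nhds (n K : ℕ) :
    {x : SkewPowerSeries D | ∀ i < K, coeff i x ∈ Ring.jacobson R ^ n} ∈ 𝓝 0 := by
  have : {x : SkewPowerSeries D | ∀ i < K, coeff i x ∈ Ring.jacobson R ^ n} =
      ⋂ i ∈ Finset.range K, {x | coeff i x ∈ Ring.jacobson R ^ n} := by
    ext x; simp
  rw [this]
  refine (biInter_finset_mem _).2 fun i _ => ?_
  exact (continuous_coeff i).continuousAt.preimage_mem_nhds (jacobson_pow_mem_nhds n)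

theorem tendsto_mulAux_left (y : SkewPowerSeries D) :
    Tendsto (fun x : SkewPowerSeries D => mulAux x y) (𝓝 0) (𝓝 0) := by
  refine tendsto_iff fun n m => ?_
  obtain ⟨K, hK⟩ := exists_mulAux_mem (D := D) n m
  filter_upwards [setOf_coeff_mem_nhds (D := D) n K] with x hx
  exact hK x y fun i hi => Ideal.mul_mem_right _ _ (hx i hi)

theorem tendsto_mulAux_right (x : SkewPowerSeries D) :
    Tendsto (fun y : SkewPowerSeries D => mulAux x y) (𝓝 0) (𝓝 0) := by
  refine tendsto_iff fun n m => ?_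
  obtain ⟨K, hK⟩ := exists_mulAux_mem (D := D) n m
  have : ∀ᶠ y in 𝓝 (0 : SkewPowerSeries D), ∀ i ∈ Finset.range K,
      coeff m (tMul^[i] y) ∈ Ring.jacobson R ^ n := by
    rw [Filter.eventually_all_finset]
    intro i _
    have hc : Continuous fun y : SkewPowerSeries D => coeff m (tMul^[i] y) :=
      (continuous_coeff m).comp (continuous_iterate_tMul i)
    refine hc.continuousAt.preimage_mem_nhds ?_
    rw [iterate_tMul_zero]
    exact jacobson_pow_mem_nhds n
  filter_upwards [this] with y hy
  exact hK x y fun i hi => Ideal.mul_mem_left _ _ (hy i (Finset.mem_range.2 hi))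

theorem tendsto_mulAux :
    Tendsto (fun p : SkewPowerSeries D × SkewPowerSeries D => mulAux p.1 p.2) (𝓝 0 ×ˢ 𝓝 0)
      (𝓝 0) := by
  refine tendsto_iff fun n m => ?_
  obtain ⟨K, hK⟩ := exists_mulAux_mem (D := D) n m
  filter_upwards [prod_mem_prod (setOf_coeff_mem_nhds (D := D) n K) univ_mem] with p hp
  exact hK p.1 p.2 fun i hi => Ideal.mul_mem_right _ _ (hp.1 i hi)

/-- `mulAux` as an additive map in the first variable. -/
noncomputable def mulAuxHom (y : SkewPowerSeries D) : SkewPowerSeries D →+ SkewPowerSeries D :=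
  AddMonoidHom.mk' (fun x => mulAux x y) fun x x' => add_mulAux x x' y

theorem continuous_mulAuxHom (y : SkewPowerSeries D) : Continuous (mulAuxHom y) := by
  refine continuous_of_continuousAt_zero _ ?_
  rw [ContinuousAt, map_zero]
  exact tendsto_mulAux_left y

theorem mulAux_assoc (x y z : SkewPowerSeries D) :
    mulAux (mulAux x y) z = mulAux x (mulAux y z) := by
  have h : HasSum (fun i => mulAux (coeff i x • tMul^[i] y) z) (mulAux (mulAux x y) z) :=
    (hasSum_mulAux x y).map (mulAuxHom z) (continuous_mulAuxHom z)
  refine h.unique ?_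
  simpa only [smul_mulAux, ← iterate_tMul_mulAux] using hasSum_mulAux x (mulAux y z)

theorem one_mulAux (x : SkewPowerSeries D) : mulAux (monomial 0 1) x = x := by
  refine (hasSum_mulAux _ _).unique ?_
  convert hasSum_single (f := fun i => coeff i (monomial 0 1 : SkewPowerSeries D) • tMul^[i] x) 0
    (fun i hi => by simp [coeff_monomial, hi]) using 1
  simp [coeff_monomial]

theorem mulAux_one (x : SkewPowerSeries D) : mulAux x (monomial 0 1) = x := by
  refine (hasSum_mulAux _ _).unique (hasSum_iff.2 fun m => ?_)
  convert hasSum_single (f := fun i => coeff m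
    (coeff i x • tMul^[i] (monomial 0 1 : SkewPowerSeries D))) m
    (fun i hi => by simp [iterate_tMul_one, coeff_monomial, hi.symm]) using 1
  simp [iterate_tMul_one, coeff_monomial]

/-- The skew power series ring `R[[t;σ,δ]]`. -/
noncomputable instance : Ring (SkewPowerSeries D) where
  __ := (inferInstance : AddCommGroup (SkewPowerSeries D))
  mul := mulAux
  one := monomial 0 1
  left_distrib := mulAux_add
  right_distrib := add_mulAux
  zero_mul := zero_mulAux
  mul_zero := mulAux_zero
  mul_assoc := mulAux_assoc
  one_mul := one_mulAux
  mul_one := mulAux_one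

theorem hasSum_mul (x y : SkewPowerSeries D) :
    HasSum (fun i => coeff i x • tMul^[i] y) (x * y) := hasSum_mulAux x y

/-- The multiplication of left power series in terms of coefficients:
`(∑ j, a j * t ^ j) * (∑ l, b l * t ^ l)` has as its coefficient of `t ^ m` the sum over
`0 ≤ n ≤ m` and `j ≥ n` of `a j * M_{j-n,n}(δ, σ)(b (m - n))`. -/
theorem coeff_mul (x y : SkewPowerSeries D) (m : ℕ) : coeff m (x * y) =
    ∑ n ∈ Finset.range (m + 1), ∑' k, coeff (k + n) x * monomialSum D k n (coeff (m - n) y) := by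
  refine (hasSum_iff.1 (hasSum_mul x y) m).unique ?_
  simp only [coeff_smul, coeff_iterate_tMul, Finset.mul_sum]
  refine hasSum_sum fun n _ => ?_
  rw [← hasSum_nat_add_iff' n, Finset.sum_eq_zero, sub_zero]
  · have hs : Summable fun k => coeff (k + n) x * monomialSum D k n (coeff (m - n) y) := by
      refine summable_of_forall fun p => ?_
      obtain ⟨K, hK⟩ := D.exists_monomialGroup_le p
      exact ⟨K, fun k hk => Ideal.mul_mem_left _ _
        (hK _ (D.monomialGroup_anti hk (monomialSum_mem k n _)))⟩
    simpa only [Nat.le_add_left, if_true, Nat.add_sub_cancel] using hs.hasSum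
  · intro i hi
    rw [if_neg (not_le.2 (Finset.mem_range.1 hi)), mul_zero]

instance : IsTopologicalRing (SkewPowerSeries D) :=
  IsTopologicalRing.of_addGroup_of_nhds_zero tendsto_mulAux tendsto_mulAux_right
    tendsto_mulAux_left

instance : IsScalarTower R (SkewPowerSeries D) (SkewPowerSeries D) := ⟨smul_mulAux⟩

/-- The inclusion of the coefficient ring. -/
noncomputable def C : R →+* SkewPowerSeries D where
  toFun a := a • 1
  map_one' := one_smul _ _
  map_mul' a b := by rw [smul_mul_assoc, one_mul, mul_smul]
  map_zero' := zero_smul _ _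
  map_add' a b := add_smul _ _ _

/-- The variable `t`. -/
def t : SkewPowerSeries D := monomial 1 1

theorem t_pow_mul (i : ℕ) (x : SkewPowerSeries D) : t ^ i * x = tMul^[i] x := by
  have h1 : ∀ x : SkewPowerSeries D, t * x = tMul x := by
    intro x
    refine (hasSum_mul _ _).unique ?_
    convert hasSum_single (f := fun i => coeff i (t : SkewPowerSeries D) • tMul^[i] x) 1
      (fun i hi => by simp [t, coeff_monomial, hi]) using 1
    simp [t, coeff_monomial]
  induction i with
  | zero => simp
  | succ i ih => rw [pow_succ', mul_assoc, ih, h1, Function.iterate_succ_apply']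

theorem t_mul_C (a : R) : (t : SkewPowerSeries D) * C a = C (D.σ a) * t + C (D.δ a) := by
  have h := t_pow_mul 1 (C a : SkewPowerSeries D)
  rw [pow_one, Function.iterate_one] at h
  have h2 := t_pow_mul 1 (1 : SkewPowerSeries D)
  rw [pow_one, Function.iterate_one, mul_one] at h2
  rw [h]
  show tMul (a • (1 : SkewPowerSeries D)) = D.σ a • 1 * t + D.δ a • 1
  rw [tMul_smul, ← h2, smul_mul_assoc, one_mul]

/-- Every element is the convergent sum `∑ i, a i * t ^ i` given by its coefficients. -/
theorem hasSum_coeff (x : SkewPowerSeries D) : HasSum (fun i => C (coeff i x) * t ^ i) x := by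
  have := hasSum_mul x 1
  rw [mul_one] at this
  convert this using 2 with i
  rw [← t_pow_mul, mul_one]
  show coeff i x • (1 : SkewPowerSeries D) * t ^ i = _
  rw [smul_mul_assoc, one_mul]

end Mul

end SkewPowerSeries

namespace SkewDatum

open PseudocompactRing

section Equicontinuity

variable {R : Type u} [Ring R] [UniformSpace R] [PseudocompactRing R] [IsNoetherianRing R]
  (D : SkewDatum R)

theorem jacobson_pow_map_le (e : R ≃+* R) (n : ℕ) :
    ∀ a ∈ Ring.jacobson R ^ n, e a ∈ Ring.jacobson R ^ n := by
  have h1 : ∀ a ∈ Ring.jacobson R, e a ∈ Ring.jacobson R := by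
    intro a ha
    rw [Ring.jacobson_eq_sInf_isMaximal, Submodule.mem_sInf] at ha ⊢
    intro m hm
    have hm' : Ideal.IsMaximal m := hm
    have : (Ideal.comap e m).IsMaximal := Ideal.comap_isMaximal_of_equiv e
    exact ha _ this
  induction n with
  | zero => simp [Submodule.pow_zero, Ideal.one_eq_top]
  | succ n ih =>
    intro a ha
    have : Ring.jacobson R ^ (n + 1) ≤ Ideal.comap e (Ring.jacobson R ^ (n + 1)) := by
      rw [Submodule.pow_succ, Ideal.mul_le]
      intro r hr s hs
      rw [Ideal.mem_comap, map_mul]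
      exact Ideal.mul_mem_mul (ih r hr) (h1 s hs)
    exact this ha

/-- Equicontinuity of all monomials in `δ, σ, σ⁻¹`. -/
theorem exists_isMonomial_mem (n : ℕ) : ∃ l, ∀ k w, IsMonomial D.σ D.δ k w →
    ∀ a ∈ Ring.jacobson R ^ l, w a ∈ Ring.jacobson R ^ n := by
  have hδ : ∀ p : ℕ, ∃ q, p ≤ q ∧ ∀ a ∈ Ring.jacobson R ^ q, D.δ a ∈ Ring.jacobson R ^ p := by
    intro p
    have : D.δ ⁻¹' (Ring.jacobson R ^ p : Ideal R) ∈ 𝓝 (0 : R) :=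
      D.continuous_δ.continuousAt.preimage_mem_nhds
        (by rw [map_zero]; exact jacobson_pow_mem_nhds p)
    obtain ⟨q, hq⟩ := exists_jacobson_pow_subset this
    exact ⟨max p q, le_max_left _ _, fun a ha => hq (Ideal.pow_le_pow_right (le_max_right p q) ha)⟩
  choose L hL hLδ using hδ
  have hmon : ∀ k w, IsMonomial D.σ D.δ k w → ∀ p, ∀ a ∈ Ring.jacobson R ^ (L^[k] p),
      w a ∈ Ring.jacobson R ^ p := by
    intro k w hw
    induction hw with
    | one => exact fun p a ha => ha
    | delta _ ih => exact fun p a ha => hLδ p _ (ih (L p) a ha)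
    | sigma _ ih => exact fun p a ha => jacobson_pow_map_le D.σ p _ (ih p a ha)
    | sigmaInv _ ih => exact fun p a ha => jacobson_pow_map_le D.σ.symm p _ (ih p a ha)
  obtain ⟨r, -, hr⟩ := D.nilpotent (n + 1) (by omega)
  have hmono : Monotone fun k => L^[k] n :=
    monotone_nat_of_le_succ fun k => by
      rw [Function.iterate_succ_apply']
      exact hL _
  refine ⟨L^[r] n, fun k w hw a ha => ?_⟩
  rcases le_total r k with h | h
  · exact Ideal.pow_le_pow_right (Nat.le_succ n) (hr k h w hw a)
  · exact hmon k w hw n a (Ideal.pow_le_pow_right (hmono h) ha)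

end Equicontinuity

end SkewDatum

namespace SkewPowerSeries

open PseudocompactRing

section Dual

variable {R : Type u} [Ring R] [UniformSpace R] [PseudocompactRing R] [IsNoetherianRing R]
  {D : SkewDatum R} {N : Type u} [AddCommGroup N] [Module R N] [Module (SkewPowerSeries D) N]
  [IsScalarTower R (SkewPowerSeries D) N]

theorem C_smul (a : R) (n : N) : (C a : SkewPowerSeries D) • n = a • n := by
  show (a • (1 : SkewPowerSeries D)) • n = a • n
  rw [smul_assoc, one_smul]

theorem t_smul_smul (a : R) (n : N) : (t : SkewPowerSeries D) • a • n =
    D.σ a • (t : SkewPowerSeries D) • n + D.δ a • n := by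
  rw [← C_smul (D := D) a n, smul_smul, t_mul_C, add_smul, mul_smul, C_smul, C_smul]

variable (D)

/-- For an `R`-linear map `f : N → R`, the `R`-linear map `f^t`,
`f^t (n) = σ⁻¹ (f (t n) - δ (f n))`. -/
noncomputable def tAct : (N →ₗ[R] R) →+ (N →ₗ[R] R) where
  toFun f :=
    { toFun := fun n => D.σ.symm (f ((t : SkewPowerSeries D) • n) - D.δ (f n))
      map_add' := fun n n' => by
        simp only [smul_add, map_add, map_sub]
        abel
      map_smul' := fun a n => by
        simp only [t_smul_smul, map_add, map_smul, smul_eq_mul, D.δ_mul, map_sub, map_mul,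
          RingEquiv.symm_apply_apply, RingHom.id_apply, mul_sub]
        abel }
  map_zero' := by ext; simp
  map_add' f g := by
    ext n
    simp only [LinearMap.coe_mk, AddHom.coe_mk, LinearMap.add_apply, map_add, map_sub]
    abel

/-- For an `R`-linear map `f : N → R` and `a : R`, the `R`-linear map `f^a`,
`f^a (n) = f n * σ⁻¹ a`. -/
def rAct (a : R) : (N →ₗ[R] R) →+ (N →ₗ[R] R) where
  toFun f :=
    { toFun := fun n => f n * D.σ.symm a
      map_add' := fun n n' => by rw [map_add, add_mul]
      map_smul' := fun b n => by rw [map_smul, smul_eq_mul, mul_assoc]; rfl }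
  map_zero' := by ext; simp
  map_add' f g := by ext; simp [add_mul]

variable {D}

theorem tAct_apply (f : N →ₗ[R] R) (n : N) :
    tAct D f n = D.σ.symm (f ((t : SkewPowerSeries D) • n) - D.δ (f n)) := rfl

theorem rAct_apply (a : R) (f : N →ₗ[R] R) (n : N) : rAct D a f n = f n * D.σ.symm a := rfl

theorem rAct_add (a b : R) (f : N →ₗ[R] R) : rAct D (a + b) f = rAct D a f + rAct D b f := by
  ext n; simp [rAct_apply, mul_add]

theorem rAct_zero (f : N →ₗ[R] R) : rAct D 0 f = 0 := by
  ext n; simp [rAct_apply]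

theorem rAct_one (f : N →ₗ[R] R) : rAct D 1 f = f := by
  ext n; simp [rAct_apply]

theorem rAct_mul (a b : R) (f : N →ₗ[R] R) : rAct D (a * b) f = rAct D b (rAct D a f) := by
  ext n; simp [rAct_apply, mul_assoc]

theorem rAct_tAct (a : R) (f : N →ₗ[R] R) :
    rAct D a (tAct D f) = tAct D (rAct D (D.σ a) f) + rAct D (D.δ a) f := by
  ext n
  simp only [rAct_apply, tAct_apply, LinearMap.add_apply, RingEquiv.symm_apply_apply, D.δ_mul,
    map_sub, map_add, map_mul, sub_mul]
  abel

/-- The values of the iterates of `tAct` in terms of monomials in `δ, σ, σ⁻¹`. -/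
theorem iterate_tAct_mem (k : ℕ) (f : N →ₗ[R] R) (n : N) : ((tAct D)^[k] f) n ∈
    AddSubgroup.closure {b | ∃ i j, i + j = k ∧ ∃ w, IsMonomial D.σ D.δ i w ∧
      b = w (f ((t : SkewPowerSeries D) ^ j • n))} := by
  induction k generalizing n with
  | zero =>
    refine AddSubgroup.subset_closure ⟨0, 0, rfl, id, .one, ?_⟩
    simp
  | succ k ih =>
    rw [Function.iterate_succ_apply', tAct_apply, map_sub]
    refine AddSubgroup.sub_mem _ ?_ ?_
    · refine AddSubgroup.mem_comap.1 ((AddSubgroup.closure_le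
        (AddSubgroup.comap (D.σ.symm : R →+ R) _)).2 ?_ (ih ((t : SkewPowerSeries D) • n)))
      rintro _ ⟨i, j, hij, w, hw, rfl⟩
      refine AddSubgroup.subset_closure ⟨i, j + 1, by omega, _, hw.sigmaInv, ?_⟩
      rw [pow_succ, mul_smul]
      rfl
    · refine AddSubgroup.mem_comap.1 ((AddSubgroup.closure_le
        (AddSubgroup.comap ((D.σ.symm : R →+ R).comp D.δ) _)).2 ?_ (ih n))
      rintro _ ⟨i, j, hij, w, hw, rfl⟩
      exact AddSubgroup.subset_closure ⟨i + 1, j, by omega, _, hw.delta.sigmaInv, rfl⟩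

theorem iterate_tAct_rAct_mem_of_forall {l n : ℕ}
    (hl : ∀ k w, IsMonomial D.σ D.δ k w → ∀ a ∈ Ring.jacobson R ^ l, w a ∈ Ring.jacobson R ^ n)
    {f : N →ₗ[R] R} (hf : ∀ m, f m ∈ Ring.jacobson R ^ l) (k : ℕ) (a : R) (m : N) :
    ((tAct D)^[k] (rAct D a f)) m ∈ Ring.jacobson R ^ n := by
  refine (AddSubgroup.closure_le (K := (Ring.jacobson R ^ n).toAddSubgroup)).2 ?_
    (iterate_tAct_mem k _ m)
  rintro _ ⟨i, j, -, w, hw, rfl⟩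
  exact hl i w hw _ (Ideal.mul_mem_right _ _ (hf _))

/-- A neighbourhood of zero in `S` contains `t ^ k * S` for all large `k`. -/
theorem exists_t_pow_mul_mem {W : Set (SkewPowerSeries D)} (hW : W ∈ 𝓝 0) :
    ∃ K, ∀ k, K ≤ k → ∀ x : SkewPowerSeries D, t ^ k * x ∈ W := by
  obtain ⟨n, I, h⟩ := exists_setOf_coeff_subset hW
  choose K hK using exists_coeff_iterate_tMul_mem (D := D) n
  refine ⟨(Finset.range I).sup K, fun k hk x => h fun i hi => ?_⟩
  rw [t_pow_mul]
  exact hK i k ((Finset.le_sup (Finset.mem_range.2 hi)).trans hk) x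

variable (D N)

/-- The continuous `R`-linear maps `N → R` on a finitely generated `S`-module `N`. The (unique)
pseudocompact topology of `N` is the quotient topology from any surjection `S ^ k → N`, which is
the module topology. -/
def ContDual : AddSubgroup (N →ₗ[R] R) where
  carrier := {f | @Continuous N R (moduleTopology (SkewPowerSeries D) N) _ f}
  zero_mem' := by
    letI := moduleTopology (SkewPowerSeries D) N
    exact continuous_zero
  add_mem' {f g} hf hg := by
    letI := moduleTopology (SkewPowerSeries D) N
    exact Continuous.add (f := f) (g := g) hf hg
  neg_mem' {f} hf := by
    letI := moduleTopology (SkewPowerSeries D) N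
    exact Continuous.neg (f := f) hf

variable {D N}

theorem mem_contDual_iff {f : N →ₗ[R] R} :
    f ∈ ContDual D N ↔ @Continuous N R (moduleTopology (SkewPowerSeries D) N) _ f := Iff.rfl

/-- Continuity may be tested after pulling back along a surjection `S ^ k → N`. -/
theorem mem_contDual_iff_of_surjective {k : ℕ}
    (g : (Fin k → SkewPowerSeries D) →ₗ[SkewPowerSeries D] N) (hg : Function.Surjective g)
    {f : N →ₗ[R] R} : f ∈ ContDual D N ↔ Continuous fun x => f (g x) := by
  letI := moduleTopology (SkewPowerSeries D) N
  haveI : IsModuleTopology (SkewPowerSeries D) N := ⟨rfl⟩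
  exact (IsModuleTopology.isQuotientMap_of_surjective hg).continuous_iff

theorem tAct_mem {f : N →ₗ[R] R} (hf : f ∈ ContDual D N) : tAct D f ∈ ContDual D N := by
  letI := moduleTopology (SkewPowerSeries D) N
  haveI : IsModuleTopology (SkewPowerSeries D) N := ⟨rfl⟩
  have hf' : Continuous f := hf
  have ht : Continuous fun n : N => (t : SkewPowerSeries D) • n := continuous_const_smul _
  exact D.continuous_σ_symm.comp ((hf'.comp ht).sub (D.continuous_δ.comp hf'))

theorem rAct_mem (a : R) {f : N →ₗ[R] R} (hf : f ∈ ContDual D N) : rAct D a f ∈ ContDual D N := by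
  letI := moduleTopology (SkewPowerSeries D) N
  exact Continuous.mul_const (f := f) hf _

theorem iterate_tAct_rAct_mem (i : ℕ) (a : R) {f : N →ₗ[R] R} (hf : f ∈ ContDual D N) :
    (tAct D)^[i] (rAct D a f) ∈ ContDual D N := by
  induction i with
  | zero => exact rAct_mem a hf
  | succ i ih =>
    rw [Function.iterate_succ_apply']
    exact tAct_mem ih

variable [Module.Finite (SkewPowerSeries D) N]

theorem exists_apply_t_pow_mem {f : N →ₗ[R] R} (hf : f ∈ ContDual D N) (n : ℕ) :
    ∃ K, ∀ k, K ≤ k → ∀ m : N, f ((t : SkewPowerSeries D) ^ k • m) ∈ Ring.jacobson R ^ n := by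
  letI := moduleTopology (SkewPowerSeries D) N
  haveI : IsModuleTopology (SkewPowerSeries D) N := ⟨rfl⟩
  obtain ⟨E, hE⟩ := Module.Finite.fg_top (R := SkewPowerSeries D) (M := N)
  have h1 : ∀ e : N, ∃ K : ℕ, ∀ k, K ≤ k → ∀ x : SkewPowerSeries D,
      f ((t ^ k * x) • e) ∈ Ring.jacobson R ^ n := by
    intro e
    have hc : Continuous fun x : SkewPowerSeries D => f (x • e) :=
      Continuous.comp (g := f) hf (continuous_id.smul continuous_const)
    refine exists_t_pow_mul_mem (W := (fun x : SkewPowerSeries D => f (x • e)) ⁻¹'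
      (Ring.jacobson R ^ n : Ideal R)) (hc.continuousAt.preimage_mem_nhds ?_)
    simp only [zero_smul, map_zero]
    exact jacobson_pow_mem_nhds n
  choose K hK using h1
  refine ⟨E.sup K, fun k hk m => ?_⟩
  have hm : m ∈ Submodule.span (SkewPowerSeries D) (E : Set N) := hE ▸ Submodule.mem_top
  have h2 : ∀ x : SkewPowerSeries D, f ((t : SkewPowerSeries D) ^ k • x • m) ∈ Ring.jacobson R ^ n := by
    induction hm using Submodule.span_induction with
    | mem e he =>
      intro x
      rw [smul_smul]
      exact hK e k ((Finset.le_sup he).trans hk) x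
    | zero => simp
    | add a b _ _ ha hb =>
      intro x
      rw [smul_add, smul_add, map_add]
      exact Submodule.add_mem _ (ha x) (hb x)
    | smul s a _ ha =>
      intro x
      rw [smul_smul x s a]
      exact ha _
  simpa using h2 1

theorem exists_iterate_tAct_rAct_mem {f : N →ₗ[R] R} (hf : f ∈ ContDual D N) (n : ℕ) :
    ∃ K, ∀ k, K ≤ k → ∀ (a : R) (m : N),
      ((tAct D)^[k] (rAct D a f)) m ∈ Ring.jacobson R ^ n := by
  obtain ⟨l, hl⟩ := D.exists_isMonomial_mem n
  obtain ⟨r, -, hr⟩ := D.nilpotent (n + 1) (by omega)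
  obtain ⟨K, hK⟩ := exists_apply_t_pow_mem hf l
  refine ⟨r + K, fun k hk a m => ?_⟩
  refine (AddSubgroup.closure_le (K := (Ring.jacobson R ^ n).toAddSubgroup)).2 ?_
    (iterate_tAct_mem k _ m)
  rintro _ ⟨i, j, hij, w, hw, rfl⟩
  rcases le_or_gt r i with h | h
  · exact Ideal.pow_le_pow_right (Nat.le_succ n) (hr i h w hw _)
  · exact hl i w hw _ (Ideal.mul_mem_right _ _ (hK j (by omega) m))

/-- The value at `n` of `f^x = ∑ i, (f^(a i))^(t^i)`, for `x = ∑ i, a i * t ^ i`. -/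
noncomputable def actFun (x : SkewPowerSeries D) (f : N →ₗ[R] R) (n : N) : R :=
  ∑' i, ((tAct D)^[i] (rAct D (coeff i x) f)) n

theorem hasSum_actFun (x : SkewPowerSeries D) {f : N →ₗ[R] R} (hf : f ∈ ContDual D N) (m : N) :
    HasSum (fun i => ((tAct D)^[i] (rAct D (coeff i x) f)) m) (actFun x f m) := by
  refine (summable_of_forall fun n => ?_).hasSum
  obtain ⟨K, hK⟩ := exists_iterate_tAct_rAct_mem hf n
  exact ⟨K, fun i hi => hK i hi _ m⟩

/-- `f^x` as an `R`-linear map. -/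
noncomputable def actLin (x : SkewPowerSeries D) (f : ContDual D N) : N →ₗ[R] R where
  toFun := actFun x (f : N →ₗ[R] R)
  map_add' m m' := by
    refine (hasSum_actFun x f.2 _).unique ?_
    simpa using (hasSum_actFun x f.2 m).add (hasSum_actFun x f.2 m')
  map_smul' a m := by
    refine (hasSum_actFun x f.2 _).unique ?_
    simpa using (hasSum_actFun x f.2 m).mul_left a

/-- `f^x` as a continuous `R`-linear map. -/
noncomputable def act (x : SkewPowerSeries D) (f : ContDual D N) : ContDual D N where
  val := actLin x f
  property := by
    letI := moduleTopology (SkewPowerSeries D) N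
    haveI : IsModuleTopology (SkewPowerSeries D) N := ⟨rfl⟩
    haveI := IsModuleTopology.topologicalAddGroup (SkewPowerSeries D) N
    refine continuous_of_continuousAt_zero (actLin x f) ?_
    intro U hU
    rw [map_zero] at hU
    obtain ⟨n, hn⟩ := exists_jacobson_pow_subset hU
    obtain ⟨K, hK⟩ := exists_iterate_tAct_rAct_mem f.2 n
    have : ∀ᶠ m in 𝓝 (0 : N), ∀ i ∈ Finset.range K,
        ((tAct D)^[i] (rAct D (coeff i x) f)) m ∈ Ring.jacobson R ^ n := by
      rw [Filter.eventually_all_finset]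
      intro i _
      have hc : Continuous ((tAct D)^[i] (rAct D (coeff i x) (f : N →ₗ[R] R))) :=
        iterate_tAct_rAct_mem i (coeff i x) f.2
      refine hc.continuousAt.preimage_mem_nhds ?_
      rw [map_zero]
      exact jacobson_pow_mem_nhds n
    rw [mem_map]
    filter_upwards [this] with m hm
    refine hn (hasSum_mem (hasSum_actFun x f.2 m) fun i => ?_)
    by_cases hi : i < K
    · exact hm i (Finset.mem_range.2 hi)
    · exact hK i (not_lt.1 hi) _ m

theorem hasSum_act (x : SkewPowerSeries D) (f : ContDual D N) (m : N) :
    HasSum (fun i => ((tAct D)^[i] (rAct D (coeff i x) (f : N →ₗ[R] R))) m)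
      ((act x f : N →ₗ[R] R) m) :=
  hasSum_actFun x f.2 m

theorem contDual_ext {f g : ContDual D N} (h : ∀ m, (f : N →ₗ[R] R) m = (g : N →ₗ[R] R) m) :
    f = g := Subtype.ext (LinearMap.ext h)

theorem iterate_tAct_add (i : ℕ) (f g : N →ₗ[R] R) :
    (tAct D)^[i] (f + g) = (tAct D)^[i] f + (tAct D)^[i] g :=
  iterate_map_add (tAct D) i f g

theorem iterate_tAct_zero (i : ℕ) : (tAct D)^[i] (0 : N →ₗ[R] R) = 0 :=
  iterate_map_zero (tAct D) i

theorem act_add (x : SkewPowerSeries D) (f g : ContDual D N) :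
    act x (f + g) = act x f + act x g := by
  refine contDual_ext fun m => (hasSum_act x (f + g) m).unique ?_
  simpa [iterate_tAct_add] using (hasSum_act x f m).add (hasSum_act x g m)

theorem add_act (x y : SkewPowerSeries D) (f : ContDual D N) :
    act (x + y) f = act x f + act y f := by
  refine contDual_ext fun m => (hasSum_act (x + y) f m).unique ?_
  simpa [iterate_tAct_add, rAct_add] using (hasSum_act x f m).add (hasSum_act y f m)

theorem one_act (f : ContDual D N) : act 1 f = f := by
  refine contDual_ext fun m => (hasSum_act 1 f m).unique ?_
  have h1 : ∀ i, coeff i (1 : SkewPowerSeries D) = if i = 0 then 1 else 0 :=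
    fun i => coeff_monomial i 0 1
  convert hasSum_single (f := fun i => ((tAct D)^[i] (rAct D (coeff i (1 : SkewPowerSeries D))
    (f : N →ₗ[R] R))) m) 0 (fun i hi => by simp [h1, hi, rAct_zero]) using 1
  simp [h1, rAct_one]

/-- `f^a` as a continuous map. -/
def rActC (a : R) (f : ContDual D N) : ContDual D N := ⟨rAct D a f, rAct_mem a f.2⟩

/-- `f^t` as a continuous map. -/
noncomputable def tActC (f : ContDual D N) : ContDual D N := ⟨tAct D f, tAct_mem f.2⟩

theorem smul_act (a : R) (y : SkewPowerSeries D) (f : ContDual D N) :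
    act (a • y) f = act y (rActC a f) := by
  refine contDual_ext fun m => (hasSum_act _ f m).unique ?_
  simpa [rAct_mul, rActC] using hasSum_act y (rActC a f) m

theorem shift_act_hasSum (x : SkewPowerSeries D) (f : ContDual D N) (m : N) :
    HasSum (fun i => ((tAct D)^[i + 1] (rAct D (D.σ (coeff i x)) (f : N →ₗ[R] R))) m)
      ((act (shift x) f : N →ₗ[R] R) m) := by
  have := hasSum_act (shift x) f m
  rw [← hasSum_nat_add_iff' 1] at this
  have h0 : coeff 0 (shift x) = 0 := rfl
  have h1 : ∀ i, coeff (i + 1) (shift x) = D.σ (coeff i x) := fun i => rfl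
  simpa only [Finset.sum_range_one, h0, h1, rAct_zero, iterate_tAct_zero, LinearMap.zero_apply,
    sub_zero] using this

theorem tMul_act (y : SkewPowerSeries D) (f : ContDual D N) :
    act (tMul y) f = act y (tActC f) := by
  refine contDual_ext fun m => ((hasSum_act y (tActC f) m).unique ?_).symm
  rw [tMul_eq y, add_act]
  convert (shift_act_hasSum y f m).add (hasSum_act (mapDelta y) f m) using 1
  · funext i
    show ((tAct D)^[i] (rAct D (coeff i y) (tAct D (f : N →ₗ[R] R)))) m = _
    rw [rAct_tAct, iterate_tAct_add, Function.iterate_succ_apply]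
    rfl
  · rfl

theorem iterate_tMul_act (i : ℕ) (y : SkewPowerSeries D) (f : ContDual D N) :
    act (tMul^[i] y) f = act y (tActC^[i] f) := by
  induction i generalizing f with
  | zero => rfl
  | succ i ih => rw [Function.iterate_succ_apply', tMul_act, ih, ← Function.iterate_succ_apply]

theorem coe_iterate_tActC (i : ℕ) (f : ContDual D N) :
    ((tActC^[i] f : ContDual D N) : N →ₗ[R] R) = (tAct D)^[i] (f : N →ₗ[R] R) := by
  induction i with
  | zero => rfl
  | succ i ih =>
    rw [Function.iterate_succ_apply', Function.iterate_succ_apply', ← ih]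
    rfl

/-- The action is continuous in the ring element. -/
theorem continuous_act_apply (f : ContDual D N) (m : N) :
    Continuous fun x : SkewPowerSeries D => (act x f : N →ₗ[R] R) m := by
  let φ : SkewPowerSeries D →+ R :=
    AddMonoidHom.mk' (fun x => (act x f : N →ₗ[R] R) m) fun x y => by rw [add_act]; rfl
  refine continuous_of_continuousAt_zero φ ?_
  intro U hU
  rw [map_zero] at hU
  obtain ⟨n, hn⟩ := exists_jacobson_pow_subset hU
  obtain ⟨K, hK⟩ := exists_iterate_tAct_rAct_mem f.2 n
  obtain ⟨l, hl⟩ := D.exists_isMonomial_mem n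
  rw [mem_map]
  filter_upwards [setOf_coeff_mem_nhds (D := D) l K] with x hx
  refine hn (hasSum_mem (hasSum_act x f m) fun i => ?_)
  by_cases hi : i < K
  · have h1 : ∀ m, rAct D (coeff i x) (f : N →ₗ[R] R) m ∈ Ring.jacobson R ^ l := fun m =>
      Ideal.mul_mem_left _ _ (SkewDatum.jacobson_pow_map_le D.σ.symm l _ (hx i hi))
    have := iterate_tAct_rAct_mem_of_forall hl h1 i 1 m
    rwa [rAct_one] at this
  · exact hK i (not_lt.1 hi) _ m

/-- Uniform continuity of the action in the linear map. -/
theorem exists_act_mem (n : ℕ) : ∃ l, ∀ (x : SkewPowerSeries D) (f : ContDual D N),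
    (∀ m, (f : N →ₗ[R] R) m ∈ Ring.jacobson R ^ l) →
      ∀ m, (act x f : N →ₗ[R] R) m ∈ Ring.jacobson R ^ n := by
  obtain ⟨l, hl⟩ := D.exists_isMonomial_mem n
  exact ⟨l, fun x f hf m => hasSum_mem (hasSum_act x f m) fun i =>
    iterate_tAct_rAct_mem_of_forall hl hf i _ m⟩

/-- `act y` as an additive map. -/
noncomputable def actHom (y : SkewPowerSeries D) : ContDual D N →+ ContDual D N :=
  AddMonoidHom.mk' (act y) (act_add y)

theorem mul_act (x y : SkewPowerSeries D) (f : ContDual D N) :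
    act (x * y) f = act y (act x f) := by
  let g : ℕ → ContDual D N := fun i => tActC^[i] (rActC (coeff i x) f)
  have hg : ∀ i m, (g i : N →ₗ[R] R) m =
      ((tAct D)^[i] (rAct D (coeff i x) (f : N →ₗ[R] R))) m := by
    intro i m
    rw [coe_iterate_tActC]
    rfl
  refine contDual_ext fun m => ?_
  -- the left-hand side
  have h1 : HasSum (fun i => (act y (g i) : N →ₗ[R] R) m) ((act (x * y) f : N →ₗ[R] R) m) := by
    let φ : SkewPowerSeries D →+ R :=
      AddMonoidHom.mk' (fun x => (act x f : N →ₗ[R] R) m) fun x y => by rw [add_act]; rfl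
    have := (hasSum_mul x y).map φ (continuous_act_apply f m)
    convert this using 1
    · funext i
      show _ = (act (coeff i x • tMul^[i] y) f : N →ₗ[R] R) m
      rw [smul_act, iterate_tMul_act]
    · rfl
  -- the right-hand side
  refine h1.unique ?_
  intro U hU
  rw [← map_add_left_nhds_zero, mem_map] at hU
  obtain ⟨n, hn⟩ := exists_jacobson_pow_subset hU
  obtain ⟨l, hl⟩ := exists_act_mem (D := D) (N := N) n
  obtain ⟨K, hK⟩ := exists_iterate_tAct_rAct_mem f.2 l
  refine mem_map.2 (mem_of_superset (Ici_mem_atTop (Finset.range K)) fun s hs => ?_)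
  have h2 : ∀ m, ((act x f - ∑ i ∈ s, g i : ContDual D N) : N →ₗ[R] R) m ∈
      Ring.jacobson R ^ l := by
    intro m
    have h3 := hasSum_sub_mem (n := l) (s := s) (hasSum_act x f m) fun i hi =>
      hK i (by
        by_contra h
        exact hi (hs (Finset.mem_range.2 (not_le.1 h)))) _ m
    have h4 : ((act x f - ∑ i ∈ s, g i : ContDual D N) : N →ₗ[R] R) m =
        (act x f : N →ₗ[R] R) m - ∑ i ∈ s, (g i : N →ₗ[R] R) m := by
      simp [LinearMap.sum_apply]
    rw [h4]
    simpa only [hg] using h3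
  have h5 := Submodule.neg_mem _ (hl y _ h2 m)
  have h6 : act y (act x f - ∑ i ∈ s, g i) = act y (act x f) - ∑ i ∈ s, act y (g i) := by
    have := map_sub (actHom y) (act x f) (∑ i ∈ s, g i)
    rw [map_sum] at this
    exact this
  rw [h6] at h5
  have h7 := hn h5
  simpa [LinearMap.sum_apply] using h7

/-- The right `S`-module structure on the group of continuous `R`-linear maps `N → R`. -/
noncomputable instance : Module (SkewPowerSeries D)ᵐᵒᵖ (ContDual D N) where
  smul x f := act x.unop f
  one_smul := one_act
  mul_smul x y f := mul_act y.unop x.unop f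
  smul_zero x := map_zero (actHom x.unop)
  smul_add x := act_add x.unop
  add_smul x y := add_act x.unop y.unop
  zero_smul f := by
    have := add_act 0 0 f
    rwa [add_zero, left_eq_add] at this

theorem op_smul_def (x : SkewPowerSeries D) (f : ContDual D N) :
    MulOpposite.op x • f = act x f := rfl

/-- `f^a (n) = f n * σ⁻¹ a`. -/
theorem op_C_smul_apply (a : R) (f : ContDual D N) (n : N) :
    ((MulOpposite.op (C a : SkewPowerSeries D) • f : ContDual D N) : N →ₗ[R] R) n =
      (f : N →ₗ[R] R) n * D.σ.symm a := by
  rw [op_smul_def]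
  show (act (a • (1 : SkewPowerSeries D)) f : N →ₗ[R] R) n = _
  rw [smul_act, one_act]
  rfl

/-- `f^t (n) = σ⁻¹ (f (t n) - δ (f n))`. -/
theorem op_t_smul_apply (f : ContDual D N) (n : N) :
    ((MulOpposite.op (t : SkewPowerSeries D) • f : ContDual D N) : N →ₗ[R] R) n =
      D.σ.symm ((f : N →ₗ[R] R) ((t : SkewPowerSeries D) • n) - D.δ ((f : N →ₗ[R] R) n)) := by
  rw [op_smul_def]
  have h : act (t : SkewPowerSeries D) f = tActC f := by
    have h := t_pow_mul 1 (1 : SkewPowerSeries D)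
    rw [mul_one, pow_one, Function.iterate_one] at h
    rw [h, tMul_act, one_act]
  rw [h]
  rfl

/-- The action of `S` extends that of the skew polynomials by continuity. -/
theorem continuous_op_smul_apply (f : ContDual D N) (n : N) :
    Continuous fun x : SkewPowerSeries D =>
      ((MulOpposite.op x • f : ContDual D N) : N →ₗ[R] R) n :=
  continuous_act_apply f n

/-- If `x = ∑ i, t ^ i * a i`, then `f^x = ∑ i, (f^(t ^ i))^(a i)`. -/
theorem hasSum_op_smul_apply {x : SkewPowerSeries D} {a : ℕ → R}
    (hx : HasSum (fun i => t ^ i * C (a i)) x) (f : ContDual D N) (n : N) :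
    HasSum (fun i => ((tAct D)^[i] (f : N →ₗ[R] R)) n * D.σ.symm (a i))
      (((MulOpposite.op x • f : ContDual D N) : N →ₗ[R] R) n) := by
  let φ : SkewPowerSeries D →+ R :=
    AddMonoidHom.mk' (fun x => (act x f : N →ₗ[R] R) n) fun x y => by rw [add_act]; rfl
  have := hx.map φ (continuous_act_apply f n)
  convert this using 1
  · funext i
    show _ = (act (t ^ i * C (a i)) f : N →ₗ[R] R) n
    rw [t_pow_mul, iterate_tMul_act, ← op_smul_def, op_C_smul_apply, coe_iterate_tActC]
  · rfl

variable {N' : Type u} [AddCommGroup N'] [Module R N'] [Module (SkewPowerSeries D) N']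
  [IsScalarTower R (SkewPowerSeries D) N'] [Module.Finite (SkewPowerSeries D) N']

/-- Composition of an `R`-linear map with an `S`-linear map. -/
noncomputable def precomp (g : N →ₗ[SkewPowerSeries D] N') (f : N' →ₗ[R] R) : N →ₗ[R] R where
  toFun n := f (g n)
  map_add' n n' := by rw [map_add, map_add]
  map_smul' a n := by
    rw [← C_smul (D := D) a n, map_smul, C_smul, map_smul]
    rfl

theorem iterate_tAct_precomp (g : N →ₗ[SkewPowerSeries D] N') (f : N' →ₗ[R] R) (i : ℕ) (a : R)
    (m : N) : ((tAct D)^[i] (rAct D a f)) (g m) = ((tAct D)^[i] (rAct D a (precomp g f))) m := by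
  induction i generalizing m with
  | zero => rfl
  | succ i ih =>
    rw [Function.iterate_succ_apply', Function.iterate_succ_apply', tAct_apply, tAct_apply,
      ← ih, ← ih, map_smul g]

theorem act_precomp (g : N →ₗ[SkewPowerSeries D] N') (x : SkewPowerSeries D) (f : ContDual D N')
    (f' : ContDual D N) (h : (f' : N →ₗ[R] R) = precomp g (f : N' →ₗ[R] R)) (m : N) :
    (act x f : N' →ₗ[R] R) (g m) = (act x f' : N →ₗ[R] R) m := by
  refine (hasSum_act x f (g m)).unique ?_
  have h1 := hasSum_act x f' m
  rw [h] at h1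
  convert h1 using 2 with i
  exact iterate_tAct_precomp g _ _ _ _

/-- An `S`-linear map `N → N'` induces an `S`-linear map of right `S`-modules on continuous
duals. -/
noncomputable def dualMap (g : N →ₗ[SkewPowerSeries D] N') :
    ContDual D N' →ₗ[(SkewPowerSeries D)ᵐᵒᵖ] ContDual D N where
  toFun f := ⟨precomp g f, by
    letI := moduleTopology (SkewPowerSeries D) N
    letI := moduleTopology (SkewPowerSeries D) N'
    haveI : IsModuleTopology (SkewPowerSeries D) N := ⟨rfl⟩
    haveI : IsModuleTopology (SkewPowerSeries D) N' := ⟨rfl⟩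
    haveI := IsModuleTopology.toContinuousAdd (SkewPowerSeries D) N'
    exact Continuous.comp (g := (f : N' →ₗ[R] R)) f.2
      (IsModuleTopology.continuous_of_linearMap g)⟩
  map_add' f f' := rfl
  map_smul' x f := contDual_ext fun m => act_precomp g x.unop f _ rfl m

theorem dualMap_apply (g : N →ₗ[SkewPowerSeries D] N') (f : ContDual D N') (n : N) :
    (dualMap g f : N →ₗ[R] R) n = (f : N' →ₗ[R] R) (g n) := rfl

end Dual

end SkewPowerSeries

section RightExt

open CategoryTheory

/-- The right `S`-module structure on `Ext^n_S(X, S)`, induced by the right multiplications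
of `S`, which are endomorphisms of the left `S`-module `S`. -/
noncomputable instance rightModuleExt {S : Type u} [Ring S] (X : ModuleCat.{u} S) (n : ℕ) :
    Module Sᵐᵒᵖ (Abelian.Ext X (ModuleCat.of S S) n) where
  smul x e := e.comp (Abelian.Ext.mk₀ (ModuleCat.ofHom
    (LinearMap.toSpanSingleton S S x.unop))) (add_zero n)
  one_smul e := by
    show e.comp (Abelian.Ext.mk₀ (ModuleCat.ofHom
      (LinearMap.toSpanSingleton S S (1 : S)))) (add_zero n) = e
    have : ModuleCat.ofHom (LinearMap.toSpanSingleton S S (1 : S)) = 𝟙 (ModuleCat.of S S) := by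
      ext; simp
    rw [this, Abelian.Ext.comp_mk₀_id]
  mul_smul x y e := by
    show e.comp (Abelian.Ext.mk₀ (ModuleCat.ofHom
        (LinearMap.toSpanSingleton S S (y.unop * x.unop)))) (add_zero n) =
      (e.comp (Abelian.Ext.mk₀ (ModuleCat.ofHom
        (LinearMap.toSpanSingleton S S y.unop))) (add_zero n)).comp
        (Abelian.Ext.mk₀ (ModuleCat.ofHom
          (LinearMap.toSpanSingleton S S x.unop))) (add_zero n)
    rw [Abelian.Ext.comp_assoc_of_third_deg_zero, Abelian.Ext.mk₀_comp_mk₀]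
    congr 2
    ext
    simp
  smul_zero x := Abelian.Ext.zero_comp _ _ _ _ (add_zero n)
  smul_add x e e' := Abelian.Ext.add_comp _ _ _ _
  add_smul x y e := by
    show e.comp (Abelian.Ext.mk₀ (ModuleCat.ofHom
        (LinearMap.toSpanSingleton S S (x.unop + y.unop)))) (add_zero n) =
      e.comp (Abelian.Ext.mk₀ (ModuleCat.ofHom
        (LinearMap.toSpanSingleton S S x.unop))) (add_zero n) +
      e.comp (Abelian.Ext.mk₀ (ModuleCat.ofHom
        (LinearMap.toSpanSingleton S S y.unop))) (add_zero n)
    rw [← Abelian.Ext.comp_add, ← Abelian.Ext.mk₀_add]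
    congr 2
    ext
    simp
  zero_smul e := by
    show e.comp (Abelian.Ext.mk₀ (ModuleCat.ofHom
        (LinearMap.toSpanSingleton S S (0 : S)))) (add_zero n) = 0
    have : ModuleCat.ofHom (LinearMap.toSpanSingleton S S (0 : S)) = 0 := by
      ext; simp
    rw [this, Abelian.Ext.mk₀_zero, Abelian.Ext.comp_zero]

end RightExt

/-- A resolution of an `S`-module `M` by finitely generated projective `S`-modules, where
`S = R[[t;σ,δ]]`. (The `R`-module structures on the terms are the restrictions of the `S`-module
structures, by the field `tower`.) -/
structure FGResolution {R : Type u} [Ring R] [UniformSpace R] [PseudocompactRing R]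
    [IsNoetherianRing R] (D : SkewDatum R) (M : Type u) [AddCommGroup M]
    [Module (SkewPowerSeries D) M] where
  X : ℕ → Type u
  [addCommGroup : ∀ n, AddCommGroup (X n)]
  [module : ∀ n, Module (SkewPowerSeries D) (X n)]
  [moduleR : ∀ n, Module R (X n)]
  [tower : ∀ n, IsScalarTower R (SkewPowerSeries D) (X n)]
  [finite : ∀ n, Module.Finite (SkewPowerSeries D) (X n)]
  [projective : ∀ n, Module.Projective (SkewPowerSeries D) (X n)]
  d : ∀ n, X (n + 1) →ₗ[SkewPowerSeries D] X n
  ε : X 0 →ₗ[SkewPowerSeries D] M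
  surjective : Function.Surjective ε
  exact_zero : Function.Exact (d 0) ε
  exact_succ : ∀ n, Function.Exact (d (n + 1)) (d n)

namespace FGResolution

open SkewPowerSeries

attribute [instance] addCommGroup module moduleR tower finite projective

variable {R : Type u} [Ring R] [UniformSpace R] [PseudocompactRing R] [IsNoetherianRing R]
  {D : SkewDatum R} {M : Type u} [AddCommGroup M] [Module (SkewPowerSeries D) M]
  (P : FGResolution D M)

/-- The `j`-cocycles of the complex of right `S`-modules of continuous `R`-linear maps from the
terms of the resolution to `R`. -/
noncomputable def cocycles (j : ℕ) :
    Submodule (SkewPowerSeries D)ᵐᵒᵖ (ContDual D (P.X j)) :=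
  LinearMap.ker (dualMap (P.d j))

/-- The `j`-coboundaries of the same complex. -/
noncomputable def coboundaries :
    (j : ℕ) → Submodule (SkewPowerSeries D)ᵐᵒᵖ (ContDual D (P.X j))
  | 0 => ⊥
  | j + 1 => LinearMap.range (dualMap (P.d j))

/-- The right `S`-module `Ext^j_R(M, R)^σ`: the `j`-th cohomology of the complex of right
`S`-modules of continuous `R`-linear maps from the terms of the resolution to `R`. -/
def TwistedExt (j : ℕ) : Type u :=
  P.cocycles j ⧸ (P.coboundaries j).submoduleOf (P.cocycles j)

noncomputable instance (j : ℕ) : AddCommGroup (P.TwistedExt j) :=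
  inferInstanceAs (AddCommGroup (P.cocycles j ⧸ (P.coboundaries j).submoduleOf (P.cocycles j)))

noncomputable instance (j : ℕ) : Module (SkewPowerSeries D)ᵐᵒᵖ (P.TwistedExt j) :=
  inferInstanceAs (Module (SkewPowerSeries D)ᵐᵒᵖ
    (P.cocycles j ⧸ (P.coboundaries j).submoduleOf (P.cocycles j)))

/-- The cohomology class of a cocycle. -/
noncomputable def toExt (j : ℕ) :
    P.cocycles j →ₗ[(SkewPowerSeries D)ᵐᵒᵖ] P.TwistedExt j :=
  Submodule.mkQ _

variable {P}

theorem mem_cocycles {j : ℕ} {z : ContDual D (P.X j)} :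
    z ∈ P.cocycles j ↔ ∀ x, (z : P.X j →ₗ[R] R) (P.d j x) = 0 := by
  constructor
  · intro h x
    rw [← dualMap_apply, LinearMap.mem_ker.1 h]
    rfl
  · intro h
    exact LinearMap.mem_ker.2 (contDual_ext h)

/-- A morphism of resolutions over a homomorphism `g : M → M'` of `S`-modules. -/
structure Hom {M' : Type u} [AddCommGroup M'] [Module (SkewPowerSeries D) M']
    (P : FGResolution D M) (P' : FGResolution D M') (g : M →ₗ[SkewPowerSeries D] M') where
  hom : ∀ n, P.X n →ₗ[SkewPowerSeries D] P'.X n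
  comm : ∀ n x, hom n (P.d n x) = P'.d n (hom (n + 1) x)
  comm_ε : ∀ x, g (P.ε x) = P'.ε (hom 0 x)

namespace Hom

variable {M' : Type u} [AddCommGroup M'] [Module (SkewPowerSeries D) M']
  {P' : FGResolution D M'} {g : M →ₗ[SkewPowerSeries D] M'} (G : Hom P P' g)

theorem dualMap_mem_cocycles (j : ℕ) {z : ContDual D (P'.X j)} (hz : z ∈ P'.cocycles j) :
    dualMap (G.hom j) z ∈ P.cocycles j := by
  rw [mem_cocycles] at hz ⊢
  intro x
  rw [dualMap_apply, G.comm, hz]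

theorem dualMap_mem_coboundaries (j : ℕ) {z : ContDual D (P'.X j)} (hz : z ∈ P'.coboundaries j) :
    dualMap (G.hom j) z ∈ P.coboundaries j := by
  rcases j with _ | j
  · have : z = 0 := hz
    rw [this, map_zero]
    exact Submodule.zero_mem _
  · obtain ⟨y, rfl⟩ := hz
    refine ⟨dualMap (G.hom j) y, contDual_ext fun x => ?_⟩
    simp only [dualMap_apply, G.comm]

/-- The map induced on cohomology by a morphism of resolutions. -/
noncomputable def map (j : ℕ) : P'.TwistedExt j →ₗ[(SkewPowerSeries D)ᵐᵒᵖ] P.TwistedExt j :=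
  Submodule.mapQ _ _ ((dualMap (G.hom j)).restrict fun _ hz => G.dualMap_mem_cocycles j hz)
    fun _ hz => G.dualMap_mem_coboundaries j hz

end Hom

section Comparison

open CategoryTheory

variable [Module R M]

/-- An `R`-linear morphism of complexes over the identity of `M`, from a resolution `Q` of `M` by
projective `R`-modules to the resolution `P`. -/
structure Lift (P : FGResolution D M) (Q : ProjectiveResolution (ModuleCat.of R M)) where
  hom : ∀ n, Q.complex.X n →ₗ[R] P.X n
  comm : ∀ n (x : Q.complex.X (n + 1)),
    hom n ((Q.complex.d (n + 1) n).hom x) = P.d n (hom (n + 1) x)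
  comm_ε : ∀ x : Q.complex.X 0, P.ε (hom 0 x) =
    (Q.π.f 0 ≫ (HomologicalComplex.singleObjXSelf (.down ℕ) 0 (ModuleCat.of R M)).hom).hom x

/-- The class in `Ext^j_R(M, R)` of the cocycle `z` for the resolution `P`; it is represented by
the composition of `z` with a morphism of complexes `Q → P`. -/
noncomputable def Lift.extClass {Q : ProjectiveResolution (ModuleCat.of R M)} (φ : Lift P Q) (j : ℕ)
    (z : P.cocycles j) : Abelian.Ext (ModuleCat.of R M) (ModuleCat.of R R) j :=
  Q.extMk (ModuleCat.ofHom ((z : ContDual D (P.X j)) ∘ₗ φ.hom j)) (j + 1) rfl (by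
    ext x
    have := mem_cocycles.1 z.2 (φ.hom (j + 1) x)
    rw [← φ.comm] at this
    exact this)

end Comparison

/-- Resolutions exist. -/
theorem nonempty [IsNoetherianRing (SkewPowerSeries D)] [Module.Finite (SkewPowerSeries D) M] :
    Nonempty (FGResolution D M) := by
  have step : ∀ p : (k : ℕ) × Submodule (SkewPowerSeries D) (Fin k → SkewPowerSeries D),
      ∃ (l : ℕ) (g : (Fin l → SkewPowerSeries D) →ₗ[SkewPowerSeries D]
        (Fin p.1 → SkewPowerSeries D)), LinearMap.range g = p.2 := by
    rintro ⟨k, K⟩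
    obtain ⟨l, g, hg⟩ := Module.Finite.exists_fin' (SkewPowerSeries D) K
    exact ⟨l, K.subtype ∘ₗ g, by rw [LinearMap.range_comp, LinearMap.range_eq_top.2 hg]; simp⟩
  choose l g hg using step
  obtain ⟨k, e, he⟩ := Module.Finite.exists_fin' (SkewPowerSeries D) M
  let s : ℕ → (k : ℕ) × Submodule (SkewPowerSeries D) (Fin k → SkewPowerSeries D) := fun n =>
    Nat.rec ⟨k, LinearMap.ker e⟩ (fun _ p => ⟨l p, LinearMap.ker (g p)⟩) n
  refine ⟨{
    X := fun n => Fin (s n).1 → SkewPowerSeries D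
    d := fun n => g (s n)
    ε := e
    surjective := he
    exact_zero := ?_
    exact_succ := fun n => ?_ }⟩
  · rw [LinearMap.exact_iff]
    exact (hg (s 0)).symm
  · rw [LinearMap.exact_iff]
    exact (hg (s (n + 1))).symm

end FGResolution

end Definitions

/-!
Write `S = R[[t;σ,δ]]`, and `N*` for the right `S`-module of continuous `R`-linear maps from a
finitely generated left `S`-module `N` to `R`. The coefficients of an `S`-linear map `F : N → S`
form a sequence in `N*` with `(F 0)^t = 0` and `(F (m + 1))^t = F m`, and every such sequence comes
from a unique `F` (`SkewPowerSeries.exists_dualMap_coeffDual_eq`). In other words, `Hom_S(N, S)` is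
the kernel of the endomorphism `Δ : G ↦ ((G m)^t - G (m - 1))` of the group of sequences in `N*`,
where `G (-1) = 0`. If `N` is projective, then `t` acts surjectively on `N*`
(`SkewPowerSeries.exists_op_t_smul_eq`), hence `Δ` is surjective. A resolution `P` of `M` therefore
gives a short exact sequence of complexes, and a long exact sequence which relates `Ext_S(M, S)` to
the kernel and the cokernel of `Δ` on sequences in `H^j(P*)`.

If `M` is finitely generated over `R`, then `H^j(P*)` is finitely generated over `R`, and `t` acts
on it in a topologically nilpotent way (`FGResolution.exists_cocycles_span` and
`FGResolution.mem_coboundaries_of_forall_t`). It follows that `Δ` is injective on sequences in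
`H^j(P*)`, and that each such sequence is congruent modulo the image of `Δ` to one of the form
`(z, 0, 0, …)` for a unique `z`: one sums the series of the products of the terms with the powers
of `t`. So `Hom_S(M, S) = 0`, and the connecting homomorphism `H^j(P*) → Ext^{j+1}_S(M, S)` is
bijective. It is described by the relation `FGResolution.IsConnecting`, from which its linearity
and its naturality are read off.

The finiteness of `H^j(P*)` comes from the comparison with a resolution `Q` of `M` by finitely
generated free `R`-modules. The terms of `P` are projective with respect to continuous `R`-linear
maps of linearly compact modules (`LinCompactFiltration.Cont.exists_lift`): a continuous map on `S`
amounts to a sequence tending to zero, the images of the powers of `t`, and a continuous map of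
linearly compact modules is open onto its image, so that such a sequence can be lifted to one
tending to zero. Hence `P` and `Q` are homotopy equivalent through continuous maps
(`FGResolution.nonempty_comparison`), and `H^j(P*)` is the usual `Ext^j_R(M, R)`. The cohomology of
`Q` consists of noetherian right `R`-modules in which the coboundaries are closed, because `R` is
linearly compact on the right too.
-/

set_option linter.unusedSectionVars false

universe v w

/-! ### Linearly compact filtrations -/

/-- A separated, complete, decreasing filtration of a module by submodules with artinian
quotients. A module carrying one is linearly compact for the linear topology it defines. -/
structure LinCompactFiltration (Λ : Type v) (A : Type w) [Ring Λ] [AddCommGroup A]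
    [Module Λ A] where
  /-- The members of the filtration. -/
  F : ℕ → Submodule Λ A
  anti : Antitone F
  artinian : ∀ n, IsArtinian Λ (A ⧸ F n)
  separated : ∀ a, (∀ n, a ∈ F n) → a = 0
  complete : ∀ a : ℕ → A, (∀ n, a (n + 1) - a n ∈ F n) → ∃ x, ∀ n, x - a n ∈ F n

namespace LinCompactFiltration

section General

variable {Λ : Type v} {A B E : Type w} [Ring Λ] [AddCommGroup A] [Module Λ A]
  [AddCommGroup B] [Module Λ B] [AddCommGroup E] [Module Λ E]

/-- Continuity of a linear map for the topologies given by two filtrations. -/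
def Cont (Φ : LinCompactFiltration Λ A) (Ψ : LinCompactFiltration Λ B) (f : A →ₗ[Λ] B) : Prop :=
  ∀ n, ∃ m, ∀ x ∈ Φ.F m, f x ∈ Ψ.F n

theorem Cont.comp {Φ : LinCompactFiltration Λ A} {Ψ : LinCompactFiltration Λ B}
    {Θ : LinCompactFiltration Λ E} {g : B →ₗ[Λ] E} {f : A →ₗ[Λ] B} (hg : Cont Ψ Θ g)
    (hf : Cont Φ Ψ f) : Cont Φ Θ (g ∘ₗ f) := by
  intro n
  obtain ⟨m, hm⟩ := hg n
  obtain ⟨l, hl⟩ := hf m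
  exact ⟨l, fun x hx => hm _ (hl x hx)⟩

theorem Cont.sub {Φ : LinCompactFiltration Λ A} {Ψ : LinCompactFiltration Λ B}
    {f g : A →ₗ[Λ] B} (hf : Cont Φ Ψ f) (hg : Cont Φ Ψ g) : Cont Φ Ψ (f - g) := by
  intro n
  obtain ⟨m, hm⟩ := hf n
  obtain ⟨l, hl⟩ := hg n
  exact ⟨max m l, fun x hx => Submodule.sub_mem _ (hm x (Φ.anti (le_max_left _ _) hx))
    (hl x (Φ.anti (le_max_right _ _) hx))⟩

theorem Cont.sum {ι : Type*} {Φ : LinCompactFiltration Λ A} {Ψ : LinCompactFiltration Λ B}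
    (s : Finset ι) {f : ι → A →ₗ[Λ] B} (hf : ∀ i, Cont Φ Ψ (f i)) :
    Cont Φ Ψ (∑ i ∈ s, f i) := by
  intro n
  choose m hm using fun i => hf i n
  refine ⟨s.sup m, fun x hx => ?_⟩
  rw [LinearMap.sum_apply]
  exact Submodule.sum_mem _ fun i hi => hm i x (Φ.anti (Finset.le_sup hi) hx)

theorem cont_id (Φ : LinCompactFiltration Λ A) : Cont Φ Φ LinearMap.id :=
  fun n => ⟨n, fun _ hx => hx⟩

/-- Linear compactness: a decreasing sequence of cosets of open submodules has a common
point. -/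
theorem exists_forall_sub_mem (Φ : LinCompactFiltration Λ A) {K : ℕ → Submodule Λ A}
    (hK : Antitone K) (hopen : ∀ n, ∃ m, Φ.F m ≤ K n) (c : ℕ → A)
    (hc : ∀ n, c (n + 1) - c n ∈ K n) : ∃ x, ∀ n, x - c n ∈ K n := by
  have hc' : ∀ n k, n ≤ k → c k - c n ∈ K n := by
    intro n k hk
    induction k, hk using Nat.le_induction with
    | base => simp
    | succ k hk ih => simpa using Submodule.add_mem _ (hK hk (hc k)) ih
  -- the images of the `K k` in the artinian module `A ⧸ F n` stabilise
  have hst : ∀ n, ∃ k, ∀ l, k ≤ l → K k ≤ K l ⊔ Φ.F n := by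
    intro n
    have := Φ.artinian n
    obtain ⟨k, hk⟩ := IsArtinian.monotone_stabilizes (R := Λ) (M := A ⧸ Φ.F n)
      ⟨fun k => OrderDual.toDual ((K k).map (Φ.F n).mkQ),
        fun a b hab => Submodule.map_mono (hK hab)⟩
    refine ⟨k, fun l hl x hx => ?_⟩
    have h1 : (K k).map (Φ.F n).mkQ = (K l).map (Φ.F n).mkQ := hk l hl
    obtain ⟨y, hy, hyx⟩ := h1 ▸ Submodule.mem_map_of_mem (f := (Φ.F n).mkQ) hx
    have h2 : x - y ∈ Φ.F n := by
      rw [← Submodule.Quotient.mk_eq_zero, ← Submodule.mkQ_apply, map_sub, hyx, sub_self]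
    rw [← add_sub_cancel y x]
    exact Submodule.add_mem _ (Submodule.mem_sup_left hy) (Submodule.mem_sup_right h2)
  choose k0 hk0 using hst
  let k : ℕ → ℕ := fun n => n + ∑ i ∈ Finset.range (n + 1), k0 i
  have hk0k : ∀ n, k0 n ≤ k n := fun n =>
    (Finset.single_le_sum (fun _ _ => Nat.zero_le _) (Finset.self_mem_range_succ n)).trans
      (Nat.le_add_left _ _)
  have hkmono : ∀ n, k n ≤ k (n + 1) := fun n => by
    simp only [k]
    rw [Finset.sum_range_succ _ (n + 1)]
    omega
  have hstep : ∀ n y, y - c (k n) ∈ K (k n) →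
      ∃ y', y' - c (k (n + 1)) ∈ K (k (n + 1)) ∧ y' - y ∈ Φ.F n := by
    intro n y hy
    have h1 : c (k (n + 1)) - y ∈ K (k n) := by
      have := Submodule.sub_mem _ (hc' _ _ (hkmono n)) hy
      simpa using this
    have h2 := hk0 n (k (n + 1)) ((hk0k n).trans (hkmono n)) (hK (hk0k n) h1)
    obtain ⟨e, he, b, hb, heb⟩ := Submodule.mem_sup.1 h2
    refine ⟨c (k (n + 1)) - e, by simpa using he, ?_⟩
    have : c (k (n + 1)) - e - y = b := by
      rw [sub_right_comm, ← heb, add_sub_cancel_left]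
    rwa [this]
  choose! s hs1 hs2 using hstep
  let y : ℕ → A := fun n => Nat.rec (c (k 0)) (fun n y => s n y) n
  have hy : ∀ n, y n - c (k n) ∈ K (k n) := by
    intro n
    induction n with
    | zero => simp [y]
    | succ n ih => exact hs1 n _ ih
  obtain ⟨x, hx⟩ := Φ.complete y fun n => hs2 n _ (hy n)
  refine ⟨x, fun N => ?_⟩
  obtain ⟨m, hm⟩ := hopen N
  let n := max N m
  have hNk : N ≤ k n := (le_max_left N m).trans (Nat.le_add_right _ _)
  have h1 : x - y n ∈ K N := hm (Φ.anti (le_max_right N m) (hx n))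
  have h2 : y n - c (k n) ∈ K N := hK hNk (hy n)
  simpa using Submodule.add_mem _ (Submodule.add_mem _ h1 h2) (hc' N _ hNk)

/-- The image of an open submodule under a continuous linear map is closed. -/
theorem Cont.exists_eq_of_forall {Φ : LinCompactFiltration Λ A} {Ψ : LinCompactFiltration Λ B}
    {f : A →ₗ[Λ] B} (hf : Cont Φ Ψ f) {K : Submodule Λ A} (hK : ∃ m, Φ.F m ≤ K) {b : B}
    (h : ∀ m, ∃ a ∈ K, f a - b ∈ Ψ.F m) : ∃ a ∈ K, f a = b := by
  choose c hcK hc using h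
  obtain ⟨x, hx⟩ := Φ.exists_forall_sub_mem (K := fun m => K ⊓ (Ψ.F m).comap f)
    (fun m n hmn => inf_le_inf_left _ (Submodule.comap_mono (Ψ.anti hmn)))
    (fun n => by
      obtain ⟨m, hm⟩ := hf n
      obtain ⟨l, hl⟩ := hK
      exact ⟨max m l, le_inf ((Φ.anti (le_max_right _ _)).trans hl)
        fun x hx => hm x (Φ.anti (le_max_left _ _) hx)⟩)
    c (fun n => ⟨Submodule.sub_mem _ (hcK _) (hcK _), by
      rw [SetLike.mem_coe, Submodule.mem_comap, map_sub, ← sub_sub_sub_cancel_right _ _ b]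
      exact Submodule.sub_mem _ (Ψ.anti (Nat.le_succ n) (hc _)) (hc n)⟩)
  refine ⟨x, ?_, ?_⟩
  · simpa using Submodule.add_mem _ (hx 0).1 (hcK 0)
  · rw [← sub_eq_zero]
    refine Ψ.separated _ fun n => ?_
    have h1 : f (x - c n) ∈ Ψ.F n := (hx n).2
    simpa using Submodule.add_mem _ h1 (hc n)

/-- A continuous linear map is open onto its image. -/
theorem Cont.exists_open {Φ : LinCompactFiltration Λ A} {Ψ : LinCompactFiltration Λ B}
    {f : A →ₗ[Λ] B} (hf : Cont Φ Ψ f) (n : ℕ) :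
    ∃ m, ∀ a, f a ∈ Ψ.F m → ∃ a' ∈ Φ.F n, f a' = f a := by
  have := Φ.artinian n
  obtain ⟨m, hm⟩ := IsArtinian.monotone_stabilizes (R := Λ) (M := A ⧸ Φ.F n)
    ⟨fun m => OrderDual.toDual (((Ψ.F m).comap f).map (Φ.F n).mkQ),
      fun a b hab => Submodule.map_mono (Submodule.comap_mono (Ψ.anti hab))⟩
  refine ⟨m, fun a ha => hf.exists_eq_of_forall ⟨n, le_rfl⟩ fun l => ?_⟩
  have h1 : ((Ψ.F m).comap f).map (Φ.F n).mkQ = ((Ψ.F (max m l)).comap f).map (Φ.F n).mkQ :=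
    hm _ (le_max_left _ _)
  obtain ⟨y, hy, hya⟩ := h1 ▸ Submodule.mem_map_of_mem (f := (Φ.F n).mkQ)
    (show a ∈ (Ψ.F m).comap f from ha)
  have h2 : a - y ∈ Φ.F n := by
    rw [← Submodule.Quotient.mk_eq_zero, ← Submodule.mkQ_apply, map_sub, hya, sub_self]
  refine ⟨a - y, h2, ?_⟩
  have h3 : f y ∈ Ψ.F l := Ψ.anti (le_max_right m l) hy
  rw [map_sub, sub_sub_cancel_left]
  exact Submodule.neg_mem _ h3

/-- The product filtration on a finite power. -/
def pi (Φ : LinCompactFiltration Λ A) (k : ℕ) : LinCompactFiltration Λ (Fin k → A) where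
  F n := Submodule.pi Set.univ fun _ => Φ.F n
  anti m n h := Submodule.pi_mono fun _ _ => Φ.anti h
  artinian n := by
    have := Φ.artinian n
    let f : (Fin k → A) →ₗ[Λ] (Fin k → A ⧸ Φ.F n) :=
      LinearMap.pi fun i => (Φ.F n).mkQ ∘ₗ LinearMap.proj i
    have hf : LinearMap.ker f = Submodule.pi Set.univ fun _ => Φ.F n := by
      ext x
      simp [f, funext_iff]
    rw [← hf]
    exact isArtinian_of_injective ((LinearMap.ker f).liftQ f le_rfl)
      (LinearMap.ker_eq_bot.1 (Submodule.ker_liftQ_eq_bot _ _ _ le_rfl))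
  separated a h := funext fun i => Φ.separated _ fun n => h n i trivial
  complete a h := by
    choose x hx using fun i => Φ.complete (fun n => a n i) fun n => h n i trivial
    exact ⟨x, fun n i _ => hx i n⟩

theorem mem_pi {Φ : LinCompactFiltration Λ A} {k n : ℕ} {x : Fin k → A} :
    x ∈ (Φ.pi k).F n ↔ ∀ i, x i ∈ Φ.F n := by
  simp [pi]

/-- The image filtration under a surjective linear map with closed kernel. -/
def map (Φ : LinCompactFiltration Λ A) (π : A →ₗ[Λ] B) (hπ : Function.Surjective π)
    (hker : ∀ a, (∀ n, ∃ b ∈ Φ.F n, π b = π a) → π a = 0) : LinCompactFiltration Λ B where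
  F n := (Φ.F n).map π
  anti m n h := Submodule.map_mono (Φ.anti h)
  artinian n := by
    have := Φ.artinian n
    exact isArtinian_of_surjective (A ⧸ Φ.F n)
      (Submodule.mapQ (Φ.F n) ((Φ.F n).map π) π (Submodule.le_comap_map _ _))
      (fun y => by
        obtain ⟨b, rfl⟩ := Submodule.mkQ_surjective _ y
        obtain ⟨a, rfl⟩ := hπ b
        exact ⟨(Φ.F n).mkQ a, rfl⟩)
  separated b h := by
    obtain ⟨a, rfl⟩ := hπ b
    exact hker a h
  complete b h := by
    choose e he heb using h
    obtain ⟨a0, ha0⟩ := hπ (b 0)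
    obtain ⟨x, hx⟩ := Φ.complete (fun n => a0 + ∑ i ∈ Finset.range n, e i) fun n => by
      simpa [Finset.sum_range_succ] using he n
    have hb : ∀ n, π (a0 + ∑ i ∈ Finset.range n, e i) = b n := by
      intro n
      rw [map_add, map_sum, ha0]
      simp only [heb]
      rw [Finset.sum_range_sub, add_sub_cancel]
    exact ⟨π x, fun n => ⟨_, hx n, by rw [map_sub, hb]⟩⟩

end General

end LinCompactFiltration

/-! ### Filtrations of power series and of finitely generated modules -/

section Opened

open Filter Topology PseudocompactRing

namespace LinCompactFiltration

section Jacobson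

variable (R : Type u) [Ring R] [UniformSpace R] [PseudocompactRing R] [IsNoetherianRing R]

theorem eq_zero_of_forall_mem_jacobson_pow {a : R} (h : ∀ n, a ∈ Ring.jacobson R ^ n) : a = 0 := by
  by_contra ha
  obtain ⟨n, hn⟩ := exists_jacobson_pow_subset (isOpen_compl_singleton.mem_nhds (Ne.symm ha))
  exact hn (h n) rfl

/-- Completeness of `R` for the `J`-adic topology, for `J` the Jacobson radical. -/
theorem exists_limit_jacobson_pow (a : ℕ → R)
    (h : ∀ n, a (n + 1) - a n ∈ Ring.jacobson R ^ n) :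
    ∃ x, ∀ n, x - a n ∈ Ring.jacobson R ^ n := by
  have hs : Summable fun i => a (i + 1) - a i :=
    summable_of_forall fun n => ⟨n, fun i hi => Ideal.pow_le_pow_right hi (h i)⟩
  refine ⟨∑' i, (a (i + 1) - a i) + a 0, fun n => ?_⟩
  have h1 : HasSum (fun i => a (i + n + 1) - a (i + n)) (∑' i, (a (i + 1) - a i) + a 0 - a n) := by
    have := (hasSum_nat_add_iff' n).2 hs.hasSum
    rwa [Finset.sum_range_sub, sub_sub_eq_add_sub] at this
  exact hasSum_mem h1 fun i => Ideal.pow_le_pow_right (Nat.le_add_left n i) (h (i + n))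

/-- The `J`-adic filtration of `R` as a left module, for `J` the Jacobson radical. -/
noncomputable def jacobson : LinCompactFiltration R R where
  F n := Ring.jacobson R ^ n
  anti _ _ h := Ideal.pow_le_pow_right h
  artinian n := isArtinian_of_isOpen (isOpen_jacobson_pow n)
  separated _ := eq_zero_of_forall_mem_jacobson_pow R
  complete := exists_limit_jacobson_pow R

/-- The filtration of the left `R`-module of power series given by the conditions that the first
`n` coefficients lie in the `n`-th power of the Jacobson radical; it defines the product
topology. -/
noncomputable def powerSeries (D : SkewDatum R) : LinCompactFiltration R (SkewPowerSeries D) where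
  F n :=
    { carrier := {x | ∀ i < n, SkewPowerSeries.coeff i x ∈ Ring.jacobson R ^ n}
      add_mem' := fun hx hy i hi => Ideal.add_mem _ (hx i hi) (hy i hi)
      zero_mem' := fun _ _ => Ideal.zero_mem _
      smul_mem' := fun a _ hx i hi => Ideal.mul_mem_left _ a (hx i hi) }
  anti m n h x hx i hi := Ideal.pow_le_pow_right h (hx i (hi.trans_le h))
  artinian n := by
    have := (jacobson R).artinian n
    let f : SkewPowerSeries D →ₗ[R] (Fin n → R ⧸ (jacobson R).F n) :=
      LinearMap.pi fun i => ((jacobson R).F n).mkQ ∘ₗ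
        { toFun := SkewPowerSeries.coeff (i : ℕ), map_add' := fun _ _ => rfl,
          map_smul' := fun _ _ => rfl }
    refine isArtinian_of_injective (Submodule.liftQ _ f ?_)
      (LinearMap.ker_eq_bot.1 (Submodule.ker_liftQ_eq_bot _ _ _ ?_))
    · intro x hx
      exact funext fun i => (Submodule.Quotient.mk_eq_zero _).2 (hx i i.2)
    · intro x hx i hi
      exact (Submodule.Quotient.mk_eq_zero _).1 (congrFun (LinearMap.mem_ker.1 hx) ⟨i, hi⟩)
  separated x h := SkewPowerSeries.ext fun m => eq_zero_of_forall_mem_jacobson_pow R fun n =>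
    Ideal.pow_le_pow_right (le_max_right (m + 1) n) (h _ m (by simp))
  complete a h := by
    -- the `m`-th coefficients satisfy the Cauchy condition from the index `m + 1` on
    have h1 : ∀ m, ∃ x : R, ∀ n, x - SkewPowerSeries.coeff m (a (max n (m + 1))) ∈
        Ring.jacobson R ^ n := by
      refine fun m => exists_limit_jacobson_pow R _ fun n => ?_
      rcases le_or_gt n m with hn | hn
      · rw [max_eq_right (by omega), max_eq_right (by omega), sub_self]
        exact Ideal.zero_mem _
      · rw [max_eq_left (by omega), max_eq_left (by omega)]
        exact h n m hn
    choose x hx using h1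
    refine ⟨(x : ℕ → R), fun n i hi => ?_⟩
    have := hx i n
    rwa [max_eq_left (by omega)] at this

end Jacobson

section ModuleFiltration

open SkewPowerSeries

variable {R : Type u} [Ring R] [UniformSpace R] [PseudocompactRing R] [IsNoetherianRing R]
  {D : SkewDatum R}

theorem mem_nhds_pi (k n : ℕ) :
    (((powerSeries R D).pi k).F n : Set (Fin k → SkewPowerSeries D)) ∈ 𝓝 0 := by
  have h : (((powerSeries R D).pi k).F n : Set (Fin k → SkewPowerSeries D)) =
      Set.univ.pi fun _ => {x : SkewPowerSeries D | ∀ i < n, coeff i x ∈ Ring.jacobson R ^ n} := by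
    ext x
    exact mem_pi.trans (by simp; rfl)
  rw [h]
  exact set_pi_mem_nhds Set.finite_univ fun _ _ => setOf_coeff_mem_nhds n n

theorem exists_pi_subset {k : ℕ} {W : Set (Fin k → SkewPowerSeries D)} (hW : W ∈ 𝓝 0) :
    ∃ n, (((powerSeries R D).pi k).F n : Set (Fin k → SkewPowerSeries D)) ⊆ W := by
  rw [nhds_pi, Filter.mem_pi] at hW
  obtain ⟨I, -, U, hU, hIU⟩ := hW
  choose ν K hν using fun i => exists_setOf_coeff_subset (hU i)
  let N := Finset.univ.sup fun i => max (ν i) (K i)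
  have hN : ∀ i, max (ν i) (K i) ≤ N := fun i =>
    Finset.le_sup (f := fun i => max (ν i) (K i)) (Finset.mem_univ i)
  refine ⟨N, fun x hx => hIU fun i _ => hν i fun j hj => ?_⟩
  exact Ideal.pow_le_pow_right ((le_max_left _ _).trans (hN i))
    (mem_pi.1 hx i j (hj.trans_le ((le_max_right _ _).trans (hN i))))

/-- An `S`-linear map between finite free modules is continuous for the product topology. -/
theorem cont_restrictScalars {k l : ℕ}
    (g : (Fin k → SkewPowerSeries D) →ₗ[SkewPowerSeries D] (Fin l → SkewPowerSeries D)) :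
    Cont ((powerSeries R D).pi k) ((powerSeries R D).pi l) (g.restrictScalars R) := by
  intro n
  have h1 : g ⁻¹' (((powerSeries R D).pi l).F n) ∈ 𝓝 0 :=
    (LinearMap.continuous_on_pi g).continuousAt.preimage_mem_nhds
      (by rw [map_zero]; exact mem_nhds_pi l n)
  obtain ⟨m, hm⟩ := exists_pi_subset h1
  exact ⟨m, fun x hx => hm hx⟩

variable {N : Type u} [AddCommGroup N] [Module R N] [Module (SkewPowerSeries D) N]
  [IsScalarTower R (SkewPowerSeries D) N] [IsNoetherianRing (SkewPowerSeries D)]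

/-- The filtration of a finitely generated `S`-module which is the image of that of `S ^ k` under
a surjective `S`-linear map. -/
noncomputable def ofSurjective {k : ℕ} (π : (Fin k → SkewPowerSeries D) →ₗ[SkewPowerSeries D] N)
    (hπ : Function.Surjective π) : LinCompactFiltration R N :=
  ((powerSeries R D).pi k).map (π.restrictScalars R) hπ fun a h => by
    -- the kernel is finitely generated over `S`, hence the image of a continuous map from
    -- some `S ^ l`
    obtain ⟨l, g, hg⟩ := Module.Finite.exists_fin' (SkewPowerSeries D) (LinearMap.ker π)
    obtain ⟨x, -, hx⟩ := (cont_restrictScalars ((LinearMap.ker π).subtype ∘ₗ g)).exists_eq_of_forall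
      (K := ⊤) ⟨0, le_top⟩ (b := a) fun m => by
        obtain ⟨b, hb, hba⟩ := h m
        obtain ⟨x, hx⟩ := hg ⟨a - b, by
          rw [LinearMap.mem_ker, map_sub, sub_eq_zero]
          exact hba.symm⟩
        refine ⟨x, trivial, ?_⟩
        have h1 : ((LinearMap.ker π).subtype ∘ₗ g) x = a - b := congrArg Subtype.val hx
        rw [LinearMap.restrictScalars_apply, h1, sub_sub_cancel_left]
        exact Submodule.neg_mem _ hb
    rw [← hx]
    exact (g x).2

end ModuleFiltration

end LinCompactFiltration

/-! ### Continuous linear maps out of projective modules -/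

open SkewPowerSeries

namespace LinCompactFiltration

section FiniteModule

variable {R : Type u} [Ring R] [UniformSpace R] [PseudocompactRing R] [IsNoetherianRing R]
  (D : SkewDatum R) [IsNoetherianRing (SkewPowerSeries D)]
  (N : Type u) [AddCommGroup N] [Module R N] [Module (SkewPowerSeries D) N]
  [IsScalarTower R (SkewPowerSeries D) N] [Module.Finite (SkewPowerSeries D) N]

theorem exists_surjective_fin : ∃ p : (k : ℕ) × ((Fin k → SkewPowerSeries D)
    →ₗ[SkewPowerSeries D] N), Function.Surjective p.2 := by
  obtain ⟨k, g, hg⟩ := Module.Finite.exists_fin' (SkewPowerSeries D) N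
  exact ⟨⟨k, g⟩, hg⟩

/-- A filtration of a finitely generated `S`-module which defines its pseudocompact topology. It
comes from a chosen surjection `S ^ k → N`. -/
noncomputable def ofFinite : LinCompactFiltration R N :=
  ofSurjective (exists_surjective_fin D N).choose.2 (exists_surjective_fin D N).choose_spec

/-- A chosen surjection `S ^ k → N`. -/
noncomputable def cover : (Fin (exists_surjective_fin D N).choose.1 → SkewPowerSeries D)
    →ₗ[SkewPowerSeries D] N := (exists_surjective_fin D N).choose.2

theorem cover_surjective : Function.Surjective (cover D N) :=
  (exists_surjective_fin D N).choose_spec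

theorem cont_cover : Cont ((powerSeries R D).pi _) (ofFinite D N)
    ((cover D N).restrictScalars R) :=
  fun n => ⟨n, fun _ hx => Submodule.mem_map_of_mem hx⟩

variable {D N}

theorem cont_of_comp_cover {A : Type u} [AddCommGroup A] [Module R A]
    {Φ : LinCompactFiltration R A} {f : N →ₗ[R] A}
    (h : Cont ((powerSeries R D).pi _) Φ (f ∘ₗ (cover D N).restrictScalars R)) :
    Cont (ofFinite D N) Φ f := by
  intro n
  obtain ⟨m, hm⟩ := h n
  refine ⟨m, ?_⟩
  rintro _ ⟨x, hx, rfl⟩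
  exact hm x hx

theorem cont_of_linear {k : ℕ} (g : (Fin k → SkewPowerSeries D) →ₗ[SkewPowerSeries D] N) :
    Cont ((powerSeries R D).pi _) (ofFinite D N) (g.restrictScalars R) := by
  obtain ⟨h, hh⟩ := Module.projective_lifting_property (cover D N) g (cover_surjective D N)
  rw [← hh]
  exact (cont_cover D N).comp (cont_restrictScalars h)

theorem cont_linear {N' : Type u} [AddCommGroup N'] [Module R N'] [Module (SkewPowerSeries D) N']
    [IsScalarTower R (SkewPowerSeries D) N'] [Module.Finite (SkewPowerSeries D) N']
    (g : N →ₗ[SkewPowerSeries D] N') :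
    Cont (ofFinite D N) (ofFinite D N') (g.restrictScalars R) :=
  cont_of_comp_cover (cont_of_linear (g ∘ₗ cover D N))

/-- Continuity for the pseudocompact topology is continuity for the filtrations. -/
theorem mem_contDual_iff_cont {f : N →ₗ[R] R} :
    f ∈ ContDual D N ↔ Cont (ofFinite D N) (jacobson R) f := by
  rw [mem_contDual_iff_of_surjective (cover D N) (cover_surjective D N)]
  constructor
  · intro h
    refine cont_of_comp_cover fun n => ?_
    obtain ⟨m, hm⟩ := exists_pi_subset (h.continuousAt.preimage_mem_nhds
      (t := (Ring.jacobson R ^ n : Ideal R)) (by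
        simp only [map_zero]
        exact jacobson_pow_mem_nhds n))
    exact ⟨m, fun x hx => hm hx⟩
  · intro h
    let φ : (Fin (exists_surjective_fin D N).choose.1 → SkewPowerSeries D) →+ R :=
      (f ∘ₗ (cover D N).restrictScalars R).toAddMonoidHom
    refine continuous_of_continuousAt_zero φ fun U hU => ?_
    rw [map_zero] at hU
    obtain ⟨n, hn⟩ := exists_jacobson_pow_subset hU
    obtain ⟨m, hm⟩ := h.comp (cont_cover D N) n
    exact mem_map.2 (mem_of_superset (mem_nhds_pi _ m) fun x hx => hn (hm x hx))

end FiniteModule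

section Sequences

variable {R : Type u} [Ring R] [UniformSpace R] [PseudocompactRing R] [IsNoetherianRing R]
  {D : SkewDatum R} {A B : Type u} [AddCommGroup A] [Module R A] [AddCommGroup B] [Module R B]

/-- Scalar multiplication on a linearly compact module is continuous in the scalar. -/
theorem exists_jacobson_pow_smul_mem (Φ : LinCompactFiltration R A) (a : A) (n : ℕ) :
    ∃ m, ∀ r ∈ Ring.jacobson R ^ m, r • a ∈ Φ.F n := by
  have := Φ.artinian n
  let f : R →ₗ[R] A ⧸ Φ.F n := (Φ.F n).mkQ ∘ₗ LinearMap.toSpanSingleton R A a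
  have hfl : IsFiniteLength R (LinearMap.range f) :=
    isFiniteLength_iff_isNoetherian_isArtinian.2 ⟨inferInstance, inferInstance⟩
  obtain ⟨m, hm⟩ := exists_jacobson_pow_le_annihilator hfl
  refine ⟨m, fun r hr => ?_⟩
  have h1 := Module.mem_annihilator.1 (hm hr) ⟨f 1, 1, rfl⟩
  have h2 : r • f 1 = 0 := congrArg Subtype.val h1
  rw [← map_smul, smul_eq_mul, mul_one] at h2
  exact (Submodule.Quotient.mk_eq_zero _).1 h2

/-- The partial sums of a power series converge to it. -/
theorem sub_sum_mem_powerSeries (x : SkewPowerSeries D) (n : ℕ) :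
    x - ∑ i ∈ Finset.range n, coeff i x • (monomial i 1 : SkewPowerSeries D) ∈
      (powerSeries R D).F n := by
  intro j hj
  let c : SkewPowerSeries D →+ R := AddMonoidHom.mk' (coeff j) fun _ _ => rfl
  have h : c (∑ i ∈ Finset.range n, coeff i x • (monomial i 1 : SkewPowerSeries D)) = c x := by
    rw [map_sum, Finset.sum_eq_single j]
    · show coeff j (coeff j x • (monomial j 1 : SkewPowerSeries D)) = coeff j x
      simp [coeff_monomial]
    · intro i _ hi
      show coeff j (coeff i x • (monomial i 1 : SkewPowerSeries D)) = 0
      simp [coeff_monomial, hi.symm]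
    · intro h
      exact (h (Finset.mem_range.2 hj)).elim
  have h2 : c (x - ∑ i ∈ Finset.range n, coeff i x • (monomial i 1 : SkewPowerSeries D)) = 0 := by
    rw [map_sub, h, sub_self]
  exact (congrArg (· ∈ Ring.jacobson R ^ n) h2).mpr (Ideal.zero_mem _)

/-- A sequence tending to zero in a linearly compact module is the image of the sequence of powers
of `t` under a continuous `R`-linear map from the power series. -/
theorem exists_cont_monomial_eq (Φ : LinCompactFiltration R A) (a : ℕ → A)
    (ha : ∀ n, ∃ K, ∀ i, K ≤ i → a i ∈ Φ.F n) :
    ∃ v : SkewPowerSeries D →ₗ[R] A, Cont (powerSeries R D) Φ v ∧ ∀ i, v (monomial i 1) = a i := by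
  choose K hK using ha
  let L : ℕ → ℕ := fun n => ∑ j ∈ Finset.range (n + 1), K j
  have hLK : ∀ n, K n ≤ L n := fun n =>
    Finset.single_le_sum (f := K) (fun _ _ => Nat.zero_le _) (Finset.self_mem_range_succ n)
  -- partial sums agree modulo `F n` from the index `L n` on
  have hs : ∀ (x : SkewPowerSeries D) n l l', L n ≤ l → l ≤ l' →
      ∑ i ∈ Finset.range l', coeff i x • a i - ∑ i ∈ Finset.range l, coeff i x • a i ∈ Φ.F n := by
    intro x n l l' hl hl'
    rw [Finset.sum_range_sub_sum_range hl']
    exact Submodule.sum_mem _ fun i hi => Submodule.smul_mem _ _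
      (hK n i ((hLK n).trans (hl.trans (Finset.mem_filter.1 hi).2)))
  have hLmono : ∀ n, L n ≤ L (n + 1) := fun n => by
    simp only [L]
    rw [Finset.sum_range_succ _ (n + 1)]
    omega
  have hex : ∀ x : SkewPowerSeries D, ∃ y, ∀ n,
      y - ∑ i ∈ Finset.range (L n), coeff i x • a i ∈ Φ.F n := fun x =>
    Φ.complete _ fun n => hs x n _ _ le_rfl (hLmono n)
  choose v hv using hex
  have huniq : ∀ y z : A, (∀ n, y - z ∈ Φ.F n) → y = z := fun y z h =>
    sub_eq_zero.1 (Φ.separated _ h)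
  let w : SkewPowerSeries D →ₗ[R] A :=
    { toFun := v
      map_add' := fun x y => huniq _ _ fun n => by
        have := Submodule.sub_mem _ (hv (x + y) n) (Submodule.add_mem _ (hv x n) (hv y n))
        simp only [coeff_add, add_smul, Finset.sum_add_distrib] at this
        convert this using 1
        abel
      map_smul' := fun r x => huniq _ _ fun n => by
        have := Submodule.sub_mem _ (hv (r • x) n) (Submodule.smul_mem _ r (hv x n))
        simp only [coeff_smul, mul_smul, smul_sub, Finset.smul_sum] at this
        convert this using 1
        simp }
  refine ⟨w, fun n => ?_, fun j => huniq _ _ fun n => ?_⟩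
  · choose m hm using fun i => Φ.exists_jacobson_pow_smul_mem (a i) n
    refine ⟨L n + (Finset.range (L n)).sup m, fun x hx => ?_⟩
    have h1 : ∑ i ∈ Finset.range (L n), coeff i x • a i ∈ Φ.F n :=
      Submodule.sum_mem _ fun i hi => hm i _ (Ideal.pow_le_pow_right
        ((Finset.le_sup hi).trans (Nat.le_add_left _ _))
        (hx i ((Finset.mem_range.1 hi).trans_le (Nat.le_add_right _ _))))
    have := Submodule.add_mem _ (hv x n) h1
    rwa [sub_add_cancel] at this
  · have h1 := hs (monomial j 1) n (L n) (max (L n) (j + 1)) le_rfl (le_max_left _ _)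
    have h2 : ∑ i ∈ Finset.range (max (L n) (j + 1)),
        coeff i (monomial j 1 : SkewPowerSeries D) • a i = a j := by
      rw [Finset.sum_eq_single j]
      · simp [coeff_monomial]
      · intro i _ hi
        simp [coeff_monomial, hi]
      · intro h
        simp at h
    rw [h2] at h1
    have := Submodule.sub_mem _ (hv (monomial j 1) n) h1
    rwa [sub_sub_sub_cancel_right] at this

/-- Continuous `R`-linear maps on the power series are determined by the images of the powers
of `t`. -/
theorem Cont.ext_monomial {Φ : LinCompactFiltration R A} {v w : SkewPowerSeries D →ₗ[R] A}
    (hv : Cont (powerSeries R D) Φ v) (hw : Cont (powerSeries R D) Φ w)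
    (h : ∀ i, v (monomial i 1) = w (monomial i 1)) : v = w := by
  ext x
  rw [← sub_eq_zero, ← LinearMap.sub_apply]
  refine Φ.separated _ fun n => ?_
  obtain ⟨m, hm⟩ := hv.sub hw n
  have h1 := hm _ (sub_sum_mem_powerSeries x m)
  have h2 : (v - w) (∑ i ∈ Finset.range m, coeff i x • (monomial i 1 : SkewPowerSeries D)) = 0 := by
    simp [h]
  rwa [map_sub, h2, sub_zero] at h1

/-- Continuous `R`-linear maps from the power series lift along continuous linear maps of linearly
compact modules. -/
theorem Cont.exists_lift_powerSeries {Φ : LinCompactFiltration R A} {Ψ : LinCompactFiltration R B}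
    {α : A →ₗ[R] B} (hα : Cont Φ Ψ α) {u : SkewPowerSeries D →ₗ[R] B}
    (hu : Cont (powerSeries R D) Ψ u) (hr : ∀ x, ∃ a, α a = u x) :
    ∃ v : SkewPowerSeries D →ₗ[R] A, Cont (powerSeries R D) Φ v ∧ α ∘ₗ v = u := by
  classical
  -- lifts of the images of the powers of `t`, chosen as small as possible
  have h1 : ∀ i, ∃ a, α a = u (monomial i 1) ∧
      ∀ n ≤ i, (∃ a' ∈ Φ.F n, α a' = u (monomial i 1)) → a ∈ Φ.F n := by
    intro i
    by_cases h : ∃ n, n ≤ i ∧ ∃ a' ∈ Φ.F n, α a' = u (monomial i 1)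
    · obtain ⟨n, hn⟩ := h
      let p : ℕ → Prop := fun n => ∃ a' ∈ Φ.F n, α a' = u (monomial i 1)
      obtain ⟨a, ha, hau⟩ : p (Nat.findGreatest p i) := Nat.findGreatest_spec hn.1 hn.2
      exact ⟨a, hau, fun m hm hpm => Φ.anti (Nat.le_findGreatest hm hpm) ha⟩
    · obtain ⟨a, ha⟩ := hr (monomial i 1)
      exact ⟨a, ha, fun n hn hn' => (h ⟨n, hn, hn'⟩).elim⟩
  choose a hau ha using h1
  obtain ⟨v, hv, hva⟩ := exists_cont_monomial_eq (D := D) Φ a fun n => by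
    obtain ⟨m, hm⟩ := hα.exists_open n
    obtain ⟨l, hl⟩ := hu m
    refine ⟨max n l, fun i hi => ha i n ((le_max_left _ _).trans hi) ?_⟩
    rw [← hau]
    refine hm _ ?_
    rw [hau]
    refine hl _ fun j hj => ?_
    rw [coeff_monomial, if_neg (by have := le_max_right n l; omega)]
    exact Ideal.zero_mem _
  exact ⟨v, hv, (hα.comp hv).ext_monomial hu fun i => by rw [LinearMap.comp_apply, hva, hau]⟩

theorem Cont.exists_lift_pi {Φ : LinCompactFiltration R A} {Ψ : LinCompactFiltration R B}
    {α : A →ₗ[R] B} (hα : Cont Φ Ψ α) {k : ℕ} {u : (Fin k → SkewPowerSeries D) →ₗ[R] B}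
    (hu : Cont ((powerSeries R D).pi k) Ψ u) (hr : ∀ x, ∃ a, α a = u x) :
    ∃ v : (Fin k → SkewPowerSeries D) →ₗ[R] A,
      Cont ((powerSeries R D).pi k) Φ v ∧ α ∘ₗ v = u := by
  have h1 : ∀ i, ∃ v : SkewPowerSeries D →ₗ[R] A, Cont (powerSeries R D) Φ v ∧
      α ∘ₗ v = u ∘ₗ LinearMap.single R (fun _ => SkewPowerSeries D) i := by
    intro i
    refine hα.exists_lift_powerSeries (hu.comp (Φ := powerSeries R D) fun n => ⟨n, fun x hx => ?_⟩)
      fun x => hr _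
    rw [mem_pi]
    intro j
    by_cases hj : j = i
    · subst hj
      simpa using hx
    · simp [hj]
  choose v hv hvu using h1
  refine ⟨∑ i, v i ∘ₗ LinearMap.proj i, Cont.sum _ fun i => (hv i).comp fun n => ⟨n, fun x hx =>
    mem_pi.1 hx i⟩, ?_⟩
  refine LinearMap.pi_ext' fun i => ?_
  rw [LinearMap.comp_assoc, ← hvu]
  congr 1
  ext x
  simp only [LinearMap.comp_apply, LinearMap.sum_apply, LinearMap.proj_apply,
    LinearMap.single_apply]
  rw [Finset.sum_eq_single i]
  · simp
  · intro j _ hj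
    simp [hj]
  · simp

/-- A finitely generated projective `S`-module is projective with respect to continuous `R`-linear
maps of linearly compact modules. -/
theorem Cont.exists_lift [IsNoetherianRing (SkewPowerSeries D)] {N : Type u} [AddCommGroup N]
    [Module R N] [Module (SkewPowerSeries D) N] [IsScalarTower R (SkewPowerSeries D) N]
    [Module.Finite (SkewPowerSeries D) N] [Module.Projective (SkewPowerSeries D) N]
    {Φ : LinCompactFiltration R A} {Ψ : LinCompactFiltration R B}
    {α : A →ₗ[R] B} (hα : Cont Φ Ψ α) {u : N →ₗ[R] B}
    (hu : Cont (ofFinite D N) Ψ u) (hr : ∀ x, ∃ a, α a = u x) :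
    ∃ v : N →ₗ[R] A, Cont (ofFinite D N) Φ v ∧ α ∘ₗ v = u := by
  obtain ⟨s, hs⟩ := Module.projective_lifting_property (cover D N) LinearMap.id
    (cover_surjective D N)
  obtain ⟨v, hv, hvu⟩ := hα.exists_lift_pi (hu.comp (cont_cover D N)) fun x => hr _
  refine ⟨v ∘ₗ s.restrictScalars R,
    cont_of_comp_cover (hv.comp (cont_restrictScalars (s ∘ₗ cover D N))), ?_⟩
  rw [← LinearMap.comp_assoc, hvu]
  ext x
  exact congrArg u (LinearMap.congr_fun hs x)

end Sequences

end LinCompactFiltration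

/-! ### Resolutions and continuous comparison morphisms -/

section ChainMaps

variable {R : Type u} [Ring R] {X Y : ℕ → Type u} [∀ n, AddCommGroup (X n)] [∀ n, Module R (X n)]
  [∀ n, AddCommGroup (Y n)] [∀ n, Module R (Y n)] {M : Type u} [AddCommGroup M] [Module R M]
  {dX : ∀ n, X (n + 1) →ₗ[R] X n} {dY : ∀ n, Y (n + 1) →ₗ[R] Y n} {εX : X 0 →ₗ[R] M}
  {εY : Y 0 →ₗ[R] M}

/-- Existence of a morphism of complexes over the identity whose components satisfy a property `C`
(such as continuity), if suitable maps lift along the differentials of the target. -/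
theorem exists_chainMap_of_lift (hX0 : ∀ x, εX (dX 0 x) = 0)
    (hX : ∀ n x, dX n (dX (n + 1) x) = 0)
    (C : ∀ n, (X n →ₗ[R] Y n) → Prop)
    (lift₀ : ∃ f : X 0 →ₗ[R] Y 0, C 0 f ∧ ∀ x, εY (f x) = εX x)
    (lift₁ : ∀ f : X 0 →ₗ[R] Y 0, C 0 f → (∀ x, εY (f (dX 0 x)) = 0) →
      ∃ g : X 1 →ₗ[R] Y 1, C 1 g ∧ ∀ x, dY 0 (g x) = f (dX 0 x))
    (lift : ∀ n (f : X (n + 1) →ₗ[R] Y (n + 1)), C (n + 1) f →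
      (∀ x, dY n (f (dX (n + 1) x)) = 0) →
      ∃ g : X (n + 2) →ₗ[R] Y (n + 2), C (n + 2) g ∧ ∀ x, dY (n + 1) (g x) = f (dX (n + 1) x)) :
    ∃ f : ∀ n, X n →ₗ[R] Y n, (∀ n, C n (f n)) ∧ (∀ x, εY (f 0 x) = εX x) ∧
      ∀ n x, f n (dX n x) = dY n (f (n + 1) x) := by
  obtain ⟨f0, hf0, hf0'⟩ := lift₀
  obtain ⟨f1, hf1, hf1'⟩ := lift₁ f0 hf0 fun x => by rw [hf0', hX0]
  let T : ℕ → Type u := fun n => {p : (X n →ₗ[R] Y n) × (X (n + 1) →ₗ[R] Y (n + 1)) //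
    C n p.1 ∧ C (n + 1) p.2 ∧ ∀ x, dY n (p.2 x) = p.1 (dX n x)}
  have step : ∀ n (p : T n), ∃ q : T (n + 1), q.1.1 = p.1.2 := by
    rintro n ⟨⟨f, g⟩, hf, hg, h⟩
    obtain ⟨k, hk, hk'⟩ := lift n g hg fun x => by
      have := h (dX (n + 1) x)
      rw [hX, map_zero] at this
      exact this
    exact ⟨⟨⟨g, k⟩, hg, hk, hk'⟩, rfl⟩
  choose s hs using step
  let p : ∀ n, T n := fun n => Nat.rec ⟨⟨f0, f1⟩, hf0, hf1, hf1'⟩ (fun n p => s n p) n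
  refine ⟨fun n => (p n).1.1, fun n => (p n).2.1, hf0', fun n x => ?_⟩
  have h1 : (p (n + 1)).1.1 = (p n).1.2 := hs n (p n)
  show (p n).1.1 (dX n x) = dY n ((p (n + 1)).1.1 x)
  rw [h1]
  exact ((p n).2.2.2 x).symm

/-- Existence of a null homotopy, with components satisfying a property `C`, of a morphism of
complexes over zero. -/
theorem exists_homotopy_of_lift (hX : ∀ n x, dX n (dX (n + 1) x) = 0)
    {f : ∀ n, X n →ₗ[R] Y n} (hf0 : ∀ x, εY (f 0 x) = 0)
    (hf : ∀ n x, f n (dX n x) = dY n (f (n + 1) x))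
    (C : ∀ n, (X n →ₗ[R] Y (n + 1)) → Prop)
    (lift₀ : (∀ x, εY (f 0 x) = 0) → ∃ h : X 0 →ₗ[R] Y 1, C 0 h ∧ ∀ x, dY 0 (h x) = f 0 x)
    (lift : ∀ n (h : X n →ₗ[R] Y (n + 1)), C n h →
      (∀ x, dY n ((f (n + 1) - h ∘ₗ dX n) x) = 0) →
      ∃ k : X (n + 1) →ₗ[R] Y (n + 2), C (n + 1) k ∧
        ∀ x, dY (n + 1) (k x) = (f (n + 1) - h ∘ₗ dX n) x) :
    ∃ h : ∀ n, X n →ₗ[R] Y (n + 1), (∀ n, C n (h n)) ∧ (∀ x, f 0 x = dY 0 (h 0 x)) ∧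
      ∀ n x, f (n + 1) x = dY (n + 1) (h (n + 1) x) + h n (dX n x) := by
  obtain ⟨h0, hh0, hh0'⟩ := lift₀ hf0
  let T : ℕ → Type u := fun n => {h : X n →ₗ[R] Y (n + 1) // C n h ∧
    ∀ x, dY n (h (dX n x)) = f n (dX n x)}
  have step : ∀ n (p : T n), ∃ q : T (n + 1), ∀ x,
      f (n + 1) x = dY (n + 1) (q.1 x) + p.1 (dX n x) := by
    rintro n ⟨h, hh, hh'⟩
    obtain ⟨k, hk, hk'⟩ := lift n h hh fun x => by
      simp [hh', ← hf]
    refine ⟨⟨k, hk, fun x => ?_⟩, fun x => ?_⟩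
    · rw [hk']
      simp [hX]
    · rw [hk']
      simp
  choose s hs using step
  let p : ∀ n, T n := fun n => Nat.rec ⟨h0, hh0, fun x => hh0' _⟩ (fun n p => s n p) n
  exact ⟨fun n => (p n).1, fun n => (p n).2.1, fun x => (hh0' x).symm, fun n => hs n (p n)⟩

end ChainMaps

/-- A resolution of an `R`-module by finitely generated free modules. -/
structure FreeResolution (R : Type u) [Ring R] (M : Type u) [AddCommGroup M] [Module R M] where
  /-- The ranks. -/
  rank : ℕ → ℕ
  /-- The differentials. -/
  d : ∀ n, (Fin (rank (n + 1)) → R) →ₗ[R] (Fin (rank n) → R)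
  /-- The augmentation. -/
  ε : (Fin (rank 0) → R) →ₗ[R] M
  surjective : Function.Surjective ε
  exact_zero : Function.Exact (d 0) ε
  exact_succ : ∀ n, Function.Exact (d (n + 1)) (d n)

namespace FreeResolution

theorem nonempty (R : Type u) [Ring R] [IsNoetherianRing R] (M : Type u) [AddCommGroup M]
    [Module R M] [Module.Finite R M] : Nonempty (FreeResolution R M) := by
  have step : ∀ p : (k : ℕ) × Submodule R (Fin k → R),
      ∃ (l : ℕ) (g : (Fin l → R) →ₗ[R] (Fin p.1 → R)), LinearMap.range g = p.2 := by
    rintro ⟨k, K⟩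
    obtain ⟨l, g, hg⟩ := Module.Finite.exists_fin' R K
    exact ⟨l, K.subtype ∘ₗ g, by rw [LinearMap.range_comp, LinearMap.range_eq_top.2 hg]; simp⟩
  choose l g hg using step
  obtain ⟨k, e, he⟩ := Module.Finite.exists_fin' R M
  let s : ℕ → (k : ℕ) × Submodule R (Fin k → R) := fun n =>
    Nat.rec ⟨k, LinearMap.ker e⟩ (fun _ p => ⟨l p, LinearMap.ker (g p)⟩) n
  refine ⟨{
    rank := fun n => (s n).1
    d := fun n => g (s n)
    ε := e
    surjective := he
    exact_zero := LinearMap.exact_iff.2 (hg (s 0)).symm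
    exact_succ := fun n => LinearMap.exact_iff.2 (hg (s (n + 1))).symm }⟩

end FreeResolution

namespace FGResolution

open LinCompactFiltration

variable {R : Type u} [Ring R] [UniformSpace R] [PseudocompactRing R] [IsNoetherianRing R]
  {D : SkewDatum R} {M : Type u} [AddCommGroup M] [Module R M] [Module (SkewPowerSeries D) M]
  [IsScalarTower R (SkewPowerSeries D) M]

/-- The differential of the resolution, as an `R`-linear map. -/
noncomputable def dR (P : FGResolution D M) (n : ℕ) : P.X (n + 1) →ₗ[R] P.X n :=
  (P.d n).restrictScalars R

/-- The augmentation of the resolution, as an `R`-linear map. -/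
noncomputable def εR (P : FGResolution D M) : P.X 0 →ₗ[R] M :=
  P.ε.restrictScalars R

/-- Continuous `R`-linear homotopy equivalences between a resolution by finitely generated
projective `S`-modules and one by finitely generated free `R`-modules. Continuity is recorded only
through its effect on functionals with values in `R`. -/
structure Comparison (P : FGResolution D M) (Q : FreeResolution R M) where
  /-- the morphism of complexes from the free resolution -/
  φ : ∀ n, (Fin (Q.rank n) → R) →ₗ[R] P.X n
  φ_ε : ∀ x, P.ε (φ 0 x) = Q.ε x
  φ_comm : ∀ n x, φ n (Q.d n x) = P.d n (φ (n + 1) x)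
  /-- the morphism of complexes to the free resolution -/
  ψ : ∀ n, P.X n →ₗ[R] (Fin (Q.rank n) → R)
  ψ_comm : ∀ n x, ψ n (P.d n x) = Q.d n (ψ (n + 1) x)
  ψ_cont : ∀ n (g : (Fin (Q.rank n) → R) →ₗ[R] R), g ∘ₗ ψ n ∈ ContDual D (P.X n)
  /-- the homotopy between `φ ∘ ψ` and the identity -/
  h : ∀ n, P.X n →ₗ[R] P.X (n + 1)
  h_cont : ∀ n, ∀ g ∈ ContDual D (P.X (n + 1)), g ∘ₗ h n ∈ ContDual D (P.X n)
  h_zero : ∀ x, x - φ 0 (ψ 0 x) = P.d 0 (h 0 x)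
  h_succ : ∀ n x, x - φ (n + 1) (ψ (n + 1) x) = P.d (n + 1) (h (n + 1) x) + h n (P.d n x)
  /-- the homotopy between `ψ ∘ φ` and the identity -/
  k : ∀ n, (Fin (Q.rank n) → R) →ₗ[R] (Fin (Q.rank (n + 1)) → R)
  k_zero : ∀ x, x - ψ 0 (φ 0 x) = Q.d 0 (k 0 x)
  k_succ : ∀ n x, x - ψ (n + 1) (φ (n + 1) x) = Q.d (n + 1) (k (n + 1) x) + k n (Q.d n x)

variable [IsNoetherianRing (SkewPowerSeries D)] [Module.Finite (SkewPowerSeries D) M]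

/-- A map from a projective module lifts along an exact sequence. -/
theorem exists_lift_of_exact {X A B E : Type u} [AddCommGroup X] [Module R X] [AddCommGroup A]
    [Module R A] [AddCommGroup B] [Module R B] [AddCommGroup E] [Module.Projective R X] [Module R E]
    {α : A →ₗ[R] B} {β : B →ₗ[R] E} (h : Function.Exact α β) {u : X →ₗ[R] B}
    (hu : ∀ x, β (u x) = 0) : ∃ v : X →ₗ[R] A, ∀ x, α (v x) = u x := by
  obtain ⟨v, hv⟩ := Module.projective_lifting_property α.rangeRestrict
    (u.codRestrict (LinearMap.range α) fun x => (h _).1 (hu x)) α.surjective_rangeRestrict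
  exact ⟨v, fun x => congrArg Subtype.val (LinearMap.congr_fun hv x)⟩

/-- Every `R`-linear map from a finite free `R`-module to a linearly compact module is
continuous. -/
theorem cont_pi_jacobson {k : ℕ} {A : Type u} [AddCommGroup A] [Module R A]
    (Φ : LinCompactFiltration R A) (f : (Fin k → R) →ₗ[R] A) :
    Cont ((jacobson R).pi k) Φ f := by
  intro n
  choose m hm using fun i => Φ.exists_jacobson_pow_smul_mem (f (Pi.single i 1)) n
  refine ⟨Finset.univ.sup m, fun x hx => ?_⟩
  rw [← LinearMap.sum_single_apply (fun _ => R) x, map_sum]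
  refine Submodule.sum_mem _ fun i _ => ?_
  have h1 : f (Pi.single i (x i)) = x i • f (Pi.single i 1) := by
    rw [← map_smul, ← Pi.single_smul, smul_eq_mul, mul_one]
  have h2 := hm i (x i) (Ideal.pow_le_pow_right (Finset.le_sup (Finset.mem_univ i)) (mem_pi.1 hx i))
  rw [← h1] at h2
  exact h2

/-- The comparison theorem: all the morphisms and homotopies that start from a term of `P` can be
chosen continuous, since these terms are projective with respect to continuous `R`-linear maps. -/
theorem nonempty_comparison (P : FGResolution D M) (Q : FreeResolution R M) :
    Nonempty (Comparison P Q) := by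
  have hP0 := P.exact_zero.apply_apply_eq_zero
  have hP := fun n => (P.exact_succ n).apply_apply_eq_zero
  have hQ0 := Q.exact_zero.apply_apply_eq_zero
  have hQ := fun n => (Q.exact_succ n).apply_apply_eq_zero
  obtain ⟨φ, -, φε, φc⟩ := exists_chainMap_of_lift
    (X := fun n => Fin (Q.rank n) → R) (Y := P.X) (dX := Q.d) (dY := P.dR) (εX := Q.ε)
    (εY := P.εR) hQ0 hQ (fun _ _ => True)
    (by
      obtain ⟨f, hf⟩ := Module.projective_lifting_property P.εR Q.ε P.surjective
      exact ⟨f, trivial, LinearMap.congr_fun hf⟩)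
    (fun f _ hf => by
      obtain ⟨g, hg⟩ := exists_lift_of_exact (α := P.dR 0) (β := P.εR) (u := f ∘ₗ Q.d 0)
        P.exact_zero hf
      exact ⟨g, trivial, hg⟩)
    (fun n f _ hf => by
      obtain ⟨g, hg⟩ := exists_lift_of_exact (α := P.dR (n + 1)) (β := P.dR n)
        (u := f ∘ₗ Q.d (n + 1)) (P.exact_succ n) hf
      exact ⟨g, trivial, hg⟩)
  have hd : ∀ n, Cont (ofFinite D (P.X (n + 1))) (ofFinite D (P.X n)) (P.dR n) :=
    fun n => cont_linear (P.d n)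
  have hdQ : ∀ n, Cont ((jacobson R).pi _) ((jacobson R).pi _) (Q.d n) := fun n =>
    cont_pi_jacobson _ _
  obtain ⟨ψ, ψC, ψε, ψc⟩ := exists_chainMap_of_lift
    (X := P.X) (Y := fun n => Fin (Q.rank n) → R) (dX := P.dR) (dY := Q.d) (εX := P.εR)
    (εY := Q.ε) hP0 hP (fun n f => Cont (ofFinite D (P.X n)) ((jacobson R).pi _) f)
    (by
      obtain ⟨f, hf, hf'⟩ := (cont_pi_jacobson (ofFinite D M) Q.ε).exists_lift
        (cont_linear P.ε) fun x => Q.surjective _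
      exact ⟨f, hf, LinearMap.congr_fun hf'⟩)
    (fun f hf hf' => by
      obtain ⟨g, hg, hg'⟩ := (hdQ 0).exists_lift (hf.comp (hd 0)) fun x =>
        (Q.exact_zero _).1 (hf' x)
      exact ⟨g, hg, LinearMap.congr_fun hg'⟩)
    (fun n f hf hf' => by
      obtain ⟨g, hg, hg'⟩ := (hdQ (n + 1)).exists_lift (hf.comp (hd (n + 1))) fun x =>
        (Q.exact_succ n _).1 (hf' x)
      exact ⟨g, hg, LinearMap.congr_fun hg'⟩)
  have hφψ : ∀ n, Cont (ofFinite D (P.X n)) (ofFinite D (P.X n)) (LinearMap.id - φ n ∘ₗ ψ n) :=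
    fun n => (cont_id _).sub ((cont_pi_jacobson _ _).comp (ψC n))
  obtain ⟨h, hC, h0, h1⟩ := exists_homotopy_of_lift
    (X := P.X) (Y := P.X) (dX := P.dR) (dY := P.dR) (εY := P.εR)
    (f := fun n => LinearMap.id - φ n ∘ₗ ψ n) hP
    (fun x => by simp [φε, ψε]) (fun n x => by simp [φc, ψc])
    (fun n f => Cont (ofFinite D (P.X n)) (ofFinite D (P.X (n + 1))) f)
    (fun hf => by
      obtain ⟨g, hg, hg'⟩ := (hd 0).exists_lift (hφψ 0) fun x => (P.exact_zero _).1 (hf x)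
      exact ⟨g, hg, LinearMap.congr_fun hg'⟩)
    (fun n f hf hf' => by
      obtain ⟨g, hg, hg'⟩ := (hd (n + 1)).exists_lift ((hφψ (n + 1)).sub (hf.comp (hd n)))
        fun x => (P.exact_succ n _).1 (hf' x)
      exact ⟨g, hg, LinearMap.congr_fun hg'⟩)
  obtain ⟨k, -, k0, k1⟩ := exists_homotopy_of_lift
    (X := fun n => Fin (Q.rank n) → R) (Y := fun n => Fin (Q.rank n) → R) (dX := Q.d) (dY := Q.d)
    (εY := Q.ε) (f := fun n => LinearMap.id - ψ n ∘ₗ φ n) hQ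
    (fun x => by simp [φε, ψε]) (fun n x => by simp [φc, ψc])
    (fun n f => True)
    (fun hf => by
      obtain ⟨g, hg⟩ := exists_lift_of_exact Q.exact_zero hf
      exact ⟨g, trivial, hg⟩)
    (fun n f hf hf' => by
      obtain ⟨g, hg⟩ := exists_lift_of_exact (Q.exact_succ n) hf'
      exact ⟨g, trivial, hg⟩)
  exact ⟨{
    φ := φ
    φ_ε := φε
    φ_comm := φc
    ψ := ψ
    ψ_comm := ψc
    ψ_cont := fun n g => mem_contDual_iff_cont.2 ((cont_pi_jacobson _ g).comp (ψC n))
    h := h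
    h_cont := fun n g hg => mem_contDual_iff_cont.2 ((mem_contDual_iff_cont.1 hg).comp (hC n))
    h_zero := h0
    h_succ := h1
    k := k
    k_zero := k0
    k_succ := k1 }⟩

end FGResolution

/-! ### Duals and cohomology over the coefficient ring -/

section RightArtinian

open MulOpposite

variable (R : Type u) [Ring R]

/-- The ideal of the opposite ring which corresponds to the Jacobson radical of `R`. -/
noncomputable def opJacobson : Ideal Rᵐᵒᵖ :=
  RingHom.ker (Ideal.Quotient.mk (Ring.jacobson R)).op

instance : (opJacobson R).IsTwoSided := inferInstanceAs (RingHom.ker _).IsTwoSided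

variable {R}

theorem mem_opJacobson {x : Rᵐᵒᵖ} : x ∈ opJacobson R ↔ x.unop ∈ Ring.jacobson R := by
  rw [opJacobson, RingHom.mem_ker, ← Ideal.Quotient.eq_zero_iff_mem]
  exact op_eq_zero_iff _

theorem unop_mem_of_mem_opJacobson_pow {n : ℕ} {x : Rᵐᵒᵖ} (hx : x ∈ opJacobson R ^ n) :
    x.unop ∈ Ring.jacobson R ^ n := by
  induction n generalizing x with
  | zero => simp [Submodule.pow_zero, Ideal.one_eq_top]
  | succ n ih =>
    rw [Ideal.IsTwoSided.pow_succ] at hx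
    induction hx using Submodule.mul_induction_on' with
    | mem_mul_mem a ha b hb =>
      rw [Submodule.pow_succ, unop_mul]
      exact Ideal.mul_mem_mul (ih hb) (mem_opJacobson.1 ha)
    | add a _ b _ ha hb => exact Ideal.add_mem _ ha hb

/-- The powers of the Jacobson radical, as submodules of the right module `R`. -/
def jacobsonPowRight (n : ℕ) : Submodule Rᵐᵒᵖ R where
  carrier := {x | x ∈ Ring.jacobson R ^ n}
  add_mem' := Ideal.add_mem _
  zero_mem' := Ideal.zero_mem _
  smul_mem' a _ hx := Ideal.mul_mem_right a.unop _ hx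

/-- The semisimple ring `R ⧸ J` is artinian on both sides. -/
theorem isArtinian_quotient_opJacobson [IsArtinian R (R ⧸ Ring.jacobson R)] :
    IsArtinian Rᵐᵒᵖ (Rᵐᵒᵖ ⧸ opJacobson R) := by
  have h1 : IsArtinianRing (R ⧸ Ring.jacobson R) := isArtinian_of_tower R ‹_›
  have h2 : IsSemisimpleRing (R ⧸ Ring.jacobson R) :=
    IsArtinianRing.isSemisimpleRing_iff_jacobson.mpr (Ring.jacobson_quotient_jacobson R)
  have h3 : IsArtinianRing (R ⧸ Ring.jacobson R)ᵐᵒᵖ := inferInstance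
  have e := RingHom.quotientKerEquivOfSurjective
    (f := (Ideal.Quotient.mk (Ring.jacobson R)).op) (fun y => by
      obtain ⟨r, hr⟩ := Ideal.Quotient.mk_surjective y.unop
      exact ⟨op r, by rw [← op_unop y, ← hr]; rfl⟩)
  have h4 : IsArtinianRing (Rᵐᵒᵖ ⧸ opJacobson R) := e.symm.isArtinianRing
  -- the submodules over the ring `Rᵐᵒᵖ` and over its quotient are the same
  let f : Submodule Rᵐᵒᵖ (Rᵐᵒᵖ ⧸ opJacobson R) → Ideal (Rᵐᵒᵖ ⧸ opJacobson R) := fun K =>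
    { K.toAddSubmonoid with
      smul_mem' := fun c x hx => by
        obtain ⟨r, rfl⟩ := Ideal.Quotient.mk_surjective c
        exact K.smul_mem r hx }
  have hf : StrictMono f := fun K L h => h
  exact ⟨hf.wellFoundedLT.wf⟩

variable [UniformSpace R] [PseudocompactRing R] [IsNoetherianRing R] [IsNoetherianRing Rᵐᵒᵖ]

theorem isArtinian_quotient_opJacobson_pow (n : ℕ) :
    IsArtinian Rᵐᵒᵖ (Rᵐᵒᵖ ⧸ opJacobson R ^ n) := by
  have h0 : IsArtinian R (R ⧸ Ring.jacobson R) := isArtinian_of_isOpen isOpen_jacobson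
  have h1 := isArtinian_quotient_opJacobson (R := R)
  induction n with
  | zero =>
    have : Subsingleton (Rᵐᵒᵖ ⧸ opJacobson R ^ 0) := by
      rw [Submodule.pow_zero, Ideal.one_eq_top]
      infer_instance
    infer_instance
  | succ n ih =>
    rw [Ideal.IsTwoSided.pow_succ]
    exact isArtinian_quotient_mul (IsNoetherian.noetherian _)

/-- A left and right noetherian pseudocompact ring has right artinian quotients by the powers of
its Jacobson radical. -/
theorem isArtinian_quotient_jacobsonPowRight (n : ℕ) :
    IsArtinian Rᵐᵒᵖ (R ⧸ (jacobsonPowRight n : Submodule Rᵐᵒᵖ R)) := by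
  have := isArtinian_quotient_opJacobson_pow (R := R) n
  have h1 : ∀ x : Rᵐᵒᵖ, LinearMap.toSpanSingleton Rᵐᵒᵖ R 1 x = x.unop := fun x => one_mul _
  have hle : opJacobson R ^ n ≤
      (jacobsonPowRight n).comap (LinearMap.toSpanSingleton Rᵐᵒᵖ R 1) := fun x hx => by
    rw [Submodule.mem_comap, h1]
    exact unop_mem_of_mem_opJacobson_pow hx
  refine isArtinian_of_surjective (Rᵐᵒᵖ ⧸ opJacobson R ^ n) (Submodule.mapQ _ _ _ hle) fun y => ?_
  obtain ⟨r, rfl⟩ := Submodule.mkQ_surjective _ y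
  refine ⟨(opJacobson R ^ n).mkQ (op r), ?_⟩
  rw [Submodule.mkQ_apply, Submodule.mapQ_apply, h1]
  rfl

variable (R)

/-- The `J`-adic filtration of `R` as a right module, for `J` the Jacobson radical. -/
noncomputable def LinCompactFiltration.jacobsonRight : LinCompactFiltration Rᵐᵒᵖ R where
  F := jacobsonPowRight
  anti _ _ h _ hx := Ideal.pow_le_pow_right h hx
  artinian := isArtinian_quotient_jacobsonPowRight
  separated _ := LinCompactFiltration.eq_zero_of_forall_mem_jacobson_pow R
  complete := LinCompactFiltration.exists_limit_jacobson_pow R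

/-- The `J`-adic filtration of the right module of functionals on `R ^ k`. -/
noncomputable def LinCompactFiltration.dual (k : ℕ) :
    LinCompactFiltration Rᵐᵒᵖ ((Fin k → R) →ₗ[R] R) :=
  ((jacobsonRight R).pi k).map ((Pi.basisFun R (Fin k)).constr Rᵐᵒᵖ).toLinearMap
    ((Pi.basisFun R (Fin k)).constr Rᵐᵒᵖ).surjective fun a h => by
      have : a = 0 := ((jacobsonRight R).pi k).separated a fun n => by
        obtain ⟨b, hb, hab⟩ := h n
        rwa [← ((Pi.basisFun R (Fin k)).constr Rᵐᵒᵖ).injective hab]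
      rw [this, map_zero]

variable {R}

theorem LinCompactFiltration.mem_dual {k n : ℕ} {f : (Fin k → R) →ₗ[R] R} :
    f ∈ (dual R k).F n ↔ ∀ x, f x ∈ Ring.jacobson R ^ n := by
  constructor
  · rintro ⟨a, ha, rfl⟩ x
    rw [LinearEquiv.coe_coe, Module.Basis.constr_apply_fintype]
    refine Ideal.sum_mem _ fun i _ => ?_
    have h1 : a i ∈ Ring.jacobson R ^ n := mem_pi.1 ha i
    rw [smul_eq_mul]
    exact Ideal.mul_mem_left _ _ h1
  · intro h
    refine ⟨((Pi.basisFun R (Fin k)).constr Rᵐᵒᵖ).symm f, ?_, LinearEquiv.apply_symm_apply _ _⟩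
    exact mem_pi.2 fun i => h _

instance isNoetherian_dual (k : ℕ) : IsNoetherian Rᵐᵒᵖ ((Fin k → R) →ₗ[R] R) := by
  have : IsNoetherian Rᵐᵒᵖ R := isNoetherian_of_surjective
    (LinearMap.toSpanSingleton Rᵐᵒᵖ R 1) (LinearMap.range_eq_top.2 fun r => ⟨op r, one_mul r⟩)
  exact isNoetherian_of_linearEquiv ((Pi.basisFun R (Fin k)).constr Rᵐᵒᵖ)

end RightArtinian

namespace FreeResolution

open MulOpposite LinCompactFiltration

variable {R : Type u} [Ring R]

/-- Composition with an `R`-linear map, as a map of right modules of functionals. -/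
def dualMap {A B : Type u} [AddCommGroup A] [Module R A] [AddCommGroup B] [Module R B]
    (f : A →ₗ[R] B) : (B →ₗ[R] R) →ₗ[Rᵐᵒᵖ] (A →ₗ[R] R) where
  toFun w := w ∘ₗ f
  map_add' _ _ := rfl
  map_smul' _ _ := rfl

variable {M : Type u} [AddCommGroup M] [Module R M]

/-- The `j`-cocycles of the complex of functionals on a free resolution. -/
def cocycles (Q : FreeResolution R M) (j : ℕ) :
    Submodule Rᵐᵒᵖ ((Fin (Q.rank j) → R) →ₗ[R] R) :=
  LinearMap.ker (dualMap (Q.d j))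

/-- The `j`-coboundaries of the complex of functionals on a free resolution. -/
def coboundaries (Q : FreeResolution R M) :
    (j : ℕ) → Submodule Rᵐᵒᵖ ((Fin (Q.rank j) → R) →ₗ[R] R)
  | 0 => ⊥
  | j + 1 => LinearMap.range (dualMap (Q.d j))

/-- The coboundaries are closed for the `J`-adic topology. -/
theorem mem_coboundaries_of_forall [UniformSpace R] [PseudocompactRing R] [IsNoetherianRing R]
    [IsNoetherianRing Rᵐᵒᵖ] (Q : FreeResolution R M) (j : ℕ) {y : (Fin (Q.rank j) → R) →ₗ[R] R}
    (h : ∀ n, ∃ b ∈ Q.coboundaries j, ∀ x, b x - y x ∈ Ring.jacobson R ^ n) :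
    y ∈ Q.coboundaries j := by
  rcases j with _ | j
  · refine (dual R _).separated y fun n => mem_dual.2 fun x => ?_
    obtain ⟨b, hb, hby⟩ := h n
    obtain rfl : b = 0 := hb
    simpa using hby x
  · have hc : Cont (dual R _) (dual R _) (dualMap (Q.d j)) := fun n =>
      ⟨n, fun f hf => mem_dual.2 fun x => mem_dual.1 hf _⟩
    obtain ⟨a, -, ha⟩ := hc.exists_eq_of_forall (K := ⊤) ⟨0, le_top⟩ (b := y) fun n => by
      obtain ⟨_, ⟨a, rfl⟩, hby⟩ := h n
      exact ⟨a, trivial, mem_dual.2 hby⟩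
    exact ⟨a, ha⟩

end FreeResolution

/-! ### Finiteness and topological nilpotence on cohomology -/

namespace SkewPowerSeries

open MulOpposite

variable {R : Type u} [Ring R] [UniformSpace R] [PseudocompactRing R] [IsNoetherianRing R]
  {D : SkewDatum R} {N : Type u} [AddCommGroup N] [Module R N] [Module (SkewPowerSeries D) N]
  [IsScalarTower R (SkewPowerSeries D) N]

theorem contDual_zero_apply (n : N) : ((0 : ContDual D N) : N →ₗ[R] R) n = 0 := rfl

variable [Module.Finite (SkewPowerSeries D) N]

theorem coe_op_C_smul (a : R) (f : ContDual D N) :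
    ((op (C a : SkewPowerSeries D) • f : ContDual D N) : N →ₗ[R] R) = rAct D a f :=
  LinearMap.ext fun n => op_C_smul_apply a f n

theorem coe_op_t_smul (f : ContDual D N) :
    ((op (t : SkewPowerSeries D) • f : ContDual D N) : N →ₗ[R] R) = tAct D f :=
  LinearMap.ext fun n => op_t_smul_apply f n

theorem coe_op_t_pow_smul (k : ℕ) (f : ContDual D N) :
    ((op (t ^ k : SkewPowerSeries D) • f : ContDual D N) : N →ₗ[R] R) = (tAct D)^[k] f := by
  induction k with
  | zero => simp
  | succ k ih =>
    rw [pow_succ, op_mul, mul_smul, coe_op_t_smul, ih, Function.iterate_succ_apply']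

theorem coe_op_C_mul_t_pow_smul (a : R) (k : ℕ) (f : ContDual D N) :
    ((op (C a * t ^ k : SkewPowerSeries D) • f : ContDual D N) : N →ₗ[R] R) =
      (tAct D)^[k] (rAct D a f) := by
  rw [op_mul, mul_smul, coe_op_t_pow_smul, coe_op_C_smul]

end SkewPowerSeries

namespace FGResolution

open LinCompactFiltration MulOpposite

variable {R : Type u} [Ring R] [UniformSpace R] [PseudocompactRing R] [IsNoetherianRing R]
  {D : SkewDatum R} {M : Type u} [AddCommGroup M] [Module (SkewPowerSeries D) M]

theorem apply_d_of_mem_cocycles {P : FGResolution D M} {j : ℕ} {z : ContDual D (P.X j)}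
    (hz : z ∈ P.cocycles j) (x : P.X (j + 1)) : (z : P.X j →ₗ[R] R) (P.d j x) = 0 :=
  mem_cocycles.1 hz x

theorem coboundaries_le_cocycles (P : FGResolution D M) (j : ℕ) :
    P.coboundaries j ≤ P.cocycles j := by
  rcases j with _ | j
  · exact bot_le
  · rintro _ ⟨w, rfl⟩
    rw [mem_cocycles]
    intro x
    rw [dualMap_apply, (P.exact_succ j).apply_apply_eq_zero, map_zero]

variable [Module R M] [IsScalarTower R (SkewPowerSeries D) M]

namespace Comparison

variable {P : FGResolution D M} {Q : FreeResolution R M} (c : Comparison P Q)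

theorem mem_cocycles {j : ℕ} {z : ContDual D (P.X j)} (hz : z ∈ P.cocycles j) :
    (z : P.X j →ₗ[R] R) ∘ₗ c.φ j ∈ Q.cocycles j := by
  refine LinearMap.mem_ker.2 (LinearMap.ext fun x => ?_)
  show (z : P.X j →ₗ[R] R) (c.φ j (Q.d j x)) = 0
  rw [c.φ_comm, apply_d_of_mem_cocycles hz]

theorem mem_coboundaries {j : ℕ} {z : ContDual D (P.X j)} (hz : z ∈ P.coboundaries j) :
    (z : P.X j →ₗ[R] R) ∘ₗ c.φ j ∈ Q.coboundaries j := by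
  rcases j with _ | j
  · obtain rfl : z = 0 := hz
    exact Submodule.zero_mem _
  · obtain ⟨w, rfl⟩ := hz
    refine ⟨(w : P.X j →ₗ[R] R) ∘ₗ c.φ j, LinearMap.ext fun x => ?_⟩
    show (w : P.X j →ₗ[R] R) (c.φ j (Q.d j x)) = (w : P.X j →ₗ[R] R) (P.d j (c.φ (j + 1) x))
    rw [c.φ_comm]

/-- The comparison is injective on cohomology. -/
theorem mem_coboundaries_of_comp {j : ℕ} {z : ContDual D (P.X j)} (hz : z ∈ P.cocycles j)
    (h : (z : P.X j →ₗ[R] R) ∘ₗ c.φ j ∈ Q.coboundaries j) : z ∈ P.coboundaries j := by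
  rcases j with _ | j
  · have h0 : (z : P.X 0 →ₗ[R] R) ∘ₗ c.φ 0 = 0 := h
    refine (Submodule.mem_bot _).2 (contDual_ext fun x => ?_)
    have h1 := congrArg (z : P.X 0 →ₗ[R] R) (c.h_zero x)
    rw [apply_d_of_mem_cocycles hz, map_sub, sub_eq_zero] at h1
    rw [h1, contDual_zero_apply]
    exact LinearMap.congr_fun h0 _
  · obtain ⟨w, hw⟩ := h
    refine ⟨⟨w ∘ₗ c.ψ j, c.ψ_cont j w⟩ + ⟨(z : P.X (j + 1) →ₗ[R] R) ∘ₗ c.h j, c.h_cont j _ z.2⟩,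
      contDual_ext fun x => ?_⟩
    have h1 := congrArg (z : P.X (j + 1) →ₗ[R] R) (c.h_succ j x)
    rw [map_add, apply_d_of_mem_cocycles hz, map_sub, zero_add, sub_eq_iff_eq_add] at h1
    have h2 : w (Q.d j (c.ψ (j + 1) x)) =
        (z : P.X (j + 1) →ₗ[R] R) (c.φ (j + 1) (c.ψ (j + 1) x)) := LinearMap.congr_fun hw _
    rw [h1, ← h2, ← c.ψ_comm, dualMap_apply, add_comm]
    rfl

/-- The comparison is surjective on cohomology. -/
theorem exists_mem_cocycles {j : ℕ} {y : (Fin (Q.rank j) → R) →ₗ[R] R} (hy : y ∈ Q.cocycles j) :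
    ∃ z ∈ P.cocycles j, (z : P.X j →ₗ[R] R) ∘ₗ c.φ j - y ∈ Q.coboundaries j := by
  have hy' : ∀ x, y (Q.d j x) = 0 := fun x => LinearMap.congr_fun (LinearMap.mem_ker.1 hy) x
  refine ⟨⟨y ∘ₗ c.ψ j, c.ψ_cont j y⟩, ?_, ?_⟩
  · rw [FGResolution.mem_cocycles]
    intro x
    show y (c.ψ j (P.d j x)) = 0
    rw [c.ψ_comm, hy']
  · rcases j with _ | j
    · refine (Submodule.mem_bot _).2 (LinearMap.ext fun x => ?_)
      have h1 := congrArg y (c.k_zero x)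
      rw [hy', map_sub, sub_eq_zero] at h1
      exact sub_eq_zero.2 h1.symm
    · refine ⟨-(y ∘ₗ c.k j), LinearMap.ext fun x => ?_⟩
      have h1 := congrArg y (c.k_succ j x)
      rw [map_add, hy', map_sub, zero_add] at h1
      show -(y (c.k j (Q.d j x))) = y (c.ψ (j + 1) (c.φ (j + 1) x)) - y x
      rw [← h1, neg_sub]

end Comparison

variable [IsNoetherianRing Rᵐᵒᵖ] [IsNoetherianRing (SkewPowerSeries D)] [Module.Finite R M]

instance : Module.Finite (SkewPowerSeries D) M := .of_restrictScalars_finite R _ _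

/-- The cohomology of the complex of continuous functionals is finitely generated over `R`. -/
theorem exists_cocycles_span (P : FGResolution D M) (j : ℕ) :
    ∃ (m : ℕ) (g : Fin m → ContDual D (P.X j)), (∀ i, g i ∈ P.cocycles j) ∧
      ∀ z ∈ P.cocycles j, ∃ a : Fin m → R,
        z - ∑ i, op (C (a i) : SkewPowerSeries D) • g i ∈ P.coboundaries j := by
  obtain ⟨Q⟩ := FreeResolution.nonempty R M
  obtain ⟨c⟩ := nonempty_comparison P Q
  obtain ⟨m, y, hy⟩ := Module.Finite.exists_fin (R := Rᵐᵒᵖ) (M := Q.cocycles j)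
  choose g hg hgy using fun i => c.exists_mem_cocycles (y i).2
  refine ⟨m, g, hg, fun z hz => ?_⟩
  have h1 : (⟨_, c.mem_cocycles hz⟩ : Q.cocycles j) ∈ Submodule.span Rᵐᵒᵖ (Set.range y) :=
    hy ▸ Submodule.mem_top
  obtain ⟨b, hb⟩ := (Submodule.mem_span_range_iff_exists_fun _).1 h1
  refine ⟨fun i => D.σ (b i).unop, c.mem_coboundaries_of_comp (Submodule.sub_mem _ hz
    (Submodule.sum_mem _ fun i _ => Submodule.smul_mem _ _ (hg i))) ?_⟩
  have h2 : ((z - ∑ i, op (C (D.σ (b i).unop) : SkewPowerSeries D) • g i :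
      ContDual D (P.X j)) : P.X j →ₗ[R] R) ∘ₗ c.φ j =
        ∑ i, b i • ((y i : (Fin (Q.rank j) → R) →ₗ[R] R) - (g i : P.X j →ₗ[R] R) ∘ₗ c.φ j) := by
    have h3 : ∑ i, b i • (y i : (Fin (Q.rank j) → R) →ₗ[R] R) =
        (z : P.X j →ₗ[R] R) ∘ₗ c.φ j := by
      simpa using congrArg Subtype.val hb
    simp only [smul_sub, Finset.sum_sub_distrib, h3]
    refine LinearMap.ext fun x => ?_
    rw [LinearMap.comp_apply, AddSubgroup.coe_sub, LinearMap.sub_apply, LinearMap.sub_apply,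
      LinearMap.comp_apply, AddSubgroup.val_finsetSum, LinearMap.sum_apply, LinearMap.sum_apply]
    congr 1
    refine Finset.sum_congr rfl fun i _ => ?_
    rw [op_C_smul_apply, RingEquiv.symm_apply_apply]
    rfl
  rw [h2]
  refine Submodule.sum_mem _ fun i _ => Submodule.smul_mem _ _ ?_
  rw [← neg_sub]
  exact Submodule.neg_mem _ (hgy i)

/-- The action of `t` is topologically nilpotent on the cohomology: a sequence of cocycles such
that each is the image of the next under `t`, up to coboundaries, consists of coboundaries. -/
theorem mem_coboundaries_of_forall_t (P : FGResolution D M) (j : ℕ) (z : ℕ → ContDual D (P.X j))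
    (hz : ∀ i, z i ∈ P.cocycles j)
    (h : ∀ i, op (t : SkewPowerSeries D) • z (i + 1) - z i ∈ P.coboundaries j) (i : ℕ) :
    z i ∈ P.coboundaries j := by
  obtain ⟨Q⟩ := FreeResolution.nonempty R M
  obtain ⟨c⟩ := nonempty_comparison P Q
  obtain ⟨m, g, hg, hspan⟩ := exists_cocycles_span P j
  have h1 : ∀ k, op (t ^ k : SkewPowerSeries D) • z (i + k) - z i ∈ P.coboundaries j := by
    intro k
    induction k with
    | zero => simp
    | succ k ih =>
      have h2 := Submodule.add_mem _ (Submodule.smul_mem _ (op (t ^ k : SkewPowerSeries D))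
        (h (i + k))) ih
      rw [smul_sub, smul_smul, ← op_mul, ← pow_succ', sub_add_sub_cancel] at h2
      exact h2
  refine c.mem_coboundaries_of_comp (hz i) (Q.mem_coboundaries_of_forall j fun n => ?_)
  -- for large `k`, right multiplication by `t ^ k` makes the generators uniformly small
  choose K hK using fun l => exists_iterate_tAct_rAct_mem (g l).2 n
  let k := Finset.univ.sup K
  obtain ⟨a, ha⟩ := hspan (z (i + k)) (hz _)
  let s : ContDual D (P.X j) := ∑ l, op (C (a l) * t ^ k : SkewPowerSeries D) • g l
  have h3 : s - z i ∈ P.coboundaries j := by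
    have h4 := Submodule.sub_mem _ (h1 k)
      (Submodule.smul_mem _ (op (t ^ k : SkewPowerSeries D)) ha)
    rw [smul_sub, Finset.smul_sum] at h4
    simp only [smul_smul, ← op_mul] at h4
    convert h4 using 1
    simp only [s]
    abel
  have h5 : ∀ x, (s : P.X j →ₗ[R] R) x ∈ Ring.jacobson R ^ n := by
    intro x
    simp only [s, AddSubgroup.val_finsetSum, LinearMap.sum_apply]
    refine Ideal.sum_mem _ fun l _ => ?_
    rw [coe_op_C_mul_t_pow_smul]
    exact hK l k (Finset.le_sup (Finset.mem_univ l)) _ _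
  refine ⟨-((s - z i : ContDual D (P.X j)) : P.X j →ₗ[R] R) ∘ₗ c.φ j,
    Submodule.neg_mem _ (c.mem_coboundaries h3), fun x => ?_⟩
  show -((s : P.X j →ₗ[R] R) (c.φ j x) - (z i : P.X j →ₗ[R] R) (c.φ j x)) -
    (z i : P.X j →ₗ[R] R) (c.φ j x) ∈ _
  rw [neg_sub, sub_sub_cancel_left]
  exact Submodule.neg_mem _ (h5 _)

end FGResolution

/-! ### Functionals on the power series -/

namespace SkewPowerSeries

open LinCompactFiltration MulOpposite

variable {R : Type u} [Ring R] [UniformSpace R] [PseudocompactRing R] [IsNoetherianRing R]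
  {D : SkewDatum R}

theorem t_mul (x : SkewPowerSeries D) : t * x = tMul x := by
  simpa using t_pow_mul 1 x

theorem t_pow_eq (i : ℕ) : (t : SkewPowerSeries D) ^ i = monomial i 1 := by
  rw [← mul_one (t ^ i), t_pow_mul, ← iterate_tMul_one]
  rfl

theorem t_smul_monomial (i : ℕ) :
    (t : SkewPowerSeries D) • (monomial i 1 : SkewPowerSeries D) = monomial (i + 1) 1 := by
  rw [← t_pow_eq, ← t_pow_eq, smul_eq_mul, pow_succ']

section PowerSeriesDual

variable [IsNoetherianRing (SkewPowerSeries D)]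

/-- The filtration chosen on `S` as a finitely generated module is equivalent to the
standard one. -/
theorem cont_ofFinite_iff {A : Type u} [AddCommGroup A] [Module R A]
    {Φ : LinCompactFiltration R A} {f : SkewPowerSeries D →ₗ[R] A} :
    Cont (ofFinite D (SkewPowerSeries D)) Φ f ↔ Cont (powerSeries R D) Φ f := by
  let e : (Fin 1 → SkewPowerSeries D) ≃ₗ[SkewPowerSeries D] SkewPowerSeries D :=
    LinearEquiv.funUnique (Fin 1) (SkewPowerSeries D) (SkewPowerSeries D)
  constructor
  · intro h n
    obtain ⟨m, hm⟩ := h.comp (cont_of_linear e.toLinearMap) n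
    exact ⟨m, fun x hx => hm (fun _ => x) (mem_pi.2 fun _ => hx)⟩
  · intro h
    refine cont_of_comp_cover fun n => ?_
    obtain ⟨m, hm⟩ := h n
    obtain ⟨l, hl⟩ := cont_restrictScalars (e.symm.toLinearMap ∘ₗ cover D (SkewPowerSeries D)) m
    exact ⟨l, fun x hx => hm _ (mem_pi.1 (hl x hx) 0)⟩

theorem mem_contDual_powerSeries_iff {f : SkewPowerSeries D →ₗ[R] R} :
    f ∈ ContDual D (SkewPowerSeries D) ↔ Cont (powerSeries R D) (jacobson R) f :=
  mem_contDual_iff_cont.trans cont_ofFinite_iff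

theorem contDual_powerSeries_ext {f g : ContDual D (SkewPowerSeries D)}
    (h : ∀ i, (f : SkewPowerSeries D →ₗ[R] R) (monomial i 1) =
      (g : SkewPowerSeries D →ₗ[R] R) (monomial i 1)) : f = g :=
  Subtype.ext ((mem_contDual_powerSeries_iff.1 f.2).ext_monomial
    (mem_contDual_powerSeries_iff.1 g.2) h)

/-- The action of `t` on the continuous dual of `S` is surjective. In the solution `g` with
`g 1 = 0`, the value at `t ^ (k + 1)` is a sum of compositions of `σ` and `δ` applied to values
`f (t ^ j)`, with `j` large or
with many factors `δ`, so that it tends to zero by `σ`-nilpotence. -/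
theorem exists_op_t_smul_eq_powerSeries (f : ContDual D (SkewPowerSeries D)) :
    ∃ g : ContDual D (SkewPowerSeries D), op (t : SkewPowerSeries D) • g = f := by
  -- the values of `g` at the powers of `t` are determined recursively by the choice `g 1 = 0`
  let b : ℕ → R := fun k => (f : SkewPowerSeries D →ₗ[R] R) (monomial k 1)
  let c : ℕ → R := fun k => Nat.rec 0 (fun k x => D.δ x + D.σ (b k)) k
  have hc : ∀ k, c k ∈ AddSubgroup.closure {a | ∃ i j, i + j + 1 = k ∧ ∃ w,
      IsMonomial D.σ D.δ i w ∧ a = w (b j)} := by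
    intro k
    induction k with
    | zero => exact AddSubgroup.zero_mem _
    | succ k ih =>
      refine AddSubgroup.add_mem _ ?_ ?_
      · refine AddSubgroup.mem_comap.1 ((AddSubgroup.closure_le
          (AddSubgroup.comap D.δ _)).2 ?_ ih)
        rintro _ ⟨i, j, hij, w, hw, rfl⟩
        exact AddSubgroup.subset_closure ⟨i + 1, j, by omega, _, hw.delta, rfl⟩
      · exact AddSubgroup.subset_closure ⟨0, k, by omega, _, IsMonomial.one.sigma, rfl⟩
  obtain ⟨v, hv, hvc⟩ := exists_cont_monomial_eq (D := D) (jacobson R) c fun n => by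
    obtain ⟨l, hl⟩ := D.exists_isMonomial_mem n
    obtain ⟨r, -, hr⟩ := D.nilpotent (n + 1) (by omega)
    obtain ⟨K, hK⟩ := exists_apply_t_pow_mem f.2 l
    refine ⟨r + K + 1, fun k hk => ?_⟩
    refine (AddSubgroup.closure_le (K := (Ring.jacobson R ^ n).toAddSubgroup)).2 ?_ (hc k)
    rintro _ ⟨i, j, hij, w, hw, rfl⟩
    rcases le_or_gt r i with h | h
    · exact Ideal.pow_le_pow_right (Nat.le_succ n) (hr i h w hw _)
    · refine hl i w hw _ ?_
      have := hK j (by omega) 1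
      rwa [smul_eq_mul, mul_one, t_pow_eq] at this
  refine ⟨⟨v, mem_contDual_powerSeries_iff.2 hv⟩, contDual_powerSeries_ext fun i => ?_⟩
  rw [op_t_smul_apply, t_smul_monomial, hvc, hvc, RingEquiv.symm_apply_eq, sub_eq_iff_eq_add']

/-- The action of `t` on the continuous dual of a finitely generated projective module is
surjective. -/
theorem exists_op_t_smul_eq {N : Type u} [AddCommGroup N] [Module R N]
    [Module (SkewPowerSeries D) N] [IsScalarTower R (SkewPowerSeries D) N]
    [Module.Finite (SkewPowerSeries D) N] [Module.Projective (SkewPowerSeries D) N]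
    (f : ContDual D N) : ∃ g : ContDual D N, op (t : SkewPowerSeries D) • g = f := by
  obtain ⟨s, hs⟩ := Module.projective_lifting_property (cover D N) LinearMap.id
    (cover_surjective D N)
  choose g hg using fun i => exists_op_t_smul_eq_powerSeries (D := D) (dualMap
    (cover D N ∘ₗ LinearMap.single (SkewPowerSeries D) (fun _ => SkewPowerSeries D) i) f)
  refine ⟨∑ i, dualMap (LinearMap.proj i ∘ₗ s) (g i), contDual_ext fun n => ?_⟩
  simp only [Finset.smul_sum, ← map_smul, hg, AddSubgroup.val_finsetSum, LinearMap.sum_apply,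
    dualMap_apply]
  rw [← map_sum]
  congr 1
  simp only [LinearMap.comp_apply]
  rw [← map_sum]
  conv_rhs => rw [← LinearMap.id_apply (R := SkewPowerSeries D) n, ← hs, LinearMap.comp_apply]
  congr 1
  exact LinearMap.sum_single_apply _ _

/-- The coefficients of power series, as continuous functionals. -/
noncomputable def coeffDual (m : ℕ) : ContDual D (SkewPowerSeries D) :=
  ⟨{ toFun := coeff m, map_add' := fun _ _ => rfl, map_smul' := fun _ _ => rfl },
    mem_contDual_powerSeries_iff.2 fun n => ⟨max n (m + 1), fun _ hx =>
      Ideal.pow_le_pow_right (le_max_left _ _) (hx m (by simp))⟩⟩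

theorem coeffDual_apply (m : ℕ) (x : SkewPowerSeries D) :
    (coeffDual (D := D) m : SkewPowerSeries D →ₗ[R] R) x = coeff m x := rfl

theorem op_t_smul_coeffDual_zero :
    op (t : SkewPowerSeries D) • (coeffDual 0 : ContDual D (SkewPowerSeries D)) = 0 := by
  refine contDual_ext fun x => ?_
  rw [op_t_smul_apply, smul_eq_mul, t_mul, coeffDual_apply, coeffDual_apply, coeff_tMul_zero,
    sub_self, map_zero]
  rfl

theorem op_t_smul_coeffDual_succ (m : ℕ) :
    op (t : SkewPowerSeries D) • (coeffDual (m + 1) : ContDual D (SkewPowerSeries D)) =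
      coeffDual m := by
  refine contDual_ext fun x => ?_
  rw [op_t_smul_apply, smul_eq_mul, t_mul, coeffDual_apply, coeffDual_apply, coeff_tMul_succ,
    add_sub_cancel_right, RingEquiv.symm_apply_apply, coeffDual_apply]

end PowerSeriesDual

/-! ### Sequences of functionals and linear maps to the power series ring -/

section Sequences

variable {N : Type u} [AddCommGroup N] [Module R N] [Module (SkewPowerSeries D) N]
  [IsScalarTower R (SkewPowerSeries D) N] [Module.Finite (SkewPowerSeries D) N]

/-- The map `n ↦ ∑ m, G m n * t ^ m` given by a sequence of functionals. -/
def seqApply (G : ℕ → ContDual D N) (n : N) : SkewPowerSeries D :=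
  fun m => (G m : N →ₗ[R] R) n

theorem coeff_seqApply (G : ℕ → ContDual D N) (n : N) (m : ℕ) :
    coeff m (seqApply G n) = (G m : N →ₗ[R] R) n := rfl

/-- The defining formula for `f^t`, solved for `f (t n)`. -/
theorem apply_t_smul (f : ContDual D N) (n : N) : (f : N →ₗ[R] R) ((t : SkewPowerSeries D) • n) =
    D.σ (((op (t : SkewPowerSeries D) • f : ContDual D N) : N →ₗ[R] R) n) +
      D.δ ((f : N →ₗ[R] R) n) := by
  rw [op_t_smul_apply, RingEquiv.apply_symm_apply, sub_add_cancel]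

/-- A sequence of functionals with `G m = (G (m + 1))^t` intertwines the actions of `t` up to a
constant. -/
theorem seqApply_t_smul {G : ℕ → ContDual D N} {z : ContDual D N}
    (h0 : op (t : SkewPowerSeries D) • G 0 = z)
    (h : ∀ m, op (t : SkewPowerSeries D) • G (m + 1) = G m) (n : N) :
    seqApply G ((t : SkewPowerSeries D) • n) =
      t * seqApply G n + C (D.σ ((z : N →ₗ[R] R) n)) := by
  rw [t_mul]
  ext (_ | m)
  · rw [coeff_add, coeff_seqApply, coeff_tMul_zero, apply_t_smul, h0, coeff_seqApply, add_comm]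
    congr 1
    show _ = D.σ ((z : N →ₗ[R] R) n) * coeff 0 (monomial 0 1 : SkewPowerSeries D)
    simp [coeff_monomial]
  · rw [coeff_add, coeff_seqApply, coeff_tMul_succ, apply_t_smul, h, coeff_seqApply,
      coeff_seqApply, left_eq_add]
    show D.σ ((z : N →ₗ[R] R) n) * coeff (m + 1) (monomial 0 1 : SkewPowerSeries D) = 0
    simp [coeff_monomial]

theorem seqApply_add (G : ℕ → ContDual D N) (n n' : N) :
    seqApply G (n + n') = seqApply G n + seqApply G n' :=
  ext fun m => map_add (G m : N →ₗ[R] R) n n'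

theorem seqApply_smul (G : ℕ → ContDual D N) (a : R) (n : N) :
    seqApply G (a • n) = a • seqApply G n :=
  ext fun m => map_smul (G m : N →ₗ[R] R) a n

/-- The sequence of coefficients of `n ↦ (∑ m, G m n * t ^ m) * s`. -/
noncomputable def mulRight (G : ℕ → ContDual D N) (s : SkewPowerSeries D) (m : ℕ) :
    ContDual D N where
  val :=
    { toFun := fun n => coeff m (seqApply G n * s)
      map_add' := fun n n' => by rw [seqApply_add, add_mul, coeff_add]
      map_smul' := fun a n => by rw [seqApply_smul, smul_mul_assoc, coeff_smul]; rfl }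
  property := by
    let := moduleTopology (SkewPowerSeries D) N
    have h : Continuous (seqApply G) := continuous_pi fun m => (G m).2
    exact (continuous_coeff m).comp (h.mul_const s)

theorem mulRight_apply (G : ℕ → ContDual D N) (s : SkewPowerSeries D) (m : ℕ) (n : N) :
    (mulRight G s m : N →ₗ[R] R) n = coeff m (seqApply G n * s) := rfl

theorem coeff_C_mul (m : ℕ) (a : R) (x : SkewPowerSeries D) :
    coeff m (C a * x) = a * coeff m x := by
  show coeff m (a • (1 : SkewPowerSeries D) * x) = _
  rw [smul_mul_assoc, one_mul, coeff_smul]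

theorem op_t_smul_mulRight_zero {G : ℕ → ContDual D N} {z : ContDual D N}
    (h0 : op (t : SkewPowerSeries D) • G 0 = z)
    (h : ∀ m, op (t : SkewPowerSeries D) • G (m + 1) = G m) (s : SkewPowerSeries D) :
    op (t : SkewPowerSeries D) • mulRight G s 0 = op (C (coeff 0 s) : SkewPowerSeries D) • z := by
  refine contDual_ext fun n => ?_
  rw [op_t_smul_apply, mulRight_apply, mulRight_apply, seqApply_t_smul h0 h, add_mul, mul_assoc,
    t_mul, coeff_add, coeff_tMul_zero, add_sub_cancel_left, coeff_C_mul, op_C_smul_apply, map_mul,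
    RingEquiv.symm_apply_apply]

/-- Right multiplication by `s` preserves the relation between the terms of `G` up to the
coefficients of `s` acting on `z`; these are compensated by `tailSeq z s`. -/
theorem op_t_smul_mulRight_succ {G : ℕ → ContDual D N} {z : ContDual D N}
    (h0 : op (t : SkewPowerSeries D) • G 0 = z)
    (h : ∀ m, op (t : SkewPowerSeries D) • G (m + 1) = G m) (s : SkewPowerSeries D) (m : ℕ) :
    op (t : SkewPowerSeries D) • mulRight G s (m + 1) =
      mulRight G s m + op (C (coeff (m + 1) s) : SkewPowerSeries D) • z := by
  refine contDual_ext fun n => ?_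
  rw [AddSubgroup.coe_add, LinearMap.add_apply]
  rw [op_t_smul_apply, mulRight_apply, mulRight_apply, mulRight_apply, seqApply_t_smul h0 h,
    add_mul, mul_assoc, t_mul, coeff_add, coeff_tMul_succ, coeff_C_mul, op_C_smul_apply,
    add_right_comm, add_sub_cancel_right, map_add, map_mul,
    RingEquiv.symm_apply_apply, RingEquiv.symm_apply_apply]

/-- The power series `∑ i, s (i + 1) * t ^ i`. -/
def tail (s : SkewPowerSeries D) : SkewPowerSeries D := fun i => s (i + 1)

theorem coeff_tail (m : ℕ) (s : SkewPowerSeries D) : coeff m (tail s) = coeff (m + 1) s := rfl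

theorem coeff_iterate_tail (k m : ℕ) (s : SkewPowerSeries D) :
    coeff m (tail^[k] s) = coeff (m + k) s := by
  induction k generalizing m with
  | zero => rfl
  | succ k ih => rw [Function.iterate_succ_apply', coeff_tail, ih, add_right_comm, add_assoc]

theorem tail_mul_t (s : SkewPowerSeries D) : tail s * t = s - C (coeff 0 s) := by
  have h1 := hasSum_coeff s
  rw [← hasSum_nat_add_iff' 1, Finset.sum_range_one, pow_zero, mul_one] at h1
  refine HasSum.unique ?_ h1
  have h2 := (hasSum_coeff (tail s)).mul_right t
  have h3 : ∀ i, C (coeff i (tail s)) * t ^ i * t =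
      (C (coeff (i + 1) s) * t ^ (i + 1) : SkewPowerSeries D) := fun i => by
    rw [pow_succ, mul_assoc]
    rfl
  simpa only [h3] using h2

/-- The sequence of the functionals `f^x`, for `x` the iterated tails of `s`. -/
noncomputable def tailSeq (f : ContDual D N) (s : SkewPowerSeries D) (m : ℕ) : ContDual D N :=
  op (tail^[m + 1] s) • f

theorem op_t_smul_tailSeq_zero (f : ContDual D N) (s : SkewPowerSeries D) :
    op (t : SkewPowerSeries D) • tailSeq f s 0 =
      op s • f - op (C (coeff 0 s) : SkewPowerSeries D) • f := by
  rw [tailSeq, smul_smul, ← op_mul, Function.iterate_one, tail_mul_t, op_sub, sub_smul]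

theorem op_t_smul_tailSeq_succ (f : ContDual D N) (s : SkewPowerSeries D) (m : ℕ) :
    op (t : SkewPowerSeries D) • tailSeq f s (m + 1) =
      tailSeq f s m - op (C (coeff (m + 1) s) : SkewPowerSeries D) • f := by
  rw [tailSeq, smul_smul, ← op_mul, Function.iterate_succ_apply', tail_mul_t, op_sub, sub_smul,
    coeff_iterate_tail, zero_add, tailSeq]

variable [IsNoetherianRing (SkewPowerSeries D)]

/-- Sequences of functionals with `(G 0)^t = 0` and `(G (m + 1))^t = G m` are the sequences of
coefficients of `S`-linear maps to `S`. -/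
theorem exists_dualMap_coeffDual_eq {G : ℕ → ContDual D N}
    (h0 : op (t : SkewPowerSeries D) • G 0 = 0)
    (h : ∀ m, op (t : SkewPowerSeries D) • G (m + 1) = G m) :
    ∃ F : N →ₗ[SkewPowerSeries D] SkewPowerSeries D, ∀ m, dualMap F (coeffDual m) = G m := by
  have ht : ∀ n, seqApply G ((t : SkewPowerSeries D) • n) = tMul (seqApply G n) := by
    intro n
    rw [seqApply_t_smul h0 h, t_mul, contDual_zero_apply, map_zero, map_zero, add_zero]
  have hti : ∀ i n, seqApply G ((t : SkewPowerSeries D) ^ i • n) = tMul^[i] (seqApply G n) := by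
    intro i n
    induction i with
    | zero => simp
    | succ i ih => rw [pow_succ', mul_smul, ht, ih, Function.iterate_succ_apply']
  refine ⟨{ toFun := seqApply G, map_add' := seqApply_add G, map_smul' := fun x n => ?_ },
    fun m => rfl⟩
  ext m
  -- both sides are continuous `R`-linear functions of `x`
  have h1 : dualMap (LinearMap.toSpanSingleton (SkewPowerSeries D) N n) (G m) =
      dualMap (LinearMap.toSpanSingleton (SkewPowerSeries D) (SkewPowerSeries D) (seqApply G n))
        (coeffDual m) := contDual_powerSeries_ext fun i => by
    rw [dualMap_apply, dualMap_apply, coeffDual_apply, LinearMap.toSpanSingleton_apply,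
      LinearMap.toSpanSingleton_apply, ← t_pow_eq, smul_eq_mul, t_pow_mul, ← hti]
    rfl
  exact LinearMap.congr_fun (congrArg Subtype.val h1) x

end Sequences

end SkewPowerSeries

/-! ### The connecting homomorphism -/

namespace FGResolution

open MulOpposite

variable {R : Type u} [Ring R] [UniformSpace R] [PseudocompactRing R] [IsNoetherianRing R]
  {D : SkewDatum R} [IsNoetherianRing (SkewPowerSeries D)]
  {M : Type u} [AddCommGroup M] [Module (SkewPowerSeries D) M]
  {P : FGResolution D M} {j : ℕ}

/-- The relation defining the connecting homomorphism: the cocycle `z` is `(G 0)^t` for a sequence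
`G` with `G m = (G (m + 1))^t`, and the coboundary of `G` is the sequence of coefficients of the
`S`-linear map `F`. -/
def IsConnecting (z : ContDual D (P.X j))
    (F : P.X (j + 1) →ₗ[SkewPowerSeries D] SkewPowerSeries D) : Prop :=
  ∃ G : ℕ → ContDual D (P.X j), op (t : SkewPowerSeries D) • G 0 = z ∧
    (∀ m, op (t : SkewPowerSeries D) • G (m + 1) = G m) ∧
    ∀ m, dualMap (P.d j) (G m) = dualMap F (coeffDual m)

/-- Surjectivity of the map sending a sequence `G` of functionals to the sequence
`m ↦ (G m)^t - G (m - 1)`. -/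
theorem exists_seq_eq (z : ℕ → ContDual D (P.X j)) : ∃ G : ℕ → ContDual D (P.X j),
    op (t : SkewPowerSeries D) • G 0 = z 0 ∧
    ∀ m, op (t : SkewPowerSeries D) • G (m + 1) = G m + z (m + 1) := by
  choose s hs using fun f : ContDual D (P.X j) => exists_op_t_smul_eq f
  exact ⟨fun m => Nat.rec (s (z 0)) (fun m g => s (g + z (m + 1))) m, hs _, fun m => hs _⟩

/-- A sequence of coboundaries is the image, under the map sending `G` to the sequence
`m ↦ (G m)^t - G (m - 1)`, of a sequence of coboundaries. -/
theorem exists_seq_eq_of_mem_coboundaries {E : ℕ → ContDual D (P.X j)}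
    (hE : ∀ m, E m ∈ P.coboundaries j) : ∃ G : ℕ → ContDual D (P.X j),
    (∀ m, G m ∈ P.coboundaries j) ∧ op (t : SkewPowerSeries D) • G 0 = E 0 ∧
    ∀ m, op (t : SkewPowerSeries D) • G (m + 1) = G m + E (m + 1) := by
  rcases j with _ | j
  · have h : ∀ m, E m = 0 := fun m => hE m
    exact ⟨fun _ => 0, fun _ => Submodule.zero_mem _, by rw [h, smul_zero],
      fun m => by rw [h, smul_zero, add_zero]⟩
  · choose e he using hE
    obtain ⟨g, hg0, hg⟩ := exists_seq_eq e
    refine ⟨fun m => dualMap (P.d j) (g m), fun m => ⟨_, rfl⟩, ?_, fun m => ?_⟩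
    · rw [← map_smul, hg0, he]
    · rw [← map_smul, hg, map_add, he]

theorem IsConnecting.exists {z : ContDual D (P.X j)} (hz : z ∈ P.cocycles j) :
    ∃ F, IsConnecting z F := by
  obtain ⟨G, hG0, hG⟩ := exists_seq_eq (P := P) (j := j) fun m => if m = 0 then z else 0
  simp only [if_true, Nat.add_eq_zero_iff, one_ne_zero, and_false, if_false, add_zero] at hG0 hG
  obtain ⟨F, hF⟩ := exists_dualMap_coeffDual_eq (G := fun m => dualMap (P.d j) (G m))
    (by rw [← map_smul, hG0]; exact hz) fun m => by rw [← map_smul, hG]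
  exact ⟨F, G, hG0, hG, fun m => (hF m).symm⟩

theorem IsConnecting.comp_d_eq_zero {z : ContDual D (P.X j)}
    {F : P.X (j + 1) →ₗ[SkewPowerSeries D] SkewPowerSeries D} (h : IsConnecting z F) :
    F ∘ₗ P.d (j + 1) = 0 := by
  obtain ⟨G, -, -, hG⟩ := h
  refine LinearMap.ext fun x => SkewPowerSeries.ext fun m => ?_
  have := LinearMap.congr_fun (congrArg Subtype.val (hG m)) (P.d (j + 1) x)
  rw [dualMap_apply, dualMap_apply, (P.exact_succ j).apply_apply_eq_zero, map_zero] at this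
  exact this.symm

theorem IsConnecting.add {z z' : ContDual D (P.X j)}
    {F F' : P.X (j + 1) →ₗ[SkewPowerSeries D] SkewPowerSeries D} (h : IsConnecting z F)
    (h' : IsConnecting z' F') : IsConnecting (z + z') (F + F') := by
  obtain ⟨G, hG0, hG, hGF⟩ := h
  obtain ⟨G', hG0', hG', hGF'⟩ := h'
  refine ⟨fun m => G m + G' m, ?_, fun m => ?_, fun m => ?_⟩
  · rw [smul_add, hG0, hG0']
  · rw [smul_add, hG, hG']
  · rw [map_add, hGF, hGF']
    rfl

theorem IsConnecting.sub {z z' : ContDual D (P.X j)}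
    {F F' : P.X (j + 1) →ₗ[SkewPowerSeries D] SkewPowerSeries D} (h : IsConnecting z F)
    (h' : IsConnecting z' F') : IsConnecting (z - z') (F - F') := by
  obtain ⟨G, hG0, hG, hGF⟩ := h
  obtain ⟨G', hG0', hG', hGF'⟩ := h'
  refine ⟨fun m => G m - G' m, ?_, fun m => ?_, fun m => ?_⟩
  · rw [smul_sub, hG0, hG0']
  · rw [smul_sub, hG, hG']
  · rw [map_sub, hGF, hGF']
    rfl

/-- The connecting homomorphism is linear over `S`: if `G` is a sequence for `z`, then the sequence
obtained by right multiplication by `s`, corrected by the tails of `s` acting on `z`, is one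
for `z^s`. -/
theorem IsConnecting.op_smul {z : ContDual D (P.X j)}
    {F : P.X (j + 1) →ₗ[SkewPowerSeries D] SkewPowerSeries D} (hz : z ∈ P.cocycles j)
    (h : IsConnecting z F) (s : SkewPowerSeries D) : IsConnecting (op s • z)
      (LinearMap.toSpanSingleton (SkewPowerSeries D) (SkewPowerSeries D) s ∘ₗ F) := by
  obtain ⟨G, hG0, hG, hGF⟩ := h
  refine ⟨fun m => mulRight G s m + tailSeq z s m, ?_, fun m => ?_, fun m => ?_⟩
  · rw [smul_add, op_t_smul_mulRight_zero hG0 hG, op_t_smul_tailSeq_zero, add_sub_cancel]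
  · rw [smul_add, op_t_smul_mulRight_succ hG0 hG, op_t_smul_tailSeq_succ,
      add_add_sub_cancel]
  · have hz' : dualMap (P.d j) z = 0 := hz
    rw [map_add, tailSeq, map_smul, hz', smul_zero, add_zero]
    refine contDual_ext fun x => ?_
    rw [dualMap_apply, dualMap_apply, mulRight_apply, coeffDual_apply]
    have : seqApply G (P.d j x) = F x := SkewPowerSeries.ext fun m =>
      LinearMap.congr_fun (congrArg Subtype.val (hGF m)) x
    rw [this]
    rfl

theorem dualMap_comp_coeffDual {N N' : Type u} [AddCommGroup N] [Module R N]
    [Module (SkewPowerSeries D) N] [IsScalarTower R (SkewPowerSeries D) N]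
    [Module.Finite (SkewPowerSeries D) N] [AddCommGroup N'] [Module R N']
    [Module (SkewPowerSeries D) N'] [IsScalarTower R (SkewPowerSeries D) N']
    [Module.Finite (SkewPowerSeries D) N'] (g : N →ₗ[SkewPowerSeries D] N')
    (F : N' →ₗ[SkewPowerSeries D] SkewPowerSeries D) (m : ℕ) :
    dualMap (F ∘ₗ g) (coeffDual m) = dualMap g (dualMap F (coeffDual m)) := rfl

/-- The connecting homomorphism is well defined on cohomology classes. -/
theorem IsConnecting.exists_of_mem_coboundaries {z : ContDual D (P.X j)}
    {F : P.X (j + 1) →ₗ[SkewPowerSeries D] SkewPowerSeries D} (h : IsConnecting z F)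
    (hz : z ∈ P.coboundaries j) : ∃ F₀, F = F₀ ∘ₗ P.d j := by
  obtain ⟨G, hG0, hG, hGF⟩ := h
  obtain ⟨G', hG', hG0', hG1'⟩ := exists_seq_eq_of_mem_coboundaries (P := P) (j := j)
    (E := fun m => if m = 0 then z else 0) fun m => by
      split_ifs
      · exact hz
      · exact Submodule.zero_mem _
  simp only [if_true, Nat.add_eq_zero_iff, one_ne_zero, and_false, if_false, add_zero]
    at hG0' hG1'
  obtain ⟨F₀, hF₀⟩ := exists_dualMap_coeffDual_eq (G := fun m => G m - G' m)
    (by rw [smul_sub, hG0, hG0', sub_self]) fun m => by rw [smul_sub, hG, hG1']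
  refine ⟨F₀, LinearMap.ext fun x => SkewPowerSeries.ext fun m => ?_⟩
  have h1 : dualMap F (coeffDual m) = dualMap (F₀ ∘ₗ P.d j) (coeffDual m) := by
    have h2 : dualMap (P.d j) (G' m) = 0 := P.coboundaries_le_cocycles j (hG' m)
    rw [dualMap_comp_coeffDual, hF₀, map_sub, h2, sub_zero, hGF]
  exact LinearMap.congr_fun (congrArg Subtype.val h1) x

variable [IsNoetherianRing Rᵐᵒᵖ] [Module R M] [IsScalarTower R (SkewPowerSeries D) M]
  [Module.Finite R M]

/-- The connecting homomorphism is injective. -/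
theorem IsConnecting.mem_coboundaries {z : ContDual D (P.X j)}
    {F : P.X (j + 1) →ₗ[SkewPowerSeries D] SkewPowerSeries D} (h : IsConnecting z F)
    (hz : z ∈ P.cocycles j) {F₀ : P.X j →ₗ[SkewPowerSeries D] SkewPowerSeries D}
    (hF : F = F₀ ∘ₗ P.d j) : z ∈ P.coboundaries j := by
  obtain ⟨G, hG0, hG, hGF⟩ := h
  have hd : ∀ m, G m - dualMap F₀ (coeffDual m) ∈ P.cocycles j := fun m =>
    LinearMap.mem_ker.2 (by rw [map_sub, hGF, hF, dualMap_comp_coeffDual, sub_self])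
  refine mem_coboundaries_of_forall_t P j
    (fun m => Nat.casesOn m z fun m => G m - dualMap F₀ (coeffDual m)) ?_ ?_ 0
  · rintro (_ | m)
    · exact hz
    · exact hd m
  · rintro (_ | m)
    · show op (t : SkewPowerSeries D) • (G 0 - dualMap F₀ (coeffDual 0)) - z ∈ _
      rw [smul_sub, hG0, ← map_smul, op_t_smul_coeffDual_zero, map_zero, sub_zero, sub_self]
      exact Submodule.zero_mem _
    · show op (t : SkewPowerSeries D) • (G (m + 1) - dualMap F₀ (coeffDual (m + 1))) -
        (G m - dualMap F₀ (coeffDual m)) ∈ _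
      rw [smul_sub, hG, ← map_smul, op_t_smul_coeffDual_succ, sub_self]
      exact Submodule.zero_mem _

/-- The coefficients of an `S`-linear cocycle are coboundaries. -/
theorem dualMap_coeffDual_mem_coboundaries {F : P.X j →ₗ[SkewPowerSeries D] SkewPowerSeries D}
    (hF : F ∘ₗ P.d j = 0) (m : ℕ) : dualMap F (coeffDual m) ∈ P.coboundaries j := by
  have hd : ∀ m, dualMap F (coeffDual m) ∈ P.cocycles j := fun m => by
    rw [mem_cocycles]
    intro x
    have : F (P.d j x) = 0 := LinearMap.congr_fun hF x
    rw [dualMap_apply, this, map_zero]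
  refine mem_coboundaries_of_forall_t P j (fun m => dualMap F (coeffDual m)) hd (fun i => ?_) m
  rw [← map_smul, op_t_smul_coeffDual_succ, sub_self]
  exact Submodule.zero_mem _

/-- The connecting homomorphism is surjective. -/
theorem IsConnecting.exists_of_comp_d_eq_zero
    {F : P.X (j + 1) →ₗ[SkewPowerSeries D] SkewPowerSeries D} (hF : F ∘ₗ P.d (j + 1) = 0) :
    ∃ z ∈ P.cocycles j, IsConnecting z F := by
  choose A hA using fun m => dualMap_coeffDual_mem_coboundaries hF m
  -- the image of `A` under the map sending `G` to the sequence `m ↦ (G m)^t - G (m - 1)`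
  let B : ℕ → ContDual D (P.X j) := fun m =>
    Nat.casesOn m (op (t : SkewPowerSeries D) • A 0)
      fun m => op (t : SkewPowerSeries D) • A (m + 1) - A m
  have hB : ∀ m, B m ∈ P.cocycles j := by
    rintro (_ | m)
    · refine LinearMap.mem_ker.2 ?_
      show dualMap (P.d j) (op (t : SkewPowerSeries D) • A 0) = 0
      rw [map_smul, hA, ← map_smul, op_t_smul_coeffDual_zero, map_zero]
    · refine LinearMap.mem_ker.2 ?_
      show dualMap (P.d j) (op (t : SkewPowerSeries D) • A (m + 1) - A m) = 0
      rw [map_sub, map_smul, hA, hA, ← map_smul, op_t_smul_coeffDual_succ, sub_self]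
  obtain ⟨k, g, hg, hspan⟩ := exists_cocycles_span P j
  choose b hb using fun m => hspan (B m) (hB m)
  -- on cohomology, `A` is corrected to a sequence with image `(z, 0, 0, …)`, where `z` is the sum
  -- of the products of the generators with the power series having the coefficients of `B`
  let s : Fin k → SkewPowerSeries D := fun l => (fun m => b m l : ℕ → R)
  obtain ⟨E, hE, hE0, hE1⟩ := exists_seq_eq_of_mem_coboundaries hb
  have hd : ∀ m, dualMap (P.d j) (∑ l, tailSeq (g l) (s l) m) = 0 := fun m => by
    rw [map_sum]
    refine Finset.sum_eq_zero fun l _ => ?_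
    have : dualMap (P.d j) (g l) = 0 := hg l
    rw [tailSeq, map_smul, this, smul_zero]
  refine ⟨∑ l, op (s l) • g l, Submodule.sum_mem _ fun l _ => Submodule.smul_mem _ _ (hg l),
    fun m => A m + ∑ l, tailSeq (g l) (s l) m - E m, ?_, fun m => ?_, fun m => ?_⟩
  · rw [smul_sub, smul_add, hE0, Finset.smul_sum]
    simp only [op_t_smul_tailSeq_zero, Finset.sum_sub_distrib]
    show op (t : SkewPowerSeries D) • A 0 + (∑ l, op (s l) • g l -
      ∑ l, op (C (b 0 l)) • g l) - (op (t : SkewPowerSeries D) • A 0 -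
      ∑ l, op (C (b 0 l)) • g l) = _
    abel
  · rw [smul_sub, smul_add, hE1, Finset.smul_sum]
    simp only [op_t_smul_tailSeq_succ, Finset.sum_sub_distrib]
    show op (t : SkewPowerSeries D) • A (m + 1) + (∑ l, tailSeq (g l) (s l) m -
      ∑ l, op (C (b (m + 1) l)) • g l) - (E m + (op (t : SkewPowerSeries D) • A (m + 1) - A m -
      ∑ l, op (C (b (m + 1) l)) • g l)) = _
    abel
  · have h2 : dualMap (P.d j) (E m) = 0 := P.coboundaries_le_cocycles j (hE m)
    rw [map_sub, map_add, hd, h2, add_zero, sub_zero, hA]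

/-- There are no nonzero `S`-linear maps to `S` from an `S`-module finitely generated over `R`. -/
theorem linearMap_eq_zero (f : M →ₗ[SkewPowerSeries D] SkewPowerSeries D) : f = 0 := by
  obtain ⟨P⟩ := FGResolution.nonempty (D := D) (M := M)
  refine LinearMap.ext fun x => SkewPowerSeries.ext fun m => ?_
  obtain ⟨y, rfl⟩ := P.surjective x
  have h1 : dualMap (f ∘ₗ P.ε) (coeffDual m) = 0 :=
    dualMap_coeffDual_mem_coboundaries (P := P) (j := 0) (LinearMap.ext fun y => by
      show f (P.ε (P.d 0 y)) = 0
      rw [P.exact_zero.apply_apply_eq_zero, map_zero]) m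
  exact LinearMap.congr_fun (congrArg Subtype.val h1) y

end FGResolution

/-! ### Classes in Ext from resolutions by modules -/

namespace CategoryTheory.ProjectiveResolution

section OfExact

variable {Λ : Type u} [Ring Λ] {M : Type u} [AddCommGroup M] [Module Λ M] {X : ℕ → Type u}
  [∀ n, AddCommGroup (X n)] [∀ n, Module Λ (X n)]
  (d : ∀ n, X (n + 1) →ₗ[Λ] X n) (ε : X 0 →ₗ[Λ] M) (hε : Function.Surjective ε)
  (h₀ : Function.Exact (d 0) ε) (h : ∀ n, Function.Exact (d (n + 1)) (d n))

/-- The complex of modules underlying a resolution. -/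
noncomputable def complexOfExact : ChainComplex (ModuleCat.{u} Λ) ℕ :=
  ChainComplex.of (fun n => ModuleCat.of Λ (X n)) (fun n => ModuleCat.ofHom (d n)) fun n => by
    ext x
    exact (h n).apply_apply_eq_zero x

theorem complexOfExact_d (n : ℕ) :
    (complexOfExact d h).d (n + 1) n = ModuleCat.ofHom (d n) :=
  ChainComplex.of_d (fun n => ModuleCat.of Λ (X n)) (fun n => ModuleCat.ofHom (d n)) n

theorem complexOfExact_exactAt_succ (n : ℕ) : (complexOfExact d h).ExactAt (n + 1) := by
  rw [HomologicalComplex.exactAt_iff' _ (n + 1 + 1) (n + 1) n (by simp) (by simp),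
    ShortComplex.ShortExact.moduleCat_exact_iff_function_exact]
  show Function.Exact ((complexOfExact d h).d (n + 1 + 1) (n + 1))
    ((complexOfExact d h).d (n + 1) n)
  rw [complexOfExact_d, complexOfExact_d]
  exact h n

variable [∀ n, Module.Projective Λ (X n)]

/-- The projective resolution given by an exact sequence of projective modules. -/
noncomputable def ofExact : ProjectiveResolution (ModuleCat.of Λ M) where
  complex := complexOfExact d h
  projective n := inferInstanceAs (Projective (ModuleCat.of Λ (X n)))
  π := (ChainComplex.toSingle₀Equiv _ _).symm ⟨ModuleCat.ofHom ε, by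
    rw [complexOfExact_d]
    ext x
    exact h₀.apply_apply_eq_zero x⟩
  quasiIso := ⟨fun n => by
    cases n
    · rw [ChainComplex.quasiIsoAt₀_iff, ShortComplex.quasiIso_iff_of_zeros']
      · refine ⟨?_, ?_⟩
        · rw [ShortComplex.ShortExact.moduleCat_exact_iff_function_exact]
          have h1 : Function.Exact ((complexOfExact d h).d 1 0) ε := by
            rw [complexOfExact_d]
            exact h₀
          exact h1
        · exact (ModuleCat.epi_iff_surjective (ModuleCat.ofHom ε)).2 hε
      all_goals rfl
    · rw [quasiIsoAt_iff_exactAt']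
      · apply complexOfExact_exactAt_succ
      · apply ChainComplex.exactAt_succ_single_obj⟩

variable {d ε hε h₀ h}

theorem ofExact_d (n : ℕ) :
    (ofExact d ε hε h₀ h).complex.d (n + 1) n = ModuleCat.ofHom (d n) :=
  complexOfExact_d d h n

end OfExact

/-- In degree zero there are no nonzero coboundaries. -/
theorem extMk_zero_eq_zero_iff {Λ : Type u} [Ring Λ] {M Y : ModuleCat.{u} Λ}
    (Q : ProjectiveResolution M) (f : Q.complex.X 0 ⟶ Y) (hf : Q.complex.d 1 0 ≫ f = 0) :
    Q.extMk f 1 rfl hf = 0 ↔ f = 0 := by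
  refine ⟨fun h => ?_, fun h => by subst h; exact Q.extMk_zero 1 rfl⟩
  rw [← Q.extEquivCohomologyClass.apply_eq_iff_eq,
    extEquivCohomologyClass_extMk, extEquivCohomologyClass_zero,
    CochainComplex.HomComplex.CohomologyClass.mk_eq_zero_iff,
    CochainComplex.HomComplex.Cocycle.toSingleMk_mem_coboundaries_iff _ _ _ _ _ 1 (by simp)] at h
  obtain ⟨g, hg⟩ := h
  have : Q.cochainComplex.d (-((0 : ℕ) : ℤ)) 1 = 0 :=
    (CochainComplex.isZero_of_isStrictlyLE Q.cochainComplex 0 1).eq_of_tgt _ _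
  rw [this, Limits.zero_comp] at hg
  rw [← cancel_epi (Q.cochainComplexXIso (-0) 0 rfl).hom]
  exact hg.symm.trans Limits.comp_zero.symm

end CategoryTheory.ProjectiveResolution

section OfExact

open CategoryTheory CategoryTheory.Abelian

variable {Λ : Type u} [Ring Λ] {M : Type u} [AddCommGroup M] [Module Λ M] {X : ℕ → Type u}
  [∀ n, AddCommGroup (X n)] [∀ n, Module Λ (X n)] [∀ n, Module.Projective Λ (X n)]
  {d : ∀ n, X (n + 1) →ₗ[Λ] X n} {ε : X 0 →ₗ[Λ] M} (hε : Function.Surjective ε)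
  (h₀ : Function.Exact (d 0) ε) (h : ∀ n, Function.Exact (d (n + 1)) (d n))
  {Y : Type u} [AddCommGroup Y] [Module Λ Y]

/-- Linear maps on the `n`-th term of the resolution, as morphisms in the category of modules. -/
noncomputable def ofExactHom {n : ℕ} :
    (X n →ₗ[Λ] Y) ≃+
      ((ProjectiveResolution.ofExact d ε hε h₀ h).complex.X n ⟶ ModuleCat.of Λ Y) where
  toFun f := (ModuleCat.ofHom f : ModuleCat.of Λ (X n) ⟶ ModuleCat.of Λ Y)
  invFun f := ModuleCat.Hom.hom (A := ModuleCat.of Λ (X n)) f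
  map_add' _ _ := rfl

theorem d_comp_ofExactHom {n : ℕ} (f : X n →ₗ[Λ] Y) :
    (ProjectiveResolution.ofExact d ε hε h₀ h).complex.d (n + 1) n ≫ ofExactHom hε h₀ h f =
      ofExactHom hε h₀ h (f ∘ₗ d n) :=
  congrArg (fun g : ModuleCat.of Λ (X (n + 1)) ⟶ ModuleCat.of Λ (X n) =>
    g ≫ (ModuleCat.ofHom f : ModuleCat.of Λ (X n) ⟶ ModuleCat.of Λ Y))
    (ProjectiveResolution.ofExact_d (hε := hε) (h₀ := h₀) (h := h) n)

/-- The class in `Ext^n` of a linear map on the `n`-th term of a resolution by projective modules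
which vanishes on the image of the differential. -/
noncomputable def extClass {n : ℕ} (f : X n →ₗ[Λ] Y) (hf : f ∘ₗ d n = 0) :
    Ext (ModuleCat.of Λ M) (ModuleCat.of Λ Y) n :=
  (ProjectiveResolution.ofExact d ε hε h₀ h).extMk (ofExactHom hε h₀ h f) (n + 1) rfl (by
    rw [d_comp_ofExactHom, hf, map_zero])

theorem extClass_eq_add {n : ℕ} {f g k : X n →ₗ[Λ] Y} (hf : f ∘ₗ d n = 0) (hg : g ∘ₗ d n = 0)
    (hk : k ∘ₗ d n = 0) (hfg : k = f + g) :
    extClass hε h₀ h k hk = extClass hε h₀ h f hf + extClass hε h₀ h g hg := by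
  subst hfg
  rw [extClass, extClass, extClass, ProjectiveResolution.add_extMk]
  simp only [map_add]

theorem extClass_sub {n : ℕ} {f g : X n →ₗ[Λ] Y} (hf : f ∘ₗ d n = 0) (hg : g ∘ₗ d n = 0)
    (hfg : (f - g) ∘ₗ d n = 0) :
    extClass hε h₀ h (f - g) hfg = extClass hε h₀ h f hf - extClass hε h₀ h g hg := by
  rw [extClass, extClass, extClass, ProjectiveResolution.sub_extMk]
  simp only [map_sub]

theorem extClass_eq_zero_iff_zero {f : X 0 →ₗ[Λ] Y} (hf : f ∘ₗ d 0 = 0) :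
    extClass hε h₀ h f hf = 0 ↔ f = 0 := by
  rw [extClass, ProjectiveResolution.extMk_zero_eq_zero_iff, map_eq_zero_iff _
    (ofExactHom hε h₀ h).injective]

theorem extClass_eq_zero_iff_succ {n : ℕ} {f : X (n + 1) →ₗ[Λ] Y} (hf : f ∘ₗ d (n + 1) = 0) :
    extClass hε h₀ h f hf = 0 ↔ ∃ g : X n →ₗ[Λ] Y, f = g ∘ₗ d n := by
  rw [extClass, ProjectiveResolution.extMk_eq_zero_iff _ _ _ _ _ n rfl,
    (ofExactHom hε h₀ h).surjective.exists]
  simp only [d_comp_ofExactHom, EmbeddingLike.apply_eq_iff_eq, eq_comm]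

theorem extClass_surjective {n : ℕ} (e : Ext (ModuleCat.of Λ M) (ModuleCat.of Λ Y) n) :
    ∃ (f : X n →ₗ[Λ] Y) (hf : f ∘ₗ d n = 0), extClass hε h₀ h f hf = e := by
  obtain ⟨f, hf, rfl⟩ := (ProjectiveResolution.ofExact d ε hε h₀ h).extMk_surjective e (n + 1) rfl
  obtain ⟨f, rfl⟩ := (ofExactHom hε h₀ h).surjective f
  refine ⟨f, ?_, rfl⟩
  rwa [d_comp_ofExactHom, map_eq_zero_iff _ (ofExactHom hε h₀ h).injective] at hf

/-- Right multiplication of cocycles with values in the ring induces the right module structure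
on `Ext`. -/
theorem extClass_eq_op_smul {n : ℕ} {f g : X n →ₗ[Λ] Λ} (hf : f ∘ₗ d n = 0)
    (hg : g ∘ₗ d n = 0) (a : Λ) (hfg : g = LinearMap.toSpanSingleton Λ Λ a ∘ₗ f) :
    extClass hε h₀ h g hg = MulOpposite.op a • extClass hε h₀ h f hf := by
  subst hfg
  refine Eq.symm ?_
  show (extClass hε h₀ h f hf).comp (Ext.mk₀ (ModuleCat.ofHom
    (LinearMap.toSpanSingleton Λ Λ a))) (add_zero n) = _
  rw [extClass, ProjectiveResolution.extMk_comp_mk₀]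
  rfl

/-- An arbitrary projective resolution maps to the given one over the identity, and classes can be
computed from either of them. -/
theorem exists_lift_extMk_eq_extClass (Q : ProjectiveResolution (ModuleCat.of Λ M)) :
    ∃ α : ∀ n, Q.complex.X n →ₗ[Λ] X n,
      (∀ n (x : Q.complex.X (n + 1)), α n ((Q.complex.d (n + 1) n).hom x) = d n (α (n + 1) x)) ∧
      (∀ x : Q.complex.X 0, ε (α 0 x) = (Q.π.f 0 ≫
        (HomologicalComplex.singleObjXSelf (.down ℕ) 0 (ModuleCat.of Λ M)).hom).hom x) ∧
      ∀ (n : ℕ) (f : X n →ₗ[Λ] Y) (hf : f ∘ₗ d n = 0) (g : Q.complex.X n →ₗ[Λ] Y)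
        (hg : Q.complex.d (n + 1) n ≫ ModuleCat.ofHom g = 0), f ∘ₗ α n = g →
        Q.extMk (ModuleCat.ofHom g) (n + 1) rfl hg = extClass hε h₀ h f hf := by
  let Q₀ := ProjectiveResolution.ofExact d ε hε h₀ h
  let α : Q.Hom Q₀ (𝟙 _) :=
    { hom := ProjectiveResolution.lift (𝟙 _) Q Q₀
      hom_f_zero_comp_π_f_zero := ProjectiveResolution.lift_commutes_zero _ _ _ }
  let β : ∀ n, Q.complex.X n →ₗ[Λ] X n := fun n =>
    ModuleCat.Hom.hom (B := ModuleCat.of Λ (X n)) (α.hom.f n)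
  refine ⟨β, fun n x => ?_, fun x => ?_, fun n f hf g hg hfg => ?_⟩
  · have h1 := (α.hom.comm (n + 1) n).symm
    have h2 : Q₀.complex.d (n + 1) n = _ := ProjectiveResolution.ofExact_d n
    rw [h2] at h1
    exact LinearMap.congr_fun (congrArg (ModuleCat.Hom.hom (B := ModuleCat.of Λ (X n))) h1) x
  · have h1 := α.hom_f_zero_comp_π_f_zero
    exact LinearMap.congr_fun (congrArg (ModuleCat.Hom.hom (B := ModuleCat.of Λ M)) h1) x
  · have h1 := ProjectiveResolution.mk₀_comp_extMk (ofExactHom hε h₀ h f) (n + 1) rfl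
      (by rw [d_comp_ofExactHom, hf, map_zero]) α
    rw [Ext.mk₀_id_comp] at h1
    subst hfg
    exact h1.symm

variable {M' : Type u} [AddCommGroup M'] [Module Λ M'] {X' : ℕ → Type u}
  [∀ n, AddCommGroup (X' n)] [∀ n, Module Λ (X' n)] [∀ n, Module.Projective Λ (X' n)]
  {d' : ∀ n, X' (n + 1) →ₗ[Λ] X' n} {ε' : X' 0 →ₗ[Λ] M'} (hε' : Function.Surjective ε')
  (h₀' : Function.Exact (d' 0) ε') (h' : ∀ n, Function.Exact (d' (n + 1)) (d' n))

/-- The map on `Ext` induced by a linear map is computed by a morphism of resolutions over it. -/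
theorem mk₀_comp_extClass (g : M →ₗ[Λ] M') (G : ∀ n, X n →ₗ[Λ] X' n)
    (hG : ∀ n, G n ∘ₗ d n = d' n ∘ₗ G (n + 1)) (hGε : g ∘ₗ ε = ε' ∘ₗ G 0) {n : ℕ}
    {f : X' n →ₗ[Λ] Y} (hf : f ∘ₗ d' n = 0) (hf' : (f ∘ₗ G n) ∘ₗ d n = 0) :
    (Ext.mk₀ (ModuleCat.ofHom g)).comp (extClass hε' h₀' h' f hf) (zero_add n) =
      extClass hε h₀ h (f ∘ₗ G n) hf' := by
  let Φ : (ProjectiveResolution.ofExact d ε hε h₀ h).Hom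
      (ProjectiveResolution.ofExact d' ε' hε' h₀' h') (ModuleCat.ofHom g) :=
    { hom :=
        { f := fun n => (ModuleCat.ofHom (G n) : ModuleCat.of Λ (X n) ⟶ ModuleCat.of Λ (X' n))
          comm' := by
            rintro _ n rfl
            have h1 : (ModuleCat.ofHom (G (n + 1)) : ModuleCat.of Λ (X (n + 1)) ⟶
                ModuleCat.of Λ (X' (n + 1))) ≫ ModuleCat.ofHom (d' n) =
                  ModuleCat.ofHom (d n) ≫ ModuleCat.ofHom (G n) := ModuleCat.hom_ext (hG n).symm
            rw [← ProjectiveResolution.ofExact_d (hε := hε) (h₀ := h₀) (h := h) n,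
              ← ProjectiveResolution.ofExact_d (hε := hε') (h₀ := h₀') (h := h') n] at h1
            exact h1 }
      hom_f_zero_comp_π_f_zero := by
        have h1 : (ModuleCat.ofHom (G 0) : ModuleCat.of Λ (X 0) ⟶ ModuleCat.of Λ (X' 0)) ≫
            ModuleCat.ofHom ε' = ModuleCat.ofHom ε ≫ ModuleCat.ofHom g :=
          ModuleCat.hom_ext hGε.symm
        exact h1 }
  rw [extClass, ProjectiveResolution.mk₀_comp_extMk _ _ _ _ Φ]
  rfl

end OfExact

/-- Two surjective linear maps with the same kernel have isomorphic targets. -/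
theorem LinearMap.exists_linearEquiv_of_ker_eq {Λ A B E : Type*} [Ring Λ] [AddCommGroup A]
    [Module Λ A] [AddCommGroup B] [Module Λ B] [AddCommGroup E] [Module Λ E] (p : A →ₗ[Λ] B)
    (q : A →ₗ[Λ] E) (hp : Function.Surjective p) (hq : Function.Surjective q)
    (h : LinearMap.ker p = LinearMap.ker q) : ∃ c : B ≃ₗ[Λ] E, ∀ x, c (p x) = q x := by
  refine ⟨(p.quotKerEquivOfSurjective hp).symm.trans ((Submodule.quotEquivOfEq _ _ h).trans
    (q.quotKerEquivOfSurjective hq)), fun x => ?_⟩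
  have h1 : (p.quotKerEquivOfSurjective hp).symm (p x) = Submodule.Quotient.mk x :=
    (LinearEquiv.symm_apply_eq _).2 rfl
  rw [LinearEquiv.trans_apply, h1]
  rfl

/-- Two surjective additive maps with the same kernel have isomorphic targets. -/
theorem AddMonoidHom.exists_addEquiv_of_ker_eq {A B E : Type*} [AddCommGroup A] [AddCommGroup B]
    [AddCommGroup E] (p : A →+ B) (q : A →+ E) (hp : Function.Surjective p)
    (hq : Function.Surjective q) (h : ∀ x, p x = 0 ↔ q x = 0) :
    ∃ c : B ≃+ E, ∀ x, c (p x) = q x := by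
  obtain ⟨c, hc⟩ := LinearMap.exists_linearEquiv_of_ker_eq p.toIntLinearMap q.toIntLinearMap hp hq
    (Submodule.ext h)
  exact ⟨c.toAddEquiv, hc⟩

namespace FGResolution

open CategoryTheory CategoryTheory.Abelian SkewPowerSeries MulOpposite

variable {R : Type u} [Ring R] [UniformSpace R] [PseudocompactRing R] [IsNoetherianRing R]
  {D : SkewDatum R}

section Underlying

variable {M : Type u} [AddCommGroup M] [Module R M] [Module (SkewPowerSeries D) M]
  [IsScalarTower R (SkewPowerSeries D) M] {P : FGResolution D M}

/-- The class of a cocycle does not depend on the morphism of complexes, since any two such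
morphisms are homotopic. -/
theorem Lift.extClass_eq_extClass {Q : ProjectiveResolution (ModuleCat.of R M)} (φ φ' : P.Lift Q)
    (j : ℕ) (z : P.cocycles j) : φ.extClass j z = φ'.extClass j z := by
  have : ∀ n, Module.Projective R (Q.complex.X n) := fun n =>
    (IsProjective.iff_projective (Q.complex.X n)).2 (Q.projective n)
  obtain ⟨h, -, h0, h1⟩ := exists_homotopy_of_lift
    (X := fun n => Q.complex.X n) (Y := P.X) (dX := fun n => (Q.complex.d (n + 1) n).hom)
    (dY := P.dR) (εY := P.εR) (f := fun n => φ.hom n - φ'.hom n)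
    (fun n x => LinearMap.congr_fun (congrArg ModuleCat.Hom.hom
      (Q.complex.d_comp_d (n + 2) (n + 1) n)) x)
    (fun x => by
      show P.ε (φ.hom 0 x - φ'.hom 0 x) = 0
      rw [map_sub, φ.comm_ε, φ'.comm_ε, sub_self])
    (fun n x => by
      show φ.hom n _ - φ'.hom n _ = P.d n (φ.hom (n + 1) x - φ'.hom (n + 1) x)
      rw [map_sub, φ.comm, φ'.comm])
    (fun _ _ => True)
    (fun hf => by
      obtain ⟨g, hg⟩ := exists_lift_of_exact (α := P.dR 0) (β := P.εR) P.exact_zero hf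
      exact ⟨g, trivial, hg⟩)
    (fun n f _ hf => by
      obtain ⟨g, hg⟩ := exists_lift_of_exact (α := P.dR (n + 1)) (β := P.dR n) (P.exact_succ n) hf
      exact ⟨g, trivial, hg⟩)
  rw [← sub_eq_zero]
  refine (Q.sub_extMk _ _ _ _ _ _).trans ?_
  rcases j with _ | j
  · rw [ProjectiveResolution.extMk_zero_eq_zero_iff]
    ext x
    show (z : ContDual D (P.X 0)).1 (φ.hom 0 x) - (z : ContDual D (P.X 0)).1 (φ'.hom 0 x) = 0
    rw [← map_sub]
    exact (congrArg (z : ContDual D (P.X 0)).1 (h0 x)).trans (apply_d_of_mem_cocycles z.2 _)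
  · rw [ProjectiveResolution.extMk_eq_zero_iff _ _ _ _ _ j rfl]
    refine ⟨ModuleCat.ofHom ((z : ContDual D (P.X (j + 1))).1 ∘ₗ h j), ?_⟩
    ext x
    have h2 := congrArg (z : ContDual D (P.X (j + 1))).1 (h1 j x)
    rw [map_add] at h2
    have h3 : (z : ContDual D (P.X (j + 1))).1 (P.dR (j + 1) (h (j + 1) x)) = 0 :=
      apply_d_of_mem_cocycles z.2 _
    rw [h3, zero_add] at h2
    exact h2.symm.trans (map_sub _ _ _)

variable [IsNoetherianRing Rᵐᵒᵖ] [IsNoetherianRing (SkewPowerSeries D)]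

/-- The underlying group of the twisted `Ext` is the usual one: the comparison with a resolution by
finitely generated free `R`-modules is bijective on cohomology. -/
theorem exists_twistedExt_addEquiv [Module.Finite R M] (P : FGResolution D M) (j : ℕ) :
    ∃ c : P.TwistedExt j ≃+ Ext (ModuleCat.of R M) (ModuleCat.of R R) j,
      (∀ (Q : ProjectiveResolution (ModuleCat.of R M)) (φ : P.Lift Q)
        (z : P.cocycles j), c (P.toExt j z) = φ.extClass j z) ∧
      ∀ (a : R) (x : P.TwistedExt j),
        c (op (C a : SkewPowerSeries D) • x) = op (D.σ.symm a) • c x := by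
  obtain ⟨Q⟩ := FreeResolution.nonempty R M
  obtain ⟨k⟩ := nonempty_comparison P Q
  have hc : ∀ z : P.cocycles j, ((z : ContDual D (P.X j)).1 ∘ₗ k.φ j) ∘ₗ Q.d j = 0 := fun z =>
    LinearMap.mem_ker.1 (k.mem_cocycles z.2)
  let q₀ : P.cocycles j → Ext (ModuleCat.of R M) (ModuleCat.of R R) j := fun z =>
    extClass (X := fun n => Fin (Q.rank n) → R) Q.surjective Q.exact_zero Q.exact_succ
      ((z : ContDual D (P.X j)).1 ∘ₗ k.φ j) (hc z)
  have hadd : ∀ z z', q₀ (z + z') = q₀ z + q₀ z' := fun z z' => by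
    refine extClass_eq_add (X := fun n => Fin (Q.rank n) → R) Q.surjective Q.exact_zero
      Q.exact_succ (hc z) (hc z') (hc (z + z')) ?_
    exact LinearMap.add_comp _ _ _
  let q : P.cocycles j →+ Ext (ModuleCat.of R M) (ModuleCat.of R R) j := AddMonoidHom.mk' q₀ hadd
  have hzero : ∀ (f : (Fin (Q.rank j) → R) →ₗ[R] R) (hf : f ∘ₗ Q.d j = 0),
      extClass (X := fun n => Fin (Q.rank n) → R) Q.surjective Q.exact_zero Q.exact_succ f hf = 0 ↔
        f ∈ Q.coboundaries j := by
    intro f hf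
    rcases j with _ | j
    · exact extClass_eq_zero_iff_zero (X := fun n => Fin (Q.rank n) → R) _ _ _ hf
    · exact (extClass_eq_zero_iff_succ (X := fun n => Fin (Q.rank n) → R) _ _ _ hf).trans
        ⟨fun ⟨g, hg⟩ => ⟨g, hg.symm⟩, fun ⟨g, hg⟩ => ⟨g, hg.symm⟩⟩
  have hker : ∀ z : P.cocycles j, P.toExt j z = 0 ↔ q z = 0 := fun z =>
    (Submodule.Quotient.mk_eq_zero _).trans (Iff.trans
      ⟨k.mem_coboundaries, k.mem_coboundaries_of_comp z.2⟩ (hzero _ (hc z)).symm)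
  have hsurj : Function.Surjective q := fun e => by
    obtain ⟨y, hy, rfl⟩ := extClass_surjective (X := fun n => Fin (Q.rank n) → R) Q.surjective
      Q.exact_zero Q.exact_succ e
    obtain ⟨z, hz, hzy⟩ := k.exists_mem_cocycles (j := j) (y := y) (LinearMap.mem_ker.2 hy)
    refine ⟨⟨z, hz⟩, sub_eq_zero.1 ?_⟩
    refine (extClass_sub (X := fun n => Fin (Q.rank n) → R) Q.surjective Q.exact_zero Q.exact_succ
      (hc ⟨z, hz⟩) hy ?_).symm.trans ((hzero _ _).2 hzy)
    rw [LinearMap.sub_comp, hy, sub_zero]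
    exact hc ⟨z, hz⟩
  obtain ⟨c, hcq⟩ := AddMonoidHom.exists_addEquiv_of_ker_eq (P.toExt j).toAddMonoidHom q
    (Submodule.mkQ_surjective _) hsurj hker
  refine ⟨c, fun Q' φ z => ?_, fun a x => ?_⟩
  · obtain ⟨α, hα, hαε, hext⟩ := exists_lift_extMk_eq_extClass (Y := R)
      (X := fun n => Fin (Q.rank n) → R) Q.surjective Q.exact_zero Q.exact_succ Q'
    let φ' : P.Lift Q' :=
      { hom := fun n => k.φ n ∘ₗ α n
        comm := fun n x => by
          show k.φ n (α n _) = _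
          rw [hα, k.φ_comm]
          rfl
        comm_ε := fun x => (k.φ_ε _).trans (hαε x) }
    rw [φ.extClass_eq_extClass φ']
    have h1 : c (P.toExt j z) = q z := hcq z
    rw [h1]
    exact (hext j _ (hc z) _ _ rfl).symm
  · obtain ⟨z, rfl⟩ := Submodule.mkQ_surjective _ x
    have h1 : c (P.toExt j (op (C a : SkewPowerSeries D) • z)) = q (op (C a) • z) := hcq _
    have h2 : c (P.toExt j z) = q z := hcq z
    refine h1.trans (Eq.trans ?_ (congrArg (op (D.σ.symm a) • ·) h2.symm))
    exact extClass_eq_op_smul (X := fun n => Fin (Q.rank n) → R) Q.surjective Q.exact_zero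
      Q.exact_succ (hc z) (hc _) (D.σ.symm a)
      (LinearMap.ext fun x => op_C_smul_apply a (z : ContDual D (P.X j)) (k.φ j x))

end Underlying

end FGResolution

/-! ### The connecting isomorphism -/

namespace FGResolution

open CategoryTheory CategoryTheory.Abelian MulOpposite

variable {R : Type u} [Ring R] [UniformSpace R] [PseudocompactRing R] [IsNoetherianRing R]
  {D : SkewDatum R} [IsNoetherianRing (SkewPowerSeries D)]

section Naturality

variable {M M' : Type u} [AddCommGroup M] [Module (SkewPowerSeries D) M] [AddCommGroup M']
  [Module (SkewPowerSeries D) M'] {P : FGResolution D M} {P' : FGResolution D M'}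
  {g : M →ₗ[SkewPowerSeries D] M'} {j : ℕ}

/-- Naturality of the connecting homomorphism. -/
theorem IsConnecting.comp_hom (G : P.Hom P' g) {z : ContDual D (P'.X j)}
    {F : P'.X (j + 1) →ₗ[SkewPowerSeries D] SkewPowerSeries D} (h : IsConnecting z F) :
    IsConnecting (dualMap (G.hom j) z) (F ∘ₗ G.hom (j + 1)) := by
  obtain ⟨E, hE0, hE, hEF⟩ := h
  refine ⟨fun m => dualMap (G.hom j) (E m), ?_, fun m => ?_, fun m => ?_⟩
  · rw [← map_smul, hE0]
  · rw [← map_smul, hE]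
  · rw [dualMap_comp_coeffDual, ← hEF]
    refine contDual_ext fun x => ?_
    simp only [dualMap_apply, G.comm]

end Naturality

variable [IsNoetherianRing Rᵐᵒᵖ] {M : Type u} [AddCommGroup M] [Module R M]
  [Module (SkewPowerSeries D) M] [IsScalarTower R (SkewPowerSeries D) M] [Module.Finite R M]

/-- The connecting homomorphism from the cohomology of the continuous duals to `Ext_S(M, S)` is an
isomorphism. -/
theorem exists_connectingEquiv (P : FGResolution D M) (j : ℕ) :
    ∃ θ : Ext (ModuleCat.of (SkewPowerSeries D) M)
        (ModuleCat.of (SkewPowerSeries D) (SkewPowerSeries D)) (j + 1)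
          ≃ₗ[(SkewPowerSeries D)ᵐᵒᵖ] P.TwistedExt j,
      ∀ (z : P.cocycles j) (F : P.X (j + 1) →ₗ[SkewPowerSeries D] SkewPowerSeries D)
        (hF : F ∘ₗ P.d (j + 1) = 0), IsConnecting (z : ContDual D (P.X j)) F →
        θ (extClass (X := P.X) P.surjective P.exact_zero P.exact_succ F hF) = P.toExt j z := by
  choose Φ hΦ using fun z : P.cocycles j => IsConnecting.exists z.2
  have hΦd := fun z => (hΦ z).comp_d_eq_zero
  -- the class does not depend on the choice of the linear map
  have huniq : ∀ (z : P.cocycles j) (F : P.X (j + 1) →ₗ[SkewPowerSeries D] SkewPowerSeries D)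
      (hF : F ∘ₗ P.d (j + 1) = 0), IsConnecting (z : ContDual D (P.X j)) F →
      extClass (X := P.X) P.surjective P.exact_zero P.exact_succ F hF =
        extClass (X := P.X) P.surjective P.exact_zero P.exact_succ (Φ z) (hΦd z) := by
    intro z F hF h
    have h1 := h.sub (hΦ z)
    rw [sub_self] at h1
    obtain ⟨F₀, hF₀⟩ := h1.exists_of_mem_coboundaries (Submodule.zero_mem _)
    rw [← sub_eq_zero, ← extClass_sub (X := P.X) _ _ _ _ _ h1.comp_d_eq_zero]
    exact (extClass_eq_zero_iff_succ (X := P.X) _ _ _ _).2 ⟨F₀, hF₀⟩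
  let q : P.cocycles j →ₗ[(SkewPowerSeries D)ᵐᵒᵖ] Ext (ModuleCat.of (SkewPowerSeries D) M)
      (ModuleCat.of (SkewPowerSeries D) (SkewPowerSeries D)) (j + 1) :=
    { toFun := fun z => extClass (X := P.X) P.surjective P.exact_zero P.exact_succ (Φ z) (hΦd z)
      map_add' := fun z z' => by
        have h := (hΦ z).add (hΦ z')
        rw [← huniq (z + z') _ h.comp_d_eq_zero h]
        exact extClass_eq_add (X := P.X) _ _ _ _ _ _ rfl
      map_smul' := fun s z => by
        have h := (hΦ z).op_smul z.2 s.unop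
        rw [← huniq (s • z) _ h.comp_d_eq_zero h]
        exact extClass_eq_op_smul (X := P.X) _ _ _ _ _ _ rfl }
  have hker : LinearMap.ker (P.toExt j) = LinearMap.ker q := by
    ext z
    rw [LinearMap.mem_ker, LinearMap.mem_ker]
    refine (Submodule.Quotient.mk_eq_zero _).trans (Iff.trans ?_
      (extClass_eq_zero_iff_succ (X := P.X) _ _ _ (hΦd z)).symm)
    exact ⟨(hΦ z).exists_of_mem_coboundaries, fun ⟨_, h⟩ => (hΦ z).mem_coboundaries z.2 h⟩
  have hsurj : Function.Surjective q := fun e => by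
    obtain ⟨F, hF, rfl⟩ := extClass_surjective (X := P.X) P.surjective P.exact_zero P.exact_succ e
    obtain ⟨z, hz, h⟩ := IsConnecting.exists_of_comp_d_eq_zero hF
    exact ⟨⟨z, hz⟩, (huniq ⟨z, hz⟩ F hF h).symm⟩
  obtain ⟨θ, hθ⟩ := LinearMap.exists_linearEquiv_of_ker_eq q (P.toExt j) hsurj
    (Submodule.mkQ_surjective _) hker.symm
  refine ⟨θ, fun z F hF h => ?_⟩
  rw [huniq z F hF h]
  exact hθ z

end FGResolution

namespace FGResolution

open CategoryTheory CategoryTheory.Abelian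

variable {R : Type u} [Ring R] [UniformSpace R] [PseudocompactRing R] [IsNoetherianRing R]
  {D : SkewDatum R} [IsNoetherianRing (SkewPowerSeries D)] [IsNoetherianRing Rᵐᵒᵖ]
  {M : Type u} [AddCommGroup M] [Module R M] [Module (SkewPowerSeries D) M]
  [IsScalarTower R (SkewPowerSeries D) M] [Module.Finite R M]

/-- The inverse of the connecting homomorphism. -/
noncomputable def connectingEquiv (P : FGResolution D M) (j : ℕ) :
    Ext (ModuleCat.of (SkewPowerSeries D) M)
      (ModuleCat.of (SkewPowerSeries D) (SkewPowerSeries D)) (j + 1)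
        ≃ₗ[(SkewPowerSeries D)ᵐᵒᵖ] P.TwistedExt j :=
  (exists_connectingEquiv P j).choose

theorem connectingEquiv_apply (P : FGResolution D M) {j : ℕ} (z : P.cocycles j)
    {F : P.X (j + 1) →ₗ[SkewPowerSeries D] SkewPowerSeries D} (hF : F ∘ₗ P.d (j + 1) = 0)
    (h : IsConnecting (z : ContDual D (P.X j)) F) :
    connectingEquiv P j (extClass (X := P.X) P.surjective P.exact_zero P.exact_succ F hF) =
      P.toExt j z :=
  (exists_connectingEquiv P j).choose_spec z F hF h

/-- The connecting isomorphism is natural: a morphism of resolutions maps the sequences computing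
the connecting homomorphism for one to those for the other. -/
theorem connectingEquiv_mk₀_comp {M' : Type u} [AddCommGroup M'] [Module R M']
    [Module (SkewPowerSeries D) M'] [IsScalarTower R (SkewPowerSeries D) M'] [Module.Finite R M']
    {g : M →ₗ[SkewPowerSeries D] M'} {P : FGResolution D M} {P' : FGResolution D M'}
    (G : P.Hom P' g) (j : ℕ) (e : Ext (ModuleCat.of (SkewPowerSeries D) M')
      (ModuleCat.of (SkewPowerSeries D) (SkewPowerSeries D)) (j + 1)) :
    connectingEquiv P j ((Ext.mk₀ (ModuleCat.ofHom g)).comp e (zero_add (j + 1))) =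
      G.map j (connectingEquiv P' j e) := by
  obtain ⟨F, hF, rfl⟩ := extClass_surjective (X := P'.X) P'.surjective P'.exact_zero P'.exact_succ e
  obtain ⟨z, hz, h⟩ := IsConnecting.exists_of_comp_d_eq_zero hF
  have h' := h.comp_hom G
  rw [connectingEquiv_apply P' ⟨z, hz⟩ hF h, mk₀_comp_extClass (X := P.X) (X' := P'.X)
    P.surjective P.exact_zero P.exact_succ P'.surjective P'.exact_zero P'.exact_succ g G.hom
    (fun n => LinearMap.ext (G.comm n)) (LinearMap.ext G.comm_ε) hF h'.comp_d_eq_zero]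
  exact connectingEquiv_apply P ⟨_, G.dualMap_mem_cocycles j hz⟩ _ h'

end FGResolution

end Opened

theorem proposition3p1 {R : Type u} [Ring R] [UniformSpace R] [PseudocompactRing R]
    [IsNoetherianRing R] [IsNoetherianRing Rᵐᵒᵖ] (D : SkewDatum R)
    [IsNoetherianRing (SkewPowerSeries D)] [IsNoetherianRing (SkewPowerSeries D)ᵐᵒᵖ] :
    -- `Hom_S(M, S) = 0`
    (∀ (M : Type u) [AddCommGroup M] [Module R M] [Module (SkewPowerSeries D) M]
      [IsScalarTower R (SkewPowerSeries D) M] [Module.Finite R M]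
      (f : M →ₗ[SkewPowerSeries D] SkewPowerSeries D), f = 0) ∧
    -- the right `S`-module `TwistedExt` is `Ext^j_R(M, R)`, with `R` acting through `σ⁻¹`
    (∀ (M : Type u) [AddCommGroup M] [Module R M] [Module (SkewPowerSeries D) M]
      [IsScalarTower R (SkewPowerSeries D) M] [Module.Finite R M]
      (P : FGResolution D M) (j : ℕ),
      ∃ c : P.TwistedExt j ≃+ CategoryTheory.Abelian.Ext (ModuleCat.of R M) (ModuleCat.of R R) j,
        (∀ (Q : CategoryTheory.ProjectiveResolution (ModuleCat.of R M)) (φ : P.Lift Q)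
          (z : P.cocycles j), c (P.toExt j z) = φ.extClass j z) ∧
        ∀ (a : R) (x : P.TwistedExt j),
          c (MulOpposite.op (SkewPowerSeries.C a : SkewPowerSeries D) • x) = MulOpposite.op (D.σ.symm a) • c x) ∧
    -- `Ext^{j+1}_S(M, S)` is naturally isomorphic to it as a right `S`-module
    ∃ θ : ∀ (M : Type u) [AddCommGroup M] [Module R M] [Module (SkewPowerSeries D) M]
        [IsScalarTower R (SkewPowerSeries D) M] [Module.Finite R M]
        (P : FGResolution D M) (j : ℕ),
        CategoryTheory.Abelian.Ext (ModuleCat.of (SkewPowerSeries D) M)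
          (ModuleCat.of (SkewPowerSeries D) (SkewPowerSeries D)) (j + 1)
          ≃ₗ[(SkewPowerSeries D)ᵐᵒᵖ] P.TwistedExt j,
      ∀ (M : Type u) [AddCommGroup M] [Module R M] [Module (SkewPowerSeries D) M]
        [IsScalarTower R (SkewPowerSeries D) M] [Module.Finite R M]
        (M' : Type u) [AddCommGroup M'] [Module R M'] [Module (SkewPowerSeries D) M']
        [IsScalarTower R (SkewPowerSeries D) M'] [Module.Finite R M']
        (g : M →ₗ[SkewPowerSeries D] M') (P : FGResolution D M) (P' : FGResolution D M')
        (G : P.Hom P' g) (j : ℕ)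
        (e : CategoryTheory.Abelian.Ext (ModuleCat.of (SkewPowerSeries D) M')
          (ModuleCat.of (SkewPowerSeries D) (SkewPowerSeries D)) (j + 1)),
        θ M P j ((CategoryTheory.Abelian.Ext.mk₀ (ModuleCat.ofHom g)).comp e
          (zero_add (j + 1))) = G.map j (θ M' P' j e) := by
  refine ⟨fun M _ _ _ _ _ f => FGResolution.linearMap_eq_zero f,
    fun M _ _ _ _ _ P j => P.exists_twistedExt_addEquiv j,
    fun M _ _ _ _ _ P j => P.connectingEquiv j, ?_⟩
  intro M _ _ _ _ _ M' _ _ _ _ _ g P P' G j e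
  exact FGResolution.connectingEquiv_mk₀_comp G j e
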